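/- All C*-algebras and $*$-homomorphisms are unital. A rational $*$-polynomial is a noncommutative $*$-polynomial with coefficients in $\mathbb Q(i)$ (constant terms allowed, the constant $1$ being interpreted as the unit). A rational relation is one of the form $\|p(\bar x)\|\le a$ with $p$ a rational $*$-polynomial and $a\ge 0$ a dyadic rational. For a set $\mathcal R$ of such relations on a countable (finite or infinite) sequence of generators $\bar x$, $C^*\langle\bar x\mid\mathcal R\rangle$ denotes the universal C*-algebra generated by elements satisfying $\mathcal R$. A *c.e. presentation* of a C*-algebra $B$ is an identification of $B$ with some $C^*\langle\bar x\mid\mathcal R\rangle$, where $\mathcal R$ is a computably enumerable set of rational relations containing, for each generator $x$, a relation $\|x\|\le M$. A presentation of $A$ by a generating sequence $\bar x$ is *computable* if there is an algorithm that, given a rational $*$-polynomial $q$ and $k\in\mathbb N$, returns a rational number $r$ with $\big|\,\|q(\bar x)\|-r\,\big|<2^{-k}$. A finitely c.e. presentation $A^\dagger=C^*\langle x_1,\dots,x_l\mid p_i(\bar x)=0\ (i\le N),\ \|x_k\|\le C_k\ (k\le l)\rangle$, with $p_i$ rational $*$-polynomials and $C_k\ge0$ dyadic rationals, is *computably weakly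 stable* if there is an algorithm that, given $n\in\mathbb N$, returns $m\in\mathbb N$ such that for every C*-algebra $B$ and all $z_1,\dots,z_l\in B$ with $\|p_i(\bar z)\|\le 2^{-m}$ for all $i$ and $\|z_k\|\le C_k+2^{-m}$ for all $k$, there is a $*$-homomorphism $\varphi:A\to B$ with $\|\varphi(x_k)-z_k\|<2^{-n}$ for all $k$. For a nonprincipal ultrafilter $\mathcal U$ on $\mathbb N$, the ultrapower $B^{\mathcal U}$ is the quotient of $\ell^\infty(\mathbb N,B)$ by the ideal of sequences $(b_n)$ with $\lim_{\mathcal U}\|b_n\|=0$. A C*-algebra $B$ is *locally universal* if every nonzero separable C*-algebra embeds into $B^{\mathcal U}$ for some nonprincipal ultrafilter $\mathcal U$ on $\mathbb N$. The Kirchberg Embedding Problem (KEP) asks whether the Cuntz algebra $\mathcal O_2=C^*\langle s_1,s_2\mid s_i^*s_j=\delta_{ij}1,\ s_1s_1^*+s_2s_2^*=1\rangle$ is locally universal. **Corollary.** If there exists a simple locally universal C*-algebra $B$ with a c.e. presentation, then every computably weakly stable presentation $A^\dagger$ of a C*-algebra $A$ is computable. Moreover, if KEP has a positive solution, then such a $B$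 exists (so that, in particular, every computably weakly stable presentation is then computable). -/

import Mathlib

open scoped Topology BoundedContinuousFunction

universe u

namespace CStarPres

section Polynomials

/-- Codes of rational `*`-monomials in the noncommuting variables `G`: the code `((a, b, d), w)`
stands for `((a + b i) / (d + 1)) • w`, where the word `w` is a list of letters; the letter
`(g, false)` is the variable `g`, the letter `(g, true)` is its adjoint, and the empty word is the
unit. -/
abbrev RatMonomial (G : Type) : Type := (ℤ × ℤ × ℕ) × List (G × Bool)

/-- Codes of rational `*`-polynomials (coefficients in `ℚ(i)`), as finite formal sums of
monomials. -/
abbrev RatPoly (G : Type) : Type := List (RatMonomial G)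

/-- The Gaussian rational with code `(a, b, d)`. -/
noncomputable def gaussVal (c : ℤ × ℤ × ℕ) : ℂ :=
  ((c.1 : ℂ) + (c.2.1 : ℂ) * Complex.I) / ((c.2.2 : ℂ) + 1)

/-- The rational number with code `(a, d)`, namely `a / (d + 1)`. -/
noncomputable def ratVal (c : ℤ × ℕ) : ℝ := (c.1 : ℝ) / ((c.2 : ℝ) + 1)

/-- The nonnegative dyadic rational with code `(a, b)`, namely `a / 2 ^ b`. -/
noncomputable def dyadicVal (c : ℕ × ℕ) : ℝ := (c.1 : ℝ) / 2 ^ c.2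

variable {G : Type} {A : Type u} [CStarAlgebra A]

/-- The value of a letter at the tuple `x`. -/
def letterVal (x : G → A) (l : G × Bool) : A := if l.2 then star (x l.1) else x l.1

/-- The value of a monomial at the tuple `x`. -/
noncomputable def monoVal (x : G → A) (m : RatMonomial G) : A :=
  gaussVal m.1 • (m.2.map (letterVal x)).prod

/-- The value `p(x)` of a rational `*`-polynomial at the tuple `x`. -/
noncomputable def polyVal (x : G → A) (p : RatPoly G) : A := (p.map (monoVal x)).sum

/-- The polynomial consisting of the single variable `g`. -/
def gen (g : G) : RatPoly G := [((1, 0, 0), [(g, false)])]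

end Polynomials

section Presentations

variable {G : Type} {A : Type u} [CStarAlgebra A]

/-- The family `a` generates `A` as a (unital) C*-algebra. -/
def IsPresentation (a : G → A) : Prop :=
  (StarAlgebra.adjoin ℂ (Set.range a)).topologicalClosure = ⊤

/-- The pair `(A, a)` is a computable presentation of `A`: `a` generates `A`, and there is an
algorithm which, given a rational point `p(a)` (through a code of `p`) and `k`, returns a rational
number `q` with `|‖p(a)‖ - q| < 2⁻ᵏ`. -/
def IsComputablePresentation [Primcodable G] (a : G → A) : Prop :=
  IsPresentation a ∧
    ∃ f : RatPoly G → ℕ → ℤ × ℕ, Computable₂ f ∧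
      ∀ p k, |‖polyVal a p‖ - ratVal (f p k)| < ((2 : ℝ) ^ k)⁻¹

/-- Rational relations: `(p, c)` stands for `‖p(x)‖ ≤ dyadicVal c`. -/
abbrev RatRelation (G : Type) : Type := RatPoly G × (ℕ × ℕ)

/-- `x` is a representation in `A` of the relations `R`. -/
def IsRepresentation (R : Set (RatRelation G)) (x : G → A) : Prop :=
  ∀ r ∈ R, ‖polyVal x r.1‖ ≤ dyadicVal r.2

/-- `(A, x)` is the universal C*-algebra `C*⟨G | R⟩` together with its canonical representation.
As everywhere here, C*-algebras and `*`-homomorphisms are unital. -/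
def IsUniversal (R : Set (RatRelation G)) (x : G → A) : Prop :=
  IsRepresentation R x ∧
    ∀ (B : Type u) [CStarAlgebra B] (y : G → B), IsRepresentation R y →
      ∃! φ : A →⋆ₐ[ℂ] B, ∀ g, φ (x g) = y g

/-- `(A, x)` is a c.e. presentation: the standard presentation `C*⟨G | R⟩` of a computably
enumerable set `R` of rational relations, in which every generator has a norm bound. -/
def IsCEPresentation [Primcodable G] (R : Set (RatRelation G)) (x : G → A) : Prop :=
  REPred (fun r => r ∈ R) ∧ (∀ g, ∃ c, (gen g, c) ∈ R) ∧ IsUniversal R x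

variable (A) in
/-- `A` has a c.e. presentation, on a finite or countably infinite sequence of generators. -/
def HasCEPresentation : Prop :=
  ∃ (G : Type) (_ : Primcodable G) (R : Set (RatRelation G)) (x : G → A), IsCEPresentation R x

end Presentations

section WeakStability

/-- The data of a finitely c.e. presentation
`C*⟨x₁, …, xₙ | pᵢ(x) = 0, ‖xₖ‖ ≤ Cₖ⟩`: the `pᵢ` are rational `*`-polynomials and the `Cₖ`
are nonnegative dyadic rationals. -/
structure FinPresData where
  /-- the number of generators -/
  numGens : ℕ
  /-- the polynomials `pᵢ` -/
  polys : List (RatPoly (Fin numGens))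
  /-- the codes of the bounds `Cₖ` -/
  bounds : Fin numGens → ℕ × ℕ

/-- The finite set of relations of a finitely c.e. presentation. -/
def FinPresData.rels (P : FinPresData) : Set (RatRelation (Fin P.numGens)) :=
  {r | (∃ p ∈ P.polys, r = (p, (0, 0))) ∨ ∃ k, r = (gen k, P.bounds k)}

variable {A : Type u} [CStarAlgebra A]

/-- `(A, x)` is the finitely c.e. presentation with data `P`. -/
def IsFinCEPresentation (P : FinPresData) (x : Fin P.numGens → A) : Prop :=
  IsUniversal P.rels x

/-- The finitely c.e. presentation `(A, x)` with data `P` is computably weakly stable. -/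
def IsComputablyWeaklyStable (P : FinPresData) (x : Fin P.numGens → A) : Prop :=
  IsFinCEPresentation P x ∧
    ∃ f : ℕ → ℕ, Computable f ∧
      ∀ (n : ℕ) (B : Type u) [CStarAlgebra B] (z : Fin P.numGens → B),
        (∀ p ∈ P.polys, ‖polyVal z p‖ ≤ ((2 : ℝ) ^ f n)⁻¹) →
        (∀ k, ‖z k‖ ≤ dyadicVal (P.bounds k) + ((2 : ℝ) ^ f n)⁻¹) →
          ∃ φ : A →⋆ₐ[ℂ] B, ∀ k, ‖φ (x k) - z k‖ < ((2 : ℝ) ^ n)⁻¹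

end WeakStability

section Ultrapowers

variable (U : Ultrafilter ℕ) (B : Type u) [CStarAlgebra B]

/-- The ideal of `ℓ^∞(ℕ, B)` of all bounded sequences `f` with `lim_U ‖f n‖ = 0`. -/
noncomputable def nullIdeal : TwoSidedIdeal (ℕ →ᵇ B) :=
  .mk' {f | Filter.Tendsto (fun n => ‖f n‖) U (𝓝 0)}
    (by simp)
    (by
      intro f g hf hg
      refine squeeze_zero (fun n => norm_nonneg _) (fun n => norm_add_le (f n) (g n)) ?_
      simpa using Filter.Tendsto.add hf hg)
    (by intro f hf; simpa using hf)
    (by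
      intro f g hg
      refine squeeze_zero (fun n => norm_nonneg _)
        (fun n => (norm_mul_le (f n) (g n)).trans
          (mul_le_mul_of_nonneg_right (f.norm_coe_le_norm n) (norm_nonneg _))) ?_
      simpa using Filter.Tendsto.const_mul ‖f‖ hg)
    (by
      intro f g hf
      refine squeeze_zero (fun n => norm_nonneg _)
        (fun n => (norm_mul_le (f n) (g n)).trans
          (mul_le_mul_of_nonneg_left (g.norm_coe_le_norm n) (norm_nonneg _))) ?_
      simpa using Filter.Tendsto.mul_const ‖g‖ hf)

theorem mem_nullIdeal {f : ℕ →ᵇ B} :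
    f ∈ nullIdeal U B ↔ Filter.Tendsto (fun n => ‖f n‖) U (𝓝 0) := by
  simp [nullIdeal, TwoSidedIdeal.mem_mk']

/-- The ultrapower of `B` with respect to `U`: the quotient of `ℓ^∞(ℕ, B)` by the ideal of
sequences that tend to `0` in norm along `U`. -/
abbrev Ultrapower : Type u := (nullIdeal U B).ringCon.Quotient

theorem nullIdeal_star {f g : ℕ →ᵇ B} (h : (nullIdeal U B).ringCon f g) :
    (nullIdeal U B).ringCon (star f) (star g) := by
  rw [TwoSidedIdeal.rel_iff, mem_nullIdeal] at h ⊢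
  simpa [← star_sub] using h

/-- The involution of the ultrapower, induced by the pointwise involution. -/
noncomputable instance : StarRing (Ultrapower U B) where
  star := Quotient.map' star (fun _ _ h => nullIdeal_star U B h)
  star_involutive := by
    rintro ⟨f⟩
    exact congrArg (nullIdeal U B).ringCon.mk' (star_star f)
  star_mul := by
    rintro ⟨f⟩ ⟨g⟩
    exact congrArg (nullIdeal U B).ringCon.mk' (star_mul f g)
  star_add := by
    rintro ⟨f⟩ ⟨g⟩
    exact congrArg (nullIdeal U B).ringCon.mk' (star_add f g)

theorem star_mk (f : ℕ →ᵇ B) :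
    star ((nullIdeal U B).ringCon.mk' f) = (nullIdeal U B).ringCon.mk' (star f) := rfl

/-- `C` embeds into the ultrapower of `B` with respect to `U`: there is an injective (unital)
`*`-homomorphism. -/
def EmbedsInUltrapower (C : Type u) [CStarAlgebra C] : Prop :=
  ∃ φ : C →⋆ₐ[ℂ] Ultrapower U B, Function.Injective φ

/-- `B` is locally universal: every nonzero separable C*-algebra embeds into an ultrapower of `B`
with respect to a nonprincipal ultrafilter on `ℕ`. -/
def IsLocallyUniversal : Prop :=
  ∀ (C : Type u) [CStarAlgebra C] [Nontrivial C] [TopologicalSpace.SeparableSpace C],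
    ∃ U : Ultrafilter ℕ, (∀ n, U ≠ pure n) ∧ EmbedsInUltrapower U B C

/-- `B` is simple as a C*-algebra: it is nonzero and has no closed two-sided ideals besides `0`
and `B`. -/
def IsSimpleCStar : Prop :=
  Nontrivial B ∧ ∀ I : TwoSidedIdeal B, IsClosed (I : Set B) → I = ⊥ ∨ I = ⊤

end Ultrapowers

section Cuntz

/-- The data of the standard presentation of the Cuntz algebra `𝒪₂`, namely
`C*⟨s₀, s₁ | s₀*s₀ = 1, s₁*s₁ = 1, s₀*s₁ = 0, s₁*s₀ = 0, s₀s₀* + s₁s₁* = 1, ‖s₀‖, ‖s₁‖ ≤ 1⟩`. -/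
def cuntzTwo : FinPresData where
  numGens := 2
  polys :=
    [ [((1, 0, 0), [(0, true), (0, false)]), ((-1, 0, 0), [])],
      [((1, 0, 0), [(1, true), (1, false)]), ((-1, 0, 0), [])],
      [((1, 0, 0), [(0, true), (1, false)])],
      [((1, 0, 0), [(1, true), (0, false)])],
      [((1, 0, 0), [(0, false), (0, true)]), ((1, 0, 0), [(1, false), (1, true)]),
        ((-1, 0, 0), [])] ]
  bounds := fun _ => (1, 0)

/-- A positive solution of the Kirchberg Embedding Problem: the Cuntz algebra `𝒪₂` is locally
universal. -/
def KirchbergEmbedding : Prop :=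
  ∃ (O : Type u) (_ : CStarAlgebra O) (s : Fin 2 → O),
    IsFinCEPresentation cuntzTwo s ∧ IsLocallyUniversal O

end Cuntz

end CStarPres

/-! A presentation is computable as soon as the strict upper and the strict lower dyadic bounds of
the norms of its rational points are both enumerable (`REPred.isComputablePresentation`).

Upper bounds are enumerable for every c.e. presentation. The bounds obtained from the relations by
the triangle inequality, submultiplicativity, the C*-identity and the isometry of the involution
form an enumerable set. Their infimum is a C*-seminorm on the free `*`-algebra over the Gaussian
rationals, and its completion is a C*-algebra representing the relations (`exists_representation`).
By universality this infimum is the universal norm (`IsUniversal.norm_polyVal_lt_iff`).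

Lower bounds are enumerable when `B` is simple. Imposing `‖p‖ ≤ c` on `B` defines a quotient of `B`,
hence `B` or zero. It is zero exactly when `c < ‖p(y)‖`, and this shows up as a derivation of `‖1‖ ≤
1/2` (`lt_norm_polyVal_iff_derivable`).

Lower bounds for the weakly stable `A` are found by searching in `B`
(`IsComputablyWeaklyStable.rePred_lt_norm`). One looks for `n` and a tuple of rational points of `B`
that satisfies the relations up to the tolerance prescribed for `n`, and at which `p` has norm above
`c + Λ 2⁻ⁿ`, with `Λ` a Lipschitz constant of `p`. Such a tuple is `2⁻ⁿ`-close to the image of the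
generators under a contractive homomorphism `A → B`, so it proves `c < ‖p(x)‖`. Conversely, when `c
< ‖p(x)‖`, an embedding of `A` in an ultrapower of `B` and the density of rational points provide
such a tuple.

For the second assertion only the simplicity of `𝒪₂` is missing. Let `b = a*a` be nonzero in an
ideal. Averaging the gauge action over roots of unity sends a polynomial approximation of `b` to its
part of degree zero, which lies in a matrix algebra and stays bounded away from zero. An eigenvector
of that matrix, followed by a word whose shifts are orthogonal, compresses the whole polynomial to a
nonzero scalar (`IsCuntzPair.exists_compress`). The same compression turns `b` into an invertible
element of the ideal (`one_mem_of_ne_zero_mem`). -/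

namespace CStarPres

/-! ### Completing a C*-seminorm to a C*-algebra. -/

section Completion

open UniformSpace

/-- The completion of a `*`-ring with a C*-seminorm, whose scalars come from a dense subring of
`ℂ`, is a C*-algebra. -/
theorem exists_cstarAlgebra_completion {V : Type u} [Ring V] [StarRing V]
    (N : RingSeminorm V) (hstar : ∀ v, N (star v) = N v)
    (hcstar : ∀ v, N v * N v ≤ N (star v * v))
    {K : Type*} [NormedRing K] [StarRing K] (j : K →+* ℂ) (hj : Isometry j) (hd : DenseRange j)
    (hjs : ∀ c, j (star c) = star (j c)) (κ : K →+* V) (hκ : ∀ c, N (κ c) ≤ ‖c‖)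
    (hκc : ∀ c v, κ c * v = v * κ c) (hκs : ∀ c, κ (star c) = star (κ c)) :
    ∃ (C : Type u) (_ : CStarAlgebra C) (ι : V →+* C),
      (∀ v, ι (star v) = star (ι v)) ∧ (∀ c, ι (κ c) = algebraMap ℂ C (j c)) ∧
        ∀ v, ‖ι v‖ = N v := by
  let _ : SeminormedRing V := N.toSeminormedRing
  let C := Completion V
  let ι : V →+* C := Completion.coeRingHom
  have hsu : UniformContinuous (star : V → V) := by
    refine (LipschitzWith.of_dist_le_mul (K := 1) fun x y => ?_).uniformContinuous
    rw [dist_eq_norm, dist_eq_norm, ← star_sub]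
    exact (hstar _).trans_le (one_mul _).ge
  have hsc : Continuous (Completion.map (star : V → V)) := Completion.continuous_map
  have hsm : ∀ v : V, Completion.map (star : V → V) (v : C) = ((star v : V) : C) := fun v =>
    Completion.map_coe hsu v
  let _ : StarRing C :=
    { star := Completion.map star
      star_involutive := fun x => by
        refine Completion.induction_on x ?_ fun a => ?_
        · exact isClosed_eq (hsc.comp hsc) continuous_id
        · rw [hsm, hsm, star_star]
      star_mul := fun x y => by
        refine Completion.induction_on₂ x y ?_ fun a b => ?_
        · exact isClosed_eq (hsc.comp (continuous_fst.mul continuous_snd))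
            ((hsc.comp continuous_snd).mul (hsc.comp continuous_fst))
        · rw [← Completion.coe_mul, hsm, hsm, hsm, star_mul, Completion.coe_mul]
      star_add := fun x y => by
        refine Completion.induction_on₂ x y ?_ fun a b => ?_
        · exact isClosed_eq (hsc.comp (continuous_fst.add continuous_snd))
            ((hsc.comp continuous_fst).add (hsc.comp continuous_snd))
        · rw [← Completion.coe_add, hsm, hsm, hsm, star_add, Completion.coe_add] }
  have hst : ∀ v : V, star (v : C) = ((star v : V) : C) := hsm
  have hstc : Continuous (star : C → C) := hsc
  have : CStarRing C :=
    { norm_mul_self_le := fun x => by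
        refine Completion.induction_on x ?_ fun a => ?_
        · exact isClosed_le (by fun_prop) (continuous_norm.comp (hstc.mul continuous_id))
        · rw [hst, ← Completion.coe_mul, Completion.norm_coe, Completion.norm_coe]
          exact hcstar a }
  let f : K →+* C := ι.comp κ
  have hfu : UniformContinuous f := by
    refine AddMonoidHomClass.uniformContinuous_of_bound f 1 fun c => ?_
    rw [one_mul]
    exact (Completion.norm_coe (κ c)).trans_le (hκ c)
  -- Complex scalars will act through multiplication by `F c`, the continuous extension of `κ` along
  -- the dense embedding `j`; centrality, contractivity and `*`-compatibility of `F` follow by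
  -- density.
  let F : ℂ →+* C := IsDenseInducing.extendRingHom hj.isUniformInducing hd hfu
  have hFc : Continuous F :=
    (uniformContinuous_uniformly_extend hj.isUniformInducing hd hfu).continuous
  have hF : ∀ c, F (j c) = (κ c : C) := fun c =>
    IsDenseInducing.extend_eq (hj.isUniformInducing.isDenseInducing hd) hfu.continuous c
  have hFcomm : ∀ (c : ℂ) (x : C), F c * x = x * F c := fun c x => by
    refine Completion.induction_on x ?_ fun a => ?_
    · exact isClosed_eq (by fun_prop) (by fun_prop)
    · refine hd.induction_on c ?_ fun c => ?_
      · exact isClosed_eq (by fun_prop) (by fun_prop)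
      · rw [hF, ← Completion.coe_mul, hκc, Completion.coe_mul]
  have hFn : ∀ c : ℂ, ‖F c‖ ≤ ‖c‖ := fun c => by
    refine hd.induction_on c ?_ fun c => ?_
    · exact isClosed_le (by fun_prop) (by fun_prop)
    · rw [hF, Completion.norm_coe, hj.norm_map_of_map_zero (map_zero j)]
      exact hκ c
  have hFs : ∀ c : ℂ, F (star c) = star (F c) := fun c => by
    refine hd.induction_on c ?_ fun c => ?_
    · exact isClosed_eq (hFc.comp continuous_star) (hstc.comp hFc)
    · rw [← hjs, hF, hF, hst, hκs]
  let _ : NormedAlgebra ℂ C :=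
    { F.toAlgebra' hFcomm with
      norm_smul_le := fun c x => by
        change ‖F c * x‖ ≤ _
        exact (norm_mul_le _ _).trans (mul_le_mul_of_nonneg_right (hFn c) (norm_nonneg _)) }
  have hsmul : ∀ (c : ℂ) (x : C), c • x = F c * x := fun _ _ => rfl
  have : StarModule ℂ C :=
    { star_smul := fun c x => by
        rw [hsmul, hsmul, star_mul, ← hFs, hFcomm] }
  exact ⟨C, { }, ι, fun v => (hst v).symm, fun c => (hF c).symm, fun v => Completion.norm_coe v⟩

end Completion


/-! ### Closure properties of recursively enumerable predicates. -/

section RecursivelyEnumerable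

variable {α β γ θ : Type*} [Primcodable α] [Primcodable β] [Primcodable θ]

theorem rePred_exists_nat {q : α × ℕ → Prop} (hq : ComputablePred q) :
    REPred fun a => ∃ n, q (a, n) := by
  obtain ⟨f, hf, rfl⟩ := ComputablePred.computable_iff.1 hq
  have h : Partrec fun a => Nat.rfind fun n => (Part.some (f (a, n)) : Part Bool) :=
    Partrec.rfind (hf.partrec : Partrec fun x : α × ℕ => (Part.some (f x) : Part Bool))
  refine h.dom_re.of_eq fun a => Nat.rfind_dom.trans ?_
  simp

/-- Kleene normal form: the witness is a bound for the step-limited evaluation `evaln` of a code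
that halts exactly on the predicate. -/
theorem rePred_iff_exists_primrecPred {p : α → Prop} :
    REPred p ↔ ∃ q : α × ℕ → Prop, PrimrecPred q ∧ ∀ a, p a ↔ ∃ n, q (a, n) := by
  constructor
  · intro h
    obtain ⟨c, hc⟩ := Nat.Partrec.Code.exists_code.1 h
    refine ⟨fun x => ((Nat.Partrec.Code.evaln x.2 c (Encodable.encode x.1)).isSome = true), ?_, ?_⟩
    · refine Primrec.eq.comp (Primrec.option_isSome.comp ?_) (Primrec.const true)
      exact Nat.Partrec.Code.primrec_evaln.comp
        ((Primrec.snd.pair (Primrec.const c)).pair (Primrec.encode.comp Primrec.fst))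
    · intro a
      have h1 : p a ↔ (c.eval (Encodable.encode a)).Dom := by
        rw [hc]
        simp [Encodable.encodek, Part.assert]
      rw [h1, Part.dom_iff_mem]
      simp only [Nat.Partrec.Code.evaln_complete, Option.isSome_iff_exists, Option.mem_def]
      exact exists_comm
  · rintro ⟨q, hq, h⟩
    exact (rePred_exists_nat hq.computablePred).of_eq fun a => (h a).symm

theorem _root_.REPred.comp {p : β → Prop} (hp : REPred p) {f : α → β} (hf : Computable f) :
    REPred fun a => p (f a) :=
  Partrec.comp hp hf

/-- Dovetailing: a single natural number codes a candidate `b` together with the witness that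
verifies it. -/
theorem _root_.REPred.exists {p : α × β → Prop} (hp : REPred p) : REPred fun a => ∃ b, p (a, b) := by
  obtain ⟨q, hq, h⟩ := rePred_iff_exists_primrecPred.1 hp
  have hd : Computable fun x : α × ℕ => (Encodable.decode x.2.unpair.1 : Option β) :=
    (Primrec.decode.comp (Primrec.fst.comp (Primrec.unpair.comp Primrec.snd))).to_comp
  obtain ⟨f, hf, rfl⟩ := ComputablePred.computable_iff.1 hq.computablePred
  have hf' : Computable₂ fun (x : α × ℕ) (b : β) => f ((x.1, b), x.2.unpair.2) :=
    hf.comp (((Computable.fst.comp Computable.fst).pair Computable.snd).pair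
      (Primrec.snd.comp (Primrec.unpair.comp (Primrec.snd.comp Primrec.fst))).to_comp)
  have hg := Computable.option_casesOn hd (Computable.const false) hf'
  refine (rePred_exists_nat (ComputablePred.computable_iff.2 ⟨_, hg, rfl⟩)).of_eq fun a => ?_
  simp only [h]
  constructor
  · rintro ⟨n, hn⟩
    cases hb : (Encodable.decode n.unpair.1 : Option β) with
    | none => simp [hb] at hn
    | some b => exact ⟨b, n.unpair.2, by simpa [hb] using hn⟩
  · rintro ⟨b, n, hn⟩
    exact ⟨Nat.pair (Encodable.encode b) n, by simpa using hn⟩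

theorem _root_.REPred.and {p q : α → Prop} (hp : REPred p) (hq : REPred q) :
    REPred fun a => p a ∧ q a := by
  obtain ⟨p', hp', h⟩ := rePred_iff_exists_primrecPred.1 hp
  obtain ⟨q', hq', h'⟩ := rePred_iff_exists_primrecPred.1 hq
  have h1 : PrimrecPred fun x : (α × ℕ) × ℕ => p' (x.1.1, x.1.2) ∧ q' (x.1.1, x.2) :=
    (hp'.comp Primrec.fst).and (hq'.comp ((Primrec.fst.comp Primrec.fst).pair Primrec.snd))
  refine (REPred.exists (REPred.exists h1.computablePred.to_re)).of_eq fun a => ?_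
  simp [h, h']

theorem _root_.REPred.or {p q : α → Prop} (hp : REPred p) (hq : REPred q) :
    REPred fun a => p a ∨ q a := by
  obtain ⟨p', hp', h⟩ := rePred_iff_exists_primrecPred.1 hp
  obtain ⟨q', hq', h'⟩ := rePred_iff_exists_primrecPred.1 hq
  refine (REPred.exists (hp'.or hq').computablePred.to_re).of_eq fun a => ?_
  simp [h, h', exists_or]

/-- The list is fixed, so no uniformity in its members is needed and they need not be coded. -/
theorem _root_.REPred.forall_mem_list (l : List γ) {p : γ → α → Prop} (hp : ∀ c ∈ l, REPred (p c)) :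
    REPred fun a => ∀ c ∈ l, p c a := by
  induction l with
  | nil =>
    refine (PrimrecPred.computablePred (Primrec.eq.comp (Primrec.const 0)
      (Primrec.const (α := α) 0))).to_re.of_eq fun a => by simp
  | cons c l ih =>
    refine ((hp c (by simp)).and (ih fun d hd => hp d (by simp [hd]))).of_eq fun a => by simp

/-- A recursively enumerable total relation has a computable choice function. -/
theorem _root_.REPred.exists_computable_choice {p : α × β → Prop} (hp : REPred p)
    (h : ∀ a, ∃ b, p (a, b)) : ∃ f : α → β, Computable f ∧ ∀ a, p (a, f a) := by
  obtain ⟨q, hq, hpq⟩ := rePred_iff_exists_primrecPred.1 hp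
  obtain ⟨f, hf, rfl⟩ := ComputablePred.computable_iff.1 hq.computablePred
  -- The number `n` is read as a candidate and a witness, and the candidate is returned only if the
  -- witness checks; the choice function takes the first success.
  let g : α → ℕ → Option β := fun a n =>
    (Encodable.decode n.unpair.1 : Option β).bind fun b =>
      bif f ((a, b), n.unpair.2) then some b else none
  have hg : Computable₂ g := by
    refine Computable.option_bind
      (Primrec.decode.comp (Primrec.fst.comp (Primrec.unpair.comp Primrec.snd))).to_comp ?_
    refine Computable.cond (hf.comp ?_) (Computable.option_some.comp Computable.snd)
      (Computable.const none)
    exact (((Computable.fst.comp Computable.fst).pair Computable.snd).pair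
      (Primrec.snd.comp (Primrec.unpair.comp (Primrec.snd.comp Primrec.fst))).to_comp)
  have hgs : ∀ a n b, b ∈ g a n → p (a, b) := by
    intro a n b hb
    simp only [g, Option.mem_def, Option.bind_eq_some_iff] at hb
    obtain ⟨b', -, hb'⟩ := hb
    cases hc : f ((a, b'), n.unpair.2) <;> simp only [hc, cond_true, cond_false] at hb'
    · cases hb'
    · cases hb'
      exact (hpq _).2 ⟨_, hc⟩
  have hgt : ∀ a, ∃ n, (g a n).isSome := by
    intro a
    obtain ⟨b, hb⟩ := h a
    obtain ⟨n, hn⟩ := (hpq _).1 hb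
    exact ⟨Nat.pair (Encodable.encode b) n, by simp [g, hn]⟩
  have hdom : ∀ a, (Nat.rfindOpt (g a)).Dom := fun a => by
    rw [Nat.rfindOpt_dom]
    obtain ⟨n, hn⟩ := hgt a
    obtain ⟨b, hb⟩ := Option.isSome_iff_exists.1 hn
    exact ⟨n, b, hb⟩
  refine ⟨fun a => (Nat.rfindOpt (g a)).get (hdom a), ?_, fun a => ?_⟩
  · exact (Partrec.rfindOpt hg).of_eq_tot fun a => Part.get_mem _
  · obtain ⟨n, hn⟩ := Nat.rfindOpt_spec (Part.get_mem (hdom a))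
    exact hgs _ _ _ hn

/-- The closure of `B` under the ternary rule `S`. -/
inductive Closure {α : Type*} (B : α → Prop) (S : α → α → α → Prop) : α → Prop
  | base {a : α} : B a → Closure B S a
  | step {a b c : α} : Closure B S a → Closure B S b → S a b c → Closure B S c

open Classical in
/-- One step of the enumeration of the closure: the candidate coded by `n` is added to the list `L`
if it is found to be a base element or to follow from elements of `L`. -/
noncomputable def closureStep (q : (θ × α) × ℕ → Prop) (S : α → α → α → Prop) (t : θ) (n : ℕ)
    (L : List α) : List α :=
  Option.casesOn (motive := fun _ => List α) (Encodable.decode n.unpair.1 : Option (α × ℕ)) L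
    fun x => if q ((t, x.1), x.2) ∨ ∃ a ∈ L, ∃ b ∈ L, S a b x.1 then x.1 :: L else L

/-- The list of the elements of the closure found after `n` steps of the enumeration. -/
noncomputable def closureStage (q : (θ × α) × ℕ → Prop) (S : α → α → α → Prop) (t : θ) (n : ℕ) :
    List α :=
  Nat.rec [] (closureStep q S t) n

open Classical in
theorem closureStage_primrec {q : (θ × α) × ℕ → Prop} (hq : PrimrecPred q)
    {S : α → α → α → Prop} (hS : PrimrecPred fun x : α × α × α => S x.1 x.2.1 x.2.2) :
    Primrec₂ (closureStage q S) := by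
  have h1 : PrimrecRel fun (b : α) (y : α × α) => S y.1 b y.2 :=
    PrimrecPred.primrecRel (p := fun z : α × α × α => S z.2.1 z.1 z.2.2)
      (hS.comp ((Primrec.fst.comp Primrec.snd).pair
        (Primrec.fst.pair (Primrec.snd.comp Primrec.snd))))
  have h2 : PrimrecRel fun (a : α) (y : List α × α) => ∃ b ∈ y.1, S a b y.2 :=
    PrimrecRel.comp (R := fun (L : List α) (y : α × α) => ∃ b ∈ L, S y.1 b y.2) h1.exists_mem_list
      (Primrec.fst.comp Primrec.snd) (Primrec.fst.pair (Primrec.snd.comp Primrec.snd))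
  have h3 : PrimrecRel fun (L : List α) (c : α) => ∃ a ∈ L, ∃ b ∈ L, S a b c :=
    PrimrecRel.comp (R := fun (L : List α) (y : List α × α) => ∃ a ∈ L, ∃ b ∈ y.1, S a b y.2)
      h2.exists_mem_list Primrec.fst Primrec.id
  refine Primrec.nat_rec (f := fun _ : θ => ([] : List α))
    (g := fun t y => closureStep q S t y.1 y.2) (Primrec.const _) ?_
  have hL : Primrec fun y : θ × ℕ × List α => y.2.2 := Primrec.snd.comp Primrec.snd
  refine Primrec.option_casesOn (Primrec.decode.comp (Primrec.fst.comp (Primrec.unpair.comp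
    (Primrec.fst.comp Primrec.snd)))) hL ?_
  have hx : Primrec fun y : (θ × ℕ × List α) × α × ℕ => y.2.1 := Primrec.fst.comp Primrec.snd
  refine Primrec.ite (PrimrecPred.or ?_ ?_) ?_ ?_
  · exact hq.comp ((((Primrec.fst.comp Primrec.fst).pair hx)).pair
      (Primrec.snd.comp Primrec.snd))
  · exact h3.comp (hL.comp Primrec.fst) hx
  · exact Primrec.list_cons.comp hx (hL.comp Primrec.fst)
  · exact hL.comp Primrec.fst

omit [Primcodable θ] in
-- Only the first component of `n` matters, so each candidate is tried again at arbitrarily late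
-- stages, after its premises have been found.
theorem closureStage_succ_mem {q : (θ × α) × ℕ → Prop} {S : α → α → α → Prop} {t : θ} {n m : ℕ}
    {c : α} (hn : n.unpair.1 = Encodable.encode (c, m))
    (h : q ((t, c), m) ∨ ∃ a ∈ closureStage q S t n, ∃ b ∈ closureStage q S t n, S a b c) :
    c ∈ closureStage q S t (n + 1) := by
  change c ∈ closureStep q S t n (closureStage q S t n)
  rw [closureStep, hn, Encodable.encodek]
  simp only
  rw [if_pos h]
  simp

omit [Primcodable θ] in
theorem closureStage_mono {q : (θ × α) × ℕ → Prop} {S : α → α → α → Prop} {t : θ} {n m : ℕ}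
    (h : n ≤ m) {c : α} (hc : c ∈ closureStage q S t n) : c ∈ closureStage q S t m := by
  induction h with
  | refl => exact hc
  | @step m _ ih =>
    change c ∈ closureStep q S t m (closureStage q S t m)
    rw [closureStep]
    cases (Encodable.decode m.unpair.1 : Option (α × ℕ)) with
    | none => exact ih
    | some x =>
      simp only
      split_ifs
      · exact List.mem_cons_of_mem _ ih
      · exact ih

omit [Primcodable θ] in
theorem closure_iff_exists_closureStage {B : θ → α → Prop} {q : (θ × α) × ℕ → Prop}
    (hB : ∀ t a, B t a ↔ ∃ n, q ((t, a), n)) {S : α → α → α → Prop} {t : θ} {c : α} :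
    Closure (B t) S c ↔ ∃ n, c ∈ closureStage q S t n := by
  constructor
  · intro h
    induction h with
    | @base c h =>
      obtain ⟨m, hm⟩ := (hB _ _).1 h
      exact ⟨Nat.pair (Encodable.encode (c, m)) 0 + 1,
        closureStage_succ_mem (m := m) (by simp) (.inl hm)⟩
    | @step a b c _ _ h iha ihb =>
      obtain ⟨n, hn⟩ := iha
      obtain ⟨m, hm⟩ := ihb
      -- The padding `max n m` makes the stage at least as late as `n` and `m`, when both premises
      -- are already listed.
      refine ⟨Nat.pair (Encodable.encode (c, 0)) (max n m) + 1,
        closureStage_succ_mem (m := 0) (by simp) (.inr ⟨a, ?_, b, ?_, h⟩)⟩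
      · exact closureStage_mono ((le_max_left n m).trans (Nat.right_le_pair _ _)) hn
      · exact closureStage_mono ((le_max_right n m).trans (Nat.right_le_pair _ _)) hm
  · rintro ⟨n, hn⟩
    induction n generalizing c with
    | zero => cases hn
    | succ n ih =>
      change c ∈ closureStep q S t n (closureStage q S t n) at hn
      rw [closureStep] at hn
      cases hx : (Encodable.decode n.unpair.1 : Option (α × ℕ)) with
      | none => rw [hx] at hn; exact ih hn
      | some x =>
        rw [hx] at hn
        simp only at hn
        split_ifs at hn with h
        · rcases List.mem_cons.1 hn with rfl | hn
          · rcases h with h | ⟨a, ha, b, hb, h⟩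
            · exact .base ((hB _ _).2 ⟨_, h⟩)
            · exact .step (ih ha) (ih hb) h
          · exact ih hn
        · exact ih hn

/-- Lying in the closure means lying in some finite stage, and the stages are primitive recursive
uniformly in the parameter. -/
theorem _root_.REPred.closure {B : θ → α → Prop} (hB : REPred fun x : θ × α => B x.1 x.2)
    {S : α → α → α → Prop} (hS : PrimrecPred fun x : α × α × α => S x.1 x.2.1 x.2.2) :
    REPred fun x : θ × α => Closure (B x.1) S x.2 := by
  obtain ⟨q, hq, h⟩ := rePred_iff_exists_primrecPred.1 hB
  have h1 : PrimrecPred fun y : (θ × α) × ℕ => ∃ a ∈ closureStage q S y.1.1 y.2, a = y.1.2 :=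
    PrimrecRel.comp (R := fun (L : List α) b => ∃ a ∈ L, a = b) Primrec.eq.exists_mem_list
      ((closureStage_primrec hq hS).comp (Primrec.fst.comp Primrec.fst) Primrec.snd)
      (Primrec.snd.comp Primrec.fst)
  refine (rePred_exists_nat h1.computablePred).of_eq fun x => ?_
  rw [closure_iff_exists_closureStage fun t a => h (t, a)]
  simp

end RecursivelyEnumerable


/-! ### Primitive recursive integer arithmetic. -/

section IntegerArithmetic

/-- Nonnegative integers have even codes and negative ones odd codes, so positive and negative parts
can be read off by parity and halving. -/
theorem encode_int_natCast (n : ℕ) : Encodable.encode (n : ℤ) = 2 * n := rfl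

theorem encode_int_negSucc (n : ℕ) : Encodable.encode (Int.negSucc n) = 2 * n + 1 := rfl

theorem primrec_int_natCast : Primrec fun n : ℕ => (n : ℤ) :=
  Primrec.encode_iff.1 (Primrec.nat_double.of_eq encode_int_natCast)

theorem primrec_int_negSucc : Primrec fun n : ℕ => Int.negSucc n :=
  Primrec.encode_iff.1 (Primrec.nat_double_succ.of_eq encode_int_negSucc)

theorem primrec_int_toNat : Primrec Int.toNat := by
  refine (Primrec.cond (Primrec.nat_bodd.comp Primrec.encode) (Primrec.const 0)
    (Primrec.nat_div2.comp Primrec.encode)).of_eq fun z => ?_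
  cases z with
  | ofNat n =>
    rw [Int.ofNat_eq_natCast, encode_int_natCast]
    simp [Nat.div2_val]
  | negSucc n => rw [encode_int_negSucc]; simp

theorem primrec_int_toNat_neg : Primrec fun z : ℤ => (-z).toNat := by
  refine (Primrec.cond (Primrec.nat_bodd.comp Primrec.encode)
    (Primrec.succ.comp (Primrec.nat_div2.comp Primrec.encode)) (Primrec.const 0)).of_eq fun z => ?_
  cases z with
  | ofNat n =>
    rw [Int.ofNat_eq_natCast, encode_int_natCast]
    simp
  | negSucc n => rw [encode_int_negSucc]; simp [Nat.div2_val]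

/-- Every integer is the difference of its positive and negative parts, so sums, negatives and
products all reduce to this case. -/
theorem primrec_int_subNat : Primrec₂ fun a b : ℕ => (a : ℤ) - b := by
  refine (Primrec.ite (c := fun x : ℕ × ℕ => x.2 ≤ x.1)
    (Primrec.nat_le.comp Primrec.snd Primrec.fst)
    (primrec_int_natCast.comp (Primrec.nat_sub.comp Primrec.fst Primrec.snd))
    (primrec_int_negSucc.comp (Primrec.pred.comp
      (Primrec.nat_sub.comp Primrec.snd Primrec.fst)))).of_eq fun x => ?_
  split_ifs with h
  · exact Nat.cast_sub h
  · change Int.negSucc (x.2 - x.1 - 1) = (x.1 : ℤ) - x.2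
    rw [Int.negSucc_eq]
    omega

theorem primrec_int_add : Primrec₂ fun a b : ℤ => a + b := by
  refine (primrec_int_subNat.comp
    (Primrec.nat_add.comp (primrec_int_toNat.comp Primrec.fst) (primrec_int_toNat.comp Primrec.snd))
    (Primrec.nat_add.comp (primrec_int_toNat_neg.comp Primrec.fst)
      (primrec_int_toNat_neg.comp Primrec.snd))).of_eq fun x => ?_
  push_cast
  omega

theorem primrec_int_neg : Primrec fun a : ℤ => -a := by
  refine (primrec_int_subNat.comp primrec_int_toNat_neg primrec_int_toNat).of_eq fun x => ?_
  omega

theorem primrec_int_mul : Primrec₂ fun a b : ℤ => a * b := by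
  have hp : Primrec fun x : ℤ × ℤ => x.1.toNat := primrec_int_toNat.comp Primrec.fst
  have hq : Primrec fun x : ℤ × ℤ => x.2.toNat := primrec_int_toNat.comp Primrec.snd
  have hp' : Primrec fun x : ℤ × ℤ => (-x.1).toNat := primrec_int_toNat_neg.comp Primrec.fst
  have hq' : Primrec fun x : ℤ × ℤ => (-x.2).toNat := primrec_int_toNat_neg.comp Primrec.snd
  refine (primrec_int_subNat.comp
    (Primrec.nat_add.comp (Primrec.nat_mul.comp hp hq) (Primrec.nat_mul.comp hp' hq'))
    (Primrec.nat_add.comp (Primrec.nat_mul.comp hp hq') (Primrec.nat_mul.comp hp' hq))).of_eq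
    fun x => ?_
  have h1 : x.1 = x.1.toNat - (-x.1).toNat := by omega
  have h2 : x.2 = x.2.toNat - (-x.2).toNat := by omega
  conv_rhs => rw [h1, h2]
  push_cast
  ring

theorem primrec_int_natAbs : Primrec Int.natAbs := by
  refine (Primrec.nat_add.comp primrec_int_toNat primrec_int_toNat_neg).of_eq fun x => ?_
  omega

theorem primrec_nat_two_pow : Primrec fun n : ℕ => 2 ^ n := by
  refine (Primrec.nat_rec₁ 1 (f := fun _ m => 2 * m)
    (Primrec.nat_double.comp Primrec.snd)).of_eq fun n => ?_
  induction n with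
  | zero => rfl
  | succ n ih => rw [pow_succ, ← ih, mul_comm]

end IntegerArithmetic

/-! ### Arithmetic on codes of Gaussian rationals. -/

section GaussianCodes

/-- The sum of two codes of Gaussian rationals. -/
def gaussAdd (c d : ℤ × ℤ × ℕ) : ℤ × ℤ × ℕ :=
  (c.1 * ((d.2.2 + 1 : ℕ) : ℤ) + d.1 * ((c.2.2 + 1 : ℕ) : ℤ),
    c.2.1 * ((d.2.2 + 1 : ℕ) : ℤ) + d.2.1 * ((c.2.2 + 1 : ℕ) : ℤ),
    c.2.2 * d.2.2 + c.2.2 + d.2.2)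

/-- The product of two codes of Gaussian rationals. -/
def gaussMul (c d : ℤ × ℤ × ℕ) : ℤ × ℤ × ℕ :=
  (c.1 * d.1 + -(c.2.1 * d.2.1), c.1 * d.2.1 + c.2.1 * d.1, c.2.2 * d.2.2 + c.2.2 + d.2.2)

/-- The negative of a code of a Gaussian rational. -/
def gaussNeg (c : ℤ × ℤ × ℕ) : ℤ × ℤ × ℕ := (-c.1, -c.2.1, c.2.2)

/-- The complex conjugate of a code of a Gaussian rational. -/
def gaussConj (c : ℤ × ℤ × ℕ) : ℤ × ℤ × ℕ := (c.1, -c.2.1, c.2.2)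

theorem gaussVal_denom_ne_zero (n : ℕ) : (n : ℂ) + 1 ≠ 0 := Nat.cast_add_one_ne_zero n

theorem gaussVal_add (c d : ℤ × ℤ × ℕ) : gaussVal (gaussAdd c d) = gaussVal c + gaussVal d := by
  have h1 := gaussVal_denom_ne_zero c.2.2
  have h2 := gaussVal_denom_ne_zero d.2.2
  -- Codes store the denominator minus one, and `(m + 1)(n + 1) - 1 = mn + m + n`.
  have h3 : ((c.2.2 * d.2.2 + c.2.2 + d.2.2 : ℕ) : ℂ) + 1 = (c.2.2 + 1) * (d.2.2 + 1) := by
    push_cast; ring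
  simp only [gaussVal, gaussAdd, h3]
  push_cast
  field_simp
  ring

theorem gaussVal_mul (c d : ℤ × ℤ × ℕ) : gaussVal (gaussMul c d) = gaussVal c * gaussVal d := by
  have h1 := gaussVal_denom_ne_zero c.2.2
  have h2 := gaussVal_denom_ne_zero d.2.2
  have h3 : ((c.2.2 * d.2.2 + c.2.2 + d.2.2 : ℕ) : ℂ) + 1 = (c.2.2 + 1) * (d.2.2 + 1) := by
    push_cast; ring
  simp only [gaussVal, gaussMul, h3]
  push_cast
  rw [div_mul_div_comm]
  congr 1
  linear_combination -((c.2.1 : ℂ) * d.2.1) * Complex.I_sq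

theorem gaussVal_neg (c : ℤ × ℤ × ℕ) : gaussVal (gaussNeg c) = -gaussVal c := by
  simp only [gaussVal, gaussNeg]
  push_cast
  ring

theorem gaussVal_conj (c : ℤ × ℤ × ℕ) : gaussVal (gaussConj c) = star (gaussVal c) := by
  simp [gaussVal, gaussConj]

theorem gaussVal_zero (d : ℕ) : gaussVal (0, 0, d) = 0 := by simp [gaussVal]

theorem gaussVal_one : gaussVal (1, 0, 0) = 1 := by simp [gaussVal]

theorem gaussVal_eq_zero_iff (c : ℤ × ℤ × ℕ) : gaussVal c = 0 ↔ c.1 = 0 ∧ c.2.1 = 0 := by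
  rw [gaussVal, div_eq_zero_iff, or_iff_left (gaussVal_denom_ne_zero _)]
  constructor
  · intro h
    have hr := congrArg Complex.re h
    have hi := congrArg Complex.im h
    simp at hr hi
    exact ⟨hr, hi⟩
  · rintro ⟨h1, h2⟩
    simp [h1, h2]

/-- The `ℓ¹` bound avoids square roots and can be read off the code; `derivNorm_const_le` later
recovers the sharp value. -/
theorem norm_gaussVal_le (c : ℤ × ℤ × ℕ) :
    ‖gaussVal c‖ ≤ ((c.1.natAbs + c.2.1.natAbs : ℕ) : ℝ) / ((c.2.2 : ℝ) + 1) := by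
  have h : ‖((c.2.2 : ℂ) + 1)‖ = (c.2.2 : ℝ) + 1 := by
    rw [← Nat.cast_add_one, Complex.norm_natCast]
    push_cast
    rfl
  rw [gaussVal, norm_div, h]
  gcongr
  refine (norm_add_le _ _).trans ?_
  simp [Nat.cast_natAbs]

theorem primrec_gaussAdd : Primrec₂ gaussAdd := by
  have h1 : Primrec fun x : (ℤ × ℤ × ℕ) × ℤ × ℤ × ℕ => x.1.2.2 :=
    Primrec.snd.comp (Primrec.snd.comp Primrec.fst)
  have h2 : Primrec fun x : (ℤ × ℤ × ℕ) × ℤ × ℤ × ℕ => x.2.2.2 :=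
    Primrec.snd.comp (Primrec.snd.comp Primrec.snd)
  have h1' := primrec_int_natCast.comp (Primrec.succ.comp h1)
  have h2' := primrec_int_natCast.comp (Primrec.succ.comp h2)
  refine Primrec.pair (primrec_int_add.comp
      (primrec_int_mul.comp (Primrec.fst.comp Primrec.fst) h2')
      (primrec_int_mul.comp (Primrec.fst.comp Primrec.snd) h1'))
    (Primrec.pair (primrec_int_add.comp
      (primrec_int_mul.comp (Primrec.fst.comp (Primrec.snd.comp Primrec.fst)) h2')
      (primrec_int_mul.comp (Primrec.fst.comp (Primrec.snd.comp Primrec.snd)) h1')) ?_)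
  exact Primrec.nat_add.comp (Primrec.nat_add.comp (Primrec.nat_mul.comp h1 h2) h1) h2

theorem primrec_gaussMul : Primrec₂ gaussMul := by
  have h1 : Primrec fun x : (ℤ × ℤ × ℕ) × ℤ × ℤ × ℕ => x.1.2.2 :=
    Primrec.snd.comp (Primrec.snd.comp Primrec.fst)
  have h2 : Primrec fun x : (ℤ × ℤ × ℕ) × ℤ × ℤ × ℕ => x.2.2.2 :=
    Primrec.snd.comp (Primrec.snd.comp Primrec.snd)
  have a1 : Primrec fun x : (ℤ × ℤ × ℕ) × ℤ × ℤ × ℕ => x.1.1 := Primrec.fst.comp Primrec.fst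
  have a2 : Primrec fun x : (ℤ × ℤ × ℕ) × ℤ × ℤ × ℕ => x.2.1 := Primrec.fst.comp Primrec.snd
  have b1 : Primrec fun x : (ℤ × ℤ × ℕ) × ℤ × ℤ × ℕ => x.1.2.1 :=
    Primrec.fst.comp (Primrec.snd.comp Primrec.fst)
  have b2 : Primrec fun x : (ℤ × ℤ × ℕ) × ℤ × ℤ × ℕ => x.2.2.1 :=
    Primrec.fst.comp (Primrec.snd.comp Primrec.snd)
  exact Primrec.pair (primrec_int_add.comp (primrec_int_mul.comp a1 a2)
      (primrec_int_neg.comp (primrec_int_mul.comp b1 b2)))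
    (Primrec.pair (primrec_int_add.comp (primrec_int_mul.comp a1 b2) (primrec_int_mul.comp b1 a2))
      (Primrec.nat_add.comp (Primrec.nat_add.comp (Primrec.nat_mul.comp h1 h2) h1) h2))

theorem primrec_gaussNeg : Primrec gaussNeg :=
  (primrec_int_neg.comp Primrec.fst).pair
    ((primrec_int_neg.comp (Primrec.fst.comp Primrec.snd)).pair (Primrec.snd.comp Primrec.snd))

theorem primrec_gaussConj : Primrec gaussConj :=
  Primrec.fst.pair
    ((primrec_int_neg.comp (Primrec.fst.comp Primrec.snd)).pair (Primrec.snd.comp Primrec.snd))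

end GaussianCodes

/-! ### Arithmetic on codes of dyadic rationals. -/

section DyadicCodes

theorem dyadicVal_nonneg (c : ℕ × ℕ) : 0 ≤ dyadicVal c := by unfold dyadicVal; positivity

/-- The sum of two codes of dyadic rationals. -/
def dyadicAdd (c d : ℕ × ℕ) : ℕ × ℕ := (c.1 * 2 ^ d.2 + d.1 * 2 ^ c.2, c.2 + d.2)

/-- The product of two codes of dyadic rationals. -/
def dyadicMul (c d : ℕ × ℕ) : ℕ × ℕ := (c.1 * d.1, c.2 + d.2)

theorem dyadicVal_add (c d : ℕ × ℕ) :
    dyadicVal (dyadicAdd c d) = dyadicVal c + dyadicVal d := by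
  simp only [dyadicVal, dyadicAdd, pow_add]
  push_cast
  field_simp

theorem dyadicVal_mul (c d : ℕ × ℕ) :
    dyadicVal (dyadicMul c d) = dyadicVal c * dyadicVal d := by
  simp only [dyadicVal, dyadicMul, pow_add]
  push_cast
  field_simp

theorem dyadicVal_inv_two_pow (n : ℕ) : dyadicVal (1, n) = ((2 : ℝ) ^ n)⁻¹ := by
  simp [dyadicVal]

theorem dyadicVal_le_iff (c d : ℕ × ℕ) :
    dyadicVal c ≤ dyadicVal d ↔ c.1 * 2 ^ d.2 ≤ d.1 * 2 ^ c.2 := by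
  rw [dyadicVal, dyadicVal, div_le_div_iff₀ (by positivity) (by positivity)]
  exact_mod_cast Iff.rfl

theorem dyadicVal_lt_iff (c d : ℕ × ℕ) :
    dyadicVal c < dyadicVal d ↔ c.1 * 2 ^ d.2 < d.1 * 2 ^ c.2 := by
  rw [dyadicVal, dyadicVal, div_lt_div_iff₀ (by positivity) (by positivity)]
  exact_mod_cast Iff.rfl

theorem exists_dyadicVal_between {s t : ℝ} (hs : 0 ≤ s) (h : s < t) :
    ∃ c, s < dyadicVal c ∧ dyadicVal c < t := by
  obtain ⟨n, hn⟩ := exists_pow_lt_of_lt_one (sub_pos.2 h) (by norm_num : (1 / 2 : ℝ) < 1)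
  have h2 : (0 : ℝ) < 2 ^ n := by positivity
  refine ⟨(⌊s * 2 ^ n⌋₊ + 1, n), ?_, ?_⟩
  · rw [dyadicVal, lt_div_iff₀ h2]
    push_cast
    exact Nat.lt_floor_add_one _
  · rw [dyadicVal, div_lt_iff₀ h2]
    push_cast
    have h3 : 1 < (t - s) * 2 ^ n := by
      rw [one_div, inv_pow, inv_eq_one_div, div_lt_iff₀ h2] at hn
      exact hn
    have h4 := Nat.floor_le (mul_nonneg hs h2.le)
    linarith

theorem primrec_dyadicAdd : Primrec₂ dyadicAdd := by
  have h1 : Primrec fun x : (ℕ × ℕ) × ℕ × ℕ => x.1.2 := Primrec.snd.comp Primrec.fst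
  have h2 : Primrec fun x : (ℕ × ℕ) × ℕ × ℕ => x.2.2 := Primrec.snd.comp Primrec.snd
  exact Primrec.pair (Primrec.nat_add.comp
    (Primrec.nat_mul.comp (Primrec.fst.comp Primrec.fst) (primrec_nat_two_pow.comp h2))
    (Primrec.nat_mul.comp (Primrec.fst.comp Primrec.snd) (primrec_nat_two_pow.comp h1)))
    (Primrec.nat_add.comp h1 h2)

theorem primrec_dyadicMul : Primrec₂ dyadicMul :=
  Primrec.pair (Primrec.nat_mul.comp (Primrec.fst.comp Primrec.fst) (Primrec.fst.comp Primrec.snd))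
    (Primrec.nat_add.comp (Primrec.snd.comp Primrec.fst) (Primrec.snd.comp Primrec.snd))

theorem primrecRel_dyadicVal_le : PrimrecRel fun c d : ℕ × ℕ => dyadicVal c ≤ dyadicVal d := by
  refine PrimrecRel.of_eq (r := fun c d : ℕ × ℕ => c.1 * 2 ^ d.2 ≤ d.1 * 2 ^ c.2) ?_
    fun c d => (dyadicVal_le_iff c d).symm
  exact Primrec.nat_le.comp (Primrec.nat_mul.comp (Primrec.fst.comp Primrec.fst)
    (primrec_nat_two_pow.comp (Primrec.snd.comp Primrec.snd)))
    (Primrec.nat_mul.comp (Primrec.fst.comp Primrec.snd)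
    (primrec_nat_two_pow.comp (Primrec.snd.comp Primrec.fst)))

theorem primrecRel_dyadicVal_lt : PrimrecRel fun c d : ℕ × ℕ => dyadicVal c < dyadicVal d := by
  refine PrimrecRel.of_eq (r := fun c d : ℕ × ℕ => c.1 * 2 ^ d.2 < d.1 * 2 ^ c.2) ?_
    fun c d => (dyadicVal_lt_iff c d).symm
  exact Primrec.nat_lt.comp (Primrec.nat_mul.comp (Primrec.fst.comp Primrec.fst)
    (primrec_nat_two_pow.comp (Primrec.snd.comp Primrec.snd)))
    (Primrec.nat_mul.comp (Primrec.fst.comp Primrec.snd)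
    (primrec_nat_two_pow.comp (Primrec.snd.comp Primrec.fst)))

end DyadicCodes


/-! ### Operations on codes of `*`-polynomials. -/

section PolynomialOperations

variable {G H : Type}

/-- The product of two codes of `*`-polynomials. -/
def polyMul (p q : RatPoly G) : RatPoly G :=
  p.flatMap fun m => q.map fun m' => (gaussMul m.1 m'.1, m.2 ++ m'.2)

/-- The adjoint of a word. -/
def wordStar (w : List (G × Bool)) : List (G × Bool) := (w.map fun l => (l.1, !l.2)).reverse

/-- The adjoint of a code of a `*`-polynomial. -/
def polyStar (p : RatPoly G) : RatPoly G := p.map fun m => (gaussConj m.1, wordStar m.2)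

/-- The negative of a code of a `*`-polynomial. -/
def polyNeg (p : RatPoly G) : RatPoly G := p.map fun m => (gaussNeg m.1, m.2)

/-- The code of a constant polynomial. -/
def polyConst (c : ℤ × ℤ × ℕ) : RatPoly G := [(c, [])]

/-- The substitution of polynomials for the variables of a word. -/
def wordSubst (q : H → RatPoly G) (w : List (H × Bool)) : RatPoly G :=
  w.foldr (fun l r => polyMul (bif l.2 then polyStar (q l.1) else q l.1) r) (polyConst (1, 0, 0))

/-- The substitution of polynomials for the variables of a polynomial. -/
def polySubst (q : H → RatPoly G) (p : RatPoly H) : RatPoly G :=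
  p.flatMap fun m => polyMul (polyConst m.1) (wordSubst q m.2)

variable {A : Type u} [CStarAlgebra A]

@[simp] theorem polyVal_nil (x : G → A) : polyVal x [] = 0 := rfl

@[simp] theorem polyVal_cons (x : G → A) (m : RatMonomial G) (p : RatPoly G) :
    polyVal x (m :: p) = monoVal x m + polyVal x p := by simp [polyVal]

@[simp] theorem polyVal_append (x : G → A) (p q : RatPoly G) :
    polyVal x (p ++ q) = polyVal x p + polyVal x q := by simp [polyVal]

@[simp] theorem polyVal_const (x : G → A) (c : ℤ × ℤ × ℕ) :
    polyVal x (polyConst c) = algebraMap ℂ A (gaussVal c) := by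
  simp [polyConst, monoVal, Algebra.algebraMap_eq_smul_one]

@[simp] theorem polyVal_gen (x : G → A) (g : G) : polyVal x (gen g) = x g := by
  simp [gen, monoVal, gaussVal_one, letterVal]

@[simp] theorem polyVal_mul (x : G → A) (p q : RatPoly G) :
    polyVal x (polyMul p q) = polyVal x p * polyVal x q := by
  induction p with
  | nil => simp [polyMul]
  | cons m p ih =>
    have h : polyVal x (q.map fun m' => (gaussMul m.1 m'.1, m.2 ++ m'.2)) =
        monoVal x m * polyVal x q := by
      clear ih
      induction q with
      | nil => simp
      | cons m' q ih =>
        rw [List.map_cons, polyVal_cons, polyVal_cons, ih, mul_add]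
        simp [monoVal, gaussVal_mul, mul_smul, smul_comm (gaussVal m.1)]
    rw [polyVal_cons, add_mul, ← ih, ← h, ← polyVal_append]
    rfl

theorem letterVal_star (x : G → A) (l : G × Bool) :
    letterVal x (l.1, !l.2) = star (letterVal x l) := by
  obtain ⟨g, b⟩ := l
  cases b <;> simp [letterVal]

theorem prod_wordStar (x : G → A) (w : List (G × Bool)) :
    ((wordStar w).map (letterVal x)).prod = star ((w.map (letterVal x)).prod) := by
  induction w with
  | nil => simp [wordStar]
  | cons l w ih =>
    simp only [wordStar, List.map_reverse, List.map_map] at ih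
    simp [wordStar, ih, letterVal_star]

@[simp] theorem polyVal_star (x : G → A) (p : RatPoly G) :
    polyVal x (polyStar p) = star (polyVal x p) := by
  induction p with
  | nil => simp [polyStar]
  | cons m p ih =>
    have h : polyVal x (polyStar (m :: p)) =
      monoVal x (gaussConj m.1, wordStar m.2) + polyVal x (polyStar p) := polyVal_cons _ _ _
    rw [h, ih, polyVal_cons, star_add]
    simp [monoVal, gaussVal_conj, prod_wordStar]

-- Turns the value of `p` at a tuple of rational points into one rational point, to which
-- enumerations of norm bounds apply.
@[simp] theorem polyVal_subst (y : G → A) (q : H → RatPoly G) (p : RatPoly H) :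
    polyVal y (polySubst q p) = polyVal (fun k => polyVal y (q k)) p := by
  have hw : ∀ w : List (H × Bool), polyVal y (wordSubst q w) =
      (w.map (letterVal fun k => polyVal y (q k))).prod := by
    intro w
    induction w with
    | nil => simp [wordSubst, gaussVal_one]
    | cons l w ih =>
      have h : polyVal y (wordSubst q (l :: w)) =
          polyVal y (bif l.2 then polyStar (q l.1) else q l.1) * polyVal y (wordSubst q w) :=
        polyVal_mul _ _ _
      rw [h, ih, List.map_cons, List.prod_cons]
      obtain ⟨g, b⟩ := l
      cases b <;> simp [letterVal]
  induction p with
  | nil => rfl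
  | cons m p ih =>
    have h : polyVal y (polySubst q (m :: p)) =
        polyVal y (polyMul (polyConst m.1) (wordSubst q m.2)) + polyVal y (polySubst q p) :=
      polyVal_append _ _ _
    rw [h, ih, polyVal_cons, polyVal_mul, polyVal_const, hw, monoVal, Algebra.smul_def]

theorem map_polyVal {B : Type*} [CStarAlgebra B] (φ : A →⋆ₐ[ℂ] B) (x : G → A) (p : RatPoly G) :
    φ (polyVal x p) = polyVal (fun g => φ (x g)) p := by
  have hl : ∀ l, φ (letterVal x l) = letterVal (fun g => φ (x g)) l := by
    rintro ⟨g, b⟩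
    cases b <;> simp [letterVal, map_star]
  induction p with
  | nil => simp
  | cons m p ih =>
    have h : letterVal (fun g => φ (x g)) = φ ∘ letterVal x := funext fun l => (hl l).symm
    simp [ih, monoVal, map_list_prod, h]

end PolynomialOperations

/-! ### Primitive recursiveness of the polynomial operations. -/

section PolynomialOperationsPrimrec

variable {G H : Type} [Primcodable G] [Primcodable H]

theorem primrec_polyMul : Primrec₂ (polyMul (G := G)) := by
  refine Primrec.list_flatMap Primrec.fst (Primrec.list_map (Primrec.snd.comp Primrec.fst) ?_)
  have h1 : Primrec fun z : ((RatPoly G × RatPoly G) × RatMonomial G) × RatMonomial G => z.1.2 :=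
    Primrec.snd.comp Primrec.fst
  exact Primrec.pair
    (primrec_gaussMul.comp (Primrec.fst.comp h1) (Primrec.fst.comp Primrec.snd))
    (Primrec.list_append.comp (Primrec.snd.comp h1) (Primrec.snd.comp Primrec.snd))

theorem primrec_wordStar : Primrec (wordStar (G := G)) := by
  refine Primrec.list_reverse.comp (Primrec.list_map Primrec.id ?_)
  exact Primrec.pair (Primrec.fst.comp Primrec.snd)
    (Primrec.not.comp (Primrec.snd.comp Primrec.snd))

theorem primrec_polyStar : Primrec (polyStar (G := G)) := by
  refine Primrec.list_map Primrec.id ?_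
  exact Primrec.pair (primrec_gaussConj.comp (Primrec.fst.comp Primrec.snd))
    (primrec_wordStar.comp (Primrec.snd.comp Primrec.snd))

theorem primrec_polyNeg : Primrec (polyNeg (G := G)) := by
  refine Primrec.list_map Primrec.id ?_
  exact Primrec.pair (primrec_gaussNeg.comp (Primrec.fst.comp Primrec.snd))
    (Primrec.snd.comp Primrec.snd)

theorem primrec_polyConst : Primrec (polyConst (G := G)) :=
  Primrec.list_cons.comp (Primrec.pair Primrec.id (Primrec.const [])) (Primrec.const [])

theorem primrec_polySubst {n : ℕ} :
    Primrec₂ fun (q : Fin n → RatPoly G) (p : RatPoly (Fin n)) => polySubst q p := by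
  have hq : Primrec₂ fun (q : Fin n → RatPoly G) (l : Fin n × Bool) =>
      bif l.2 then polyStar (q l.1) else q l.1 := by
    have h : Primrec fun z : (Fin n → RatPoly G) × Fin n × Bool => z.1 z.2.1 :=
      Primrec.fin_app.comp Primrec.fst (Primrec.fst.comp Primrec.snd)
    exact Primrec.cond (Primrec.snd.comp Primrec.snd) (primrec_polyStar.comp h) h
  have hw : Primrec₂ fun (q : Fin n → RatPoly G) (w : List (Fin n × Bool)) => wordSubst q w := by
    refine Primrec.list_foldr (h := fun (z : (Fin n → RatPoly G) × List (Fin n × Bool))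
      (y : (Fin n × Bool) × RatPoly G) =>
        polyMul (bif y.1.2 then polyStar (z.1 y.1.1) else z.1 y.1.1) y.2)
      Primrec.snd (Primrec.const _) ?_
    exact primrec_polyMul.comp
      (hq.comp (Primrec.fst.comp Primrec.fst) (Primrec.fst.comp Primrec.snd))
      (Primrec.snd.comp Primrec.snd)
  refine Primrec.list_flatMap Primrec.snd ?_
  exact primrec_polyMul.comp (primrec_polyConst.comp (Primrec.fst.comp Primrec.snd))
    (hw.comp (Primrec.fst.comp Primrec.fst) (Primrec.snd.comp Primrec.snd))

end PolynomialOperationsPrimrec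


/-! ### The Gaussian rationals as a dense `*`-subring of `ℂ`. -/

section GaussianField

/-- The `*`-ring of Gaussian rationals, as a subring of `ℂ`. -/
noncomputable def gaussRat : StarSubalgebra ℚ ℂ where
  carrier := Set.range gaussVal
  mul_mem' := by
    rintro _ _ ⟨c, rfl⟩ ⟨d, rfl⟩
    exact ⟨_, gaussVal_mul c d⟩
  add_mem' := by
    rintro _ _ ⟨c, rfl⟩ ⟨d, rfl⟩
    exact ⟨_, gaussVal_add c d⟩
  algebraMap_mem' q := by
    refine ⟨(q.num, 0, q.den - 1), ?_⟩
    have h : ((q.den - 1 : ℕ) : ℂ) + 1 = q.den := by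
      rw [← Nat.cast_add_one, Nat.sub_add_cancel q.pos]
    have h2 : (q : ℂ) = (q.num : ℂ) / (q.den : ℂ) := Rat.cast_def q
    simp [gaussVal, h, h2]
  star_mem' := by
    rintro _ ⟨c, rfl⟩
    exact ⟨_, gaussVal_conj c⟩

/-- The Gaussian rational with code `c`, as an element of `gaussRat`. -/
noncomputable def gaussElt (c : ℤ × ℤ × ℕ) : gaussRat := ⟨gaussVal c, c, rfl⟩

@[simp] theorem coe_gaussElt (c : ℤ × ℤ × ℕ) : (gaussElt c : ℂ) = gaussVal c := rfl

theorem gaussElt_surjective : Function.Surjective gaussElt := by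
  rintro ⟨_, c, rfl⟩
  exact ⟨c, rfl⟩

theorem gaussElt_add (c d : ℤ × ℤ × ℕ) : gaussElt (gaussAdd c d) = gaussElt c + gaussElt d :=
  Subtype.ext (gaussVal_add c d)

theorem gaussElt_mul (c d : ℤ × ℤ × ℕ) : gaussElt (gaussMul c d) = gaussElt c * gaussElt d :=
  Subtype.ext (gaussVal_mul c d)

theorem gaussElt_neg (c : ℤ × ℤ × ℕ) : gaussElt (gaussNeg c) = -gaussElt c :=
  Subtype.ext (gaussVal_neg c)

theorem gaussElt_conj (c : ℤ × ℤ × ℕ) : gaussElt (gaussConj c) = star (gaussElt c) :=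
  Subtype.ext (gaussVal_conj c)

theorem gaussElt_zero (d : ℕ) : gaussElt (0, 0, d) = 0 := Subtype.ext (gaussVal_zero d)

theorem gaussElt_one : gaussElt (1, 0, 0) = 1 := Subtype.ext gaussVal_one

theorem denseRange_gaussVal : DenseRange gaussVal := by
  rw [Metric.denseRange_iff]
  intro z r hr
  obtain ⟨n, hn⟩ := exists_nat_one_div_lt (half_pos hr)
  have hn0 : (0 : ℝ) < n + 1 := by positivity
  refine ⟨(⌊z.re * (n + 1)⌋, ⌊z.im * (n + 1)⌋, n), ?_⟩
  have key : ∀ t : ℝ, |t - ⌊t * (n + 1)⌋ / (n + 1)| ≤ 1 / (n + 1) := by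
    intro t
    have h1 := Int.floor_le (t * (n + 1))
    have h2 := Int.lt_floor_add_one (t * (n + 1))
    have h3 : t - ⌊t * (n + 1)⌋ / (n + 1) = (t * (n + 1) - ⌊t * (n + 1)⌋) / (n + 1) := by
      field_simp
    rw [h3, abs_div, abs_of_pos hn0]
    gcongr
    rw [abs_le]
    constructor <;> linarith
  have hv : gaussVal (⌊z.re * (n + 1)⌋, ⌊z.im * (n + 1)⌋, n) =
      ⟨⌊z.re * (n + 1)⌋ / (n + 1), ⌊z.im * (n + 1)⌋ / (n + 1)⟩ := by
    rw [gaussVal, div_eq_iff (gaussVal_denom_ne_zero n)]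
    apply Complex.ext <;> simp <;> field_simp
  rw [hv, dist_eq_norm]
  calc ‖z - _‖ ≤ |(z - _).re| + |(z - _).im| := Complex.norm_le_abs_re_add_abs_im _
    _ ≤ 1 / (n + 1) + 1 / (n + 1) := add_le_add (key _) (key _)
    _ < r := by linarith

end GaussianField

/-! ### The free `*`-algebra over the Gaussian rationals. -/

section FreeStarAlgebra

variable {G : Type}

/-- The free `*`-algebra over the Gaussian rationals on the generators `G`. -/
abbrev FreeStar (G : Type) : Type u :=
  MonoidAlgebra gaussRat (FreeMonoid (ULift.{u} (G × Bool)))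

/-- The element of the free monoid given by a word. -/
def freeWord (w : List (G × Bool)) : FreeMonoid (ULift.{u} (G × Bool)) :=
  FreeMonoid.ofList (w.map ULift.up)

/-- The adjoint of an element of the free monoid. -/
def freeWordStar (w : FreeMonoid (ULift.{u} (G × Bool))) : FreeMonoid (ULift.{u} (G × Bool)) :=
  freeWord (wordStar (w.toList.map ULift.down))

theorem freeWord_append (v w : List (G × Bool)) :
    freeWord.{u} (v ++ w) = freeWord v * freeWord w := by
  simp [freeWord]

theorem freeWord_surjective : Function.Surjective (freeWord.{u} (G := G)) := fun w =>
  ⟨w.toList.map ULift.down, by simp [freeWord, Function.comp_def]⟩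

theorem freeWord_injective : Function.Injective (freeWord.{u} (G := G)) := fun _ _ h =>
  (List.map_injective_iff.2 ULift.up_injective) (FreeMonoid.ofList.injective h)

theorem freeWordStar_freeWord (w : List (G × Bool)) :
    freeWordStar (freeWord.{u} w) = freeWord (wordStar w) := by
  simp [freeWordStar, freeWord, Function.comp_def]

theorem wordStar_append (v w : List (G × Bool)) :
    wordStar (v ++ w) = wordStar w ++ wordStar v := by simp [wordStar]

theorem wordStar_wordStar (w : List (G × Bool)) : wordStar (wordStar w) = w := by
  simp [wordStar, Function.comp_def]

theorem freeWordStar_mul (v w : FreeMonoid (ULift.{u} (G × Bool))) :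
    freeWordStar (v * w) = freeWordStar w * freeWordStar v := by
  obtain ⟨v, rfl⟩ := freeWord_surjective v
  obtain ⟨w, rfl⟩ := freeWord_surjective w
  rw [← freeWord_append, freeWordStar_freeWord, freeWordStar_freeWord, freeWordStar_freeWord,
    wordStar_append, freeWord_append]

theorem freeWordStar_freeWordStar (v : FreeMonoid (ULift.{u} (G × Bool))) :
    freeWordStar (freeWordStar v) = v := by
  obtain ⟨v, rfl⟩ := freeWord_surjective v
  rw [freeWordStar_freeWord, freeWordStar_freeWord, wordStar_wordStar]

/-- The involution of the free `*`-algebra, as an additive map. -/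
noncomputable def freeStarHom : FreeStar.{u} G →+ FreeStar.{u} G :=
  MonoidAlgebra.liftNC ((MonoidAlgebra.singleAddHom 1).comp (starAddEquiv : gaussRat ≃+ gaussRat))
    fun w => MonoidAlgebra.single (freeWordStar w) 1

theorem freeStarHom_single (w : FreeMonoid (ULift.{u} (G × Bool))) (c : gaussRat) :
    freeStarHom (MonoidAlgebra.single w c) = MonoidAlgebra.single (freeWordStar w) (star c) := by
  simp [freeStarHom, MonoidAlgebra.liftNC_single, MonoidAlgebra.single_mul_single]

noncomputable instance : StarRing (FreeStar.{u} G) where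
  star := freeStarHom
  star_involutive v := by
    induction v using MonoidAlgebra.induction_linear with
    | zero => simp
    | add f g hf hg => rw [map_add, map_add, hf, hg]
    | single w c => rw [freeStarHom_single, freeStarHom_single, freeWordStar_freeWordStar, star_star]
  star_mul v v' := by
    induction v using MonoidAlgebra.induction_linear with
    | zero => simp
    | add f g hf hg => rw [add_mul, map_add, map_add, hf, hg, mul_add]
    | single w c =>
      induction v' using MonoidAlgebra.induction_linear with
      | zero => simp
      | add f g hf hg => rw [mul_add, map_add, map_add, hf, hg, add_mul]
      | single w' c' =>
        rw [MonoidAlgebra.single_mul_single, freeStarHom_single, freeStarHom_single,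
          freeStarHom_single, MonoidAlgebra.single_mul_single, freeWordStar_mul, star_mul]
  star_add v v' := map_add _ _ _

theorem star_freeStar_single (w : FreeMonoid (ULift.{u} (G × Bool))) (c : gaussRat) :
    star (MonoidAlgebra.single w c : FreeStar.{u} G) =
      MonoidAlgebra.single (freeWordStar w) (star c) :=
  freeStarHom_single w c

/-- The formal polynomial with a given code. -/
noncomputable def formal (p : RatPoly G) : FreeStar.{u} G :=
  (p.map fun m => MonoidAlgebra.single (freeWord m.2) (gaussElt m.1)).sum

@[simp] theorem formal_nil : formal.{u} ([] : RatPoly G) = 0 := rfl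

@[simp] theorem formal_cons (m : RatMonomial G) (p : RatPoly G) :
    formal.{u} (m :: p) = MonoidAlgebra.single (freeWord m.2) (gaussElt m.1) + formal p := by
  simp [formal]

@[simp] theorem formal_append (p q : RatPoly G) :
    formal.{u} (p ++ q) = formal p + formal q := by simp [formal]

@[simp] theorem formal_const (c : ℤ × ℤ × ℕ) :
    formal.{u} (polyConst c : RatPoly G) = MonoidAlgebra.single 1 (gaussElt c) := by
  simp [polyConst, formal, freeWord]

@[simp] theorem formal_mul (p q : RatPoly G) :
    formal.{u} (polyMul p q) = formal p * formal q := by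
  induction p with
  | nil => simp [polyMul]
  | cons m p ih =>
    have h : formal.{u} (q.map fun m' => (gaussMul m.1 m'.1, m.2 ++ m'.2)) =
        MonoidAlgebra.single (freeWord m.2) (gaussElt m.1) * formal q := by
      clear ih
      induction q with
      | nil => simp
      | cons m' q ih =>
        rw [List.map_cons, formal_cons, formal_cons, ih, mul_add, MonoidAlgebra.single_mul_single,
          gaussElt_mul, freeWord_append]
    rw [formal_cons, add_mul, ← ih, ← h, ← formal_append]
    rfl

@[simp] theorem formal_star (p : RatPoly G) : formal.{u} (polyStar p) = star (formal p) := by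
  induction p with
  | nil => simp [polyStar]
  | cons m p ih =>
    have h : formal.{u} (polyStar (m :: p)) = MonoidAlgebra.single (freeWord (wordStar m.2))
      (gaussElt (gaussConj m.1)) + formal (polyStar p) := formal_cons _ _
    rw [h, ih, formal_cons, star_add, star_freeStar_single, freeWordStar_freeWord, gaussElt_conj]

@[simp] theorem formal_neg (p : RatPoly G) : formal.{u} (polyNeg p) = -formal p := by
  induction p with
  | nil => simp [polyNeg]
  | cons m p ih =>
    have h : formal.{u} (polyNeg (m :: p)) = MonoidAlgebra.single (freeWord m.2)
      (gaussElt (gaussNeg m.1)) + formal (polyNeg p) := formal_cons _ _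
    rw [h, ih, formal_cons, neg_add, gaussElt_neg, MonoidAlgebra.single_neg]

theorem formal_surjective : Function.Surjective (formal.{u} (G := G)) := by
  intro v
  induction v using MonoidAlgebra.induction_linear with
  | zero => exact ⟨[], rfl⟩
  | add f g hf hg =>
    obtain ⟨p, rfl⟩ := hf
    obtain ⟨q, rfl⟩ := hg
    exact ⟨p ++ q, formal_append p q⟩
  | single w c =>
    obtain ⟨w, rfl⟩ := freeWord_surjective w
    obtain ⟨c, rfl⟩ := gaussElt_surjective c
    exact ⟨[(c, w)], by simp⟩

variable {A : Type u} [CStarAlgebra A]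

/-- Codes of the same formal polynomial have the same values. -/
theorem polyVal_eq_of_formal_eq {p q : RatPoly G} (h : formal.{u} p = formal q) (x : G → A) :
    polyVal x p = polyVal x q := by
  let f : gaussRat →+ A :=
    (algebraMap ℂ A : ℂ →+ A).comp (gaussRat.subtype : gaussRat →+ ℂ)
  let L : FreeStar.{u} G →+ A :=
    MonoidAlgebra.liftNC f fun w => ((w.toList.map ULift.down).map (letterVal x)).prod
  have hL : ∀ p : RatPoly G, L (formal p) = polyVal x p := by
    intro p
    induction p with
    | nil => simp
    | cons m p ih =>
      rw [formal_cons, polyVal_cons, map_add, ih]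
      congr 1
      simp only [L, MonoidAlgebra.liftNC_single, monoVal, Algebra.smul_def]
      simp [f, freeWord, Function.comp_def]
  rw [← hL, ← hL, h]

end FreeStarAlgebra

/-! ### Deciding equality of formal polynomials. -/

section FormalEquality

variable {G : Type}

open Classical in
/-- The code of the coefficient of a word in a polynomial. -/
noncomputable def polyCoeff (p : RatPoly G) (w : List (G × Bool)) : ℤ × ℤ × ℕ :=
  p.foldr (fun m c => if m.2 = w then gaussAdd m.1 c else c) (0, 0, 0)

/-- Equality of formal polynomials, on codes. -/
def PolyEq (p q : RatPoly G) : Prop :=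
  ∀ m ∈ p ++ polyNeg q, (polyCoeff (p ++ polyNeg q) m.2).1 = 0 ∧
    (polyCoeff (p ++ polyNeg q) m.2).2.1 = 0

open Classical in
theorem coeff_formal (p : RatPoly G) (w : List (G × Bool)) :
    (formal.{u} p).coeff (freeWord w) = gaussElt (polyCoeff p w) := by
  induction p with
  | nil => simp [polyCoeff, gaussElt_zero]
  | cons m p ih =>
    have h : polyCoeff (m :: p) w =
      if m.2 = w then gaussAdd m.1 (polyCoeff p w) else polyCoeff p w := rfl
    rw [formal_cons, MonoidAlgebra.coeff_add, Finsupp.add_apply, ih, h, MonoidAlgebra.coeff_single,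
      Finsupp.single_apply]
    by_cases hw : m.2 = w
    · rw [if_pos (congrArg _ hw), if_pos hw, gaussElt_add]
    · rw [if_neg (fun h => hw (freeWord_injective h)), if_neg hw, zero_add]

open Classical in
-- Only words occurring in the codes can have a nonzero coefficient in the difference, so the finite
-- check suffices. The left side does not depend on the universe in which formal polynomials live.
theorem polyEq_iff (p q : RatPoly G) : PolyEq p q ↔ formal.{u} p = formal q := by
  have h0 : formal.{u} p = formal q ↔ formal.{u} (p ++ polyNeg q) = 0 := by
    rw [formal_append, formal_neg, ← sub_eq_add_neg, sub_eq_zero]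
  have h1 : ∀ c, (c.1 = 0 ∧ c.2.1 = 0) ↔ gaussElt c = 0 := fun c => by
    rw [← gaussVal_eq_zero_iff, ← coe_gaussElt, ZeroMemClass.coe_eq_zero]
  rw [h0, PolyEq]
  generalize p ++ polyNeg q = r
  simp only [h1, ← coeff_formal.{u}]
  constructor
  · intro h
    refine MonoidAlgebra.ext (Finsupp.ext fun w => ?_)
    obtain ⟨w, rfl⟩ := freeWord_surjective w
    by_cases hw : ∃ m ∈ r, m.2 = w
    · obtain ⟨m, hm, rfl⟩ := hw
      exact h m hm
    · rw [coeff_formal]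
      clear h h0
      induction r with
      | nil => simp [polyCoeff, gaussElt_zero]
      | cons m r ih =>
        push Not at hw
        have h : polyCoeff (m :: r) w =
          if m.2 = w then gaussAdd m.1 (polyCoeff r w) else polyCoeff r w := rfl
        rw [h, if_neg (hw m (by simp))]
        exact ih (by push Not; exact fun m' hm' => hw m' (by simp [hm']))
  · intro h m _
    rw [h]
    rfl

open Classical in
theorem primrecRel_polyEq [Primcodable G] : PrimrecRel (PolyEq (G := G)) := by
  have hc : Primrec₂ (polyCoeff (G := G)) := by
    refine Primrec.list_foldr (h := fun (z : RatPoly G × List (G × Bool))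
      (y : RatMonomial G × (ℤ × ℤ × ℕ)) => if y.1.2 = z.2 then gaussAdd y.1.1 y.2 else y.2)
      Primrec.fst (Primrec.const (0, 0, 0)) ?_
    refine Primrec.ite ?_ ?_ (Primrec.snd.comp Primrec.snd)
    · exact Primrec.eq.comp (Primrec.snd.comp (Primrec.fst.comp Primrec.snd))
        (Primrec.snd.comp Primrec.fst)
    · exact primrec_gaussAdd.comp (Primrec.fst.comp (Primrec.fst.comp Primrec.snd))
        (Primrec.snd.comp Primrec.snd)
  have h1 : PrimrecRel fun (m : RatMonomial G) (r : RatPoly G) =>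
      (polyCoeff r m.2).1 = 0 ∧ (polyCoeff r m.2).2.1 = 0 := by
    have h2 : Primrec fun z : RatMonomial G × RatPoly G => polyCoeff z.2 z.1.2 :=
      hc.comp Primrec.snd (Primrec.snd.comp Primrec.fst)
    exact PrimrecPred.and (Primrec.eq.comp (Primrec.fst.comp h2) (Primrec.const 0))
      (Primrec.eq.comp (Primrec.fst.comp (Primrec.snd.comp h2)) (Primrec.const 0))
  have h3 : Primrec fun z : RatPoly G × RatPoly G => z.1 ++ polyNeg z.2 :=
    Primrec.list_append.comp Primrec.fst (primrec_polyNeg.comp Primrec.snd)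
  exact h1.forall_mem_list.comp h3 h3

end FormalEquality


/-! ### Derivable norm bounds and the universal C*-seminorm. -/

section Derivations

variable {G : Type}

/-- The bounds of the constant polynomials. -/
def ConstBound (r : RatRelation G) : Prop :=
  ∃ c : ℤ × ℤ × ℕ, r.1 = polyConst c ∧
    (c.1.natAbs + c.2.1.natAbs) * 2 ^ r.2.2 ≤ r.2.1 * (c.2.2 + 1)

/-- The rules by which a norm bound `c` follows from the norm bounds `a` and `b`: the triangle
inequality, submultiplicativity, the C*-identity and the isometry of the involution. -/
def DerivStep (a b c : RatRelation G) : Prop :=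
  (PolyEq c.1 (a.1 ++ b.1) ∧ dyadicVal (dyadicAdd a.2 b.2) ≤ dyadicVal c.2) ∨
  (PolyEq c.1 (polyMul a.1 b.1) ∧ dyadicVal (dyadicMul a.2 b.2) ≤ dyadicVal c.2) ∨
  (PolyEq (polyMul (polyStar c.1) c.1) a.1 ∧ dyadicVal a.2 ≤ dyadicVal (dyadicMul c.2 c.2)) ∨
  (PolyEq c.1 (polyStar a.1) ∧ dyadicVal a.2 ≤ dyadicVal c.2)

/-- The norm bounds which can be derived from the relations `R`. -/
def Derivable (R : Set (RatRelation G)) (r : RatRelation G) : Prop :=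
  Closure (fun r => r ∈ R ∨ ConstBound r) DerivStep r

theorem norm_polyVal_le_of_constBound {A : Type u} [CStarAlgebra A] (x : G → A)
    {r : RatRelation G} (h : ConstBound r) : ‖polyVal x r.1‖ ≤ dyadicVal r.2 := by
  obtain ⟨c, hc, hle⟩ := h
  rw [hc, polyVal_const, dyadicVal]
  rcases subsingleton_or_nontrivial A with hA | hA
  · rw [Subsingleton.elim (algebraMap ℂ A (gaussVal c)) 0, norm_zero]
    positivity
  · rw [norm_algebraMap']
    refine (norm_gaussVal_le c).trans ?_
    rw [div_le_div_iff₀ (by positivity) (by positivity)]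
    exact_mod_cast hle

/-- Soundness of the calculus: each rule is a true statement about norms in any C*-algebra. -/
theorem Derivable.norm_polyVal_le {A : Type u} [CStarAlgebra A] {R : Set (RatRelation G)}
    {x : G → A} (hx : IsRepresentation R x) {r : RatRelation G} (h : Derivable R r) :
    ‖polyVal x r.1‖ ≤ dyadicVal r.2 := by
  induction h with
  | base h => exact h.elim (hx _) (norm_polyVal_le_of_constBound x)
  | @step a b c _ _ h iha ihb =>
    rcases h with ⟨h, hle⟩ | ⟨h, hle⟩ | ⟨h, hle⟩ | ⟨h, hle⟩
    · rw [polyVal_eq_of_formal_eq ((polyEq_iff.{u} _ _).1 h), polyVal_append]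
      rw [dyadicVal_add] at hle
      exact (norm_add_le _ _).trans ((add_le_add iha ihb).trans hle)
    · rw [polyVal_eq_of_formal_eq ((polyEq_iff.{u} _ _).1 h), polyVal_mul]
      rw [dyadicVal_mul] at hle
      exact (norm_mul_le _ _).trans
        ((mul_le_mul iha ihb (norm_nonneg _) (dyadicVal_nonneg _)).trans hle)
    · have h1 := polyVal_eq_of_formal_eq ((polyEq_iff.{u} _ _).1 h) x
      rw [polyVal_mul, polyVal_star] at h1
      rw [dyadicVal_mul] at hle
      -- The C*-identity bounds the square of the norm, so squares are compared.
      refine (pow_le_pow_iff_left₀ (norm_nonneg _) (dyadicVal_nonneg _) two_ne_zero).1 ?_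
      rw [sq, sq, ← CStarRing.norm_star_mul_self, h1]
      exact iha.trans hle
    · rw [polyVal_eq_of_formal_eq ((polyEq_iff.{u} _ _).1 h), polyVal_star, norm_star]
      exact iha.trans hle

/-- The numbers which are derivable bounds of a formal polynomial. -/
def derivBounds (R : Set (RatRelation G)) (v : FreeStar.{u} G) : Set ℝ :=
  {t | ∃ r, Derivable R r ∧ formal r.1 = v ∧ dyadicVal r.2 = t}

/-- The infimum of the derivable bounds of a formal polynomial. -/
noncomputable def derivNorm (R : Set (RatRelation G)) (v : FreeStar.{u} G) : ℝ :=
  sInf (derivBounds R v)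

variable {R : Set (RatRelation G)}

theorem derivBounds_bddBelow (v : FreeStar.{u} G) : BddBelow (derivBounds R v) :=
  ⟨0, by rintro _ ⟨r, -, -, rfl⟩; exact dyadicVal_nonneg _⟩

theorem derivNorm_nonneg (v : FreeStar.{u} G) : 0 ≤ derivNorm R v :=
  Real.sInf_nonneg (by rintro _ ⟨r, -, -, rfl⟩; exact dyadicVal_nonneg _)

theorem derivNorm_le {r : RatRelation G} (h : Derivable R r) :
    derivNorm.{u} R (formal r.1) ≤ dyadicVal r.2 :=
  csInf_le (derivBounds_bddBelow _) ⟨r, h, rfl, rfl⟩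

theorem Derivable.add {a b : RatRelation G} (ha : Derivable R a) (hb : Derivable R b) :
    Derivable R (a.1 ++ b.1, dyadicAdd a.2 b.2) :=
  .step ha hb (.inl ⟨(polyEq_iff.{0} _ _).2 rfl, le_rfl⟩)

theorem Derivable.mul {a b : RatRelation G} (ha : Derivable R a) (hb : Derivable R b) :
    Derivable R (polyMul a.1 b.1, dyadicMul a.2 b.2) :=
  .step ha hb (.inr (.inl ⟨(polyEq_iff.{0} _ _).2 rfl, le_rfl⟩))

theorem Derivable.star {a : RatRelation G} (ha : Derivable R a) :
    Derivable R (polyStar a.1, a.2) :=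
  .step ha ha (.inr (.inr (.inr ⟨(polyEq_iff.{0} _ _).2 rfl, le_rfl⟩)))

theorem Derivable.of_constBound {r : RatRelation G} (h : ConstBound r) : Derivable R r :=
  .base (.inr h)

theorem derivable_zero : Derivable R (polyConst (0, 0, 0), (0, 0)) :=
  .of_constBound ⟨_, rfl, by simp⟩

/-- Every rule tolerates formal equality and slack in the bound, so weakening is the sum rule
applied with the zero polynomial. -/
theorem Derivable.mono {p q : RatPoly G} {c d : ℕ × ℕ} (h : Derivable R (p, c))
    (hpq : formal.{u} q = formal p) (hcd : dyadicVal c ≤ dyadicVal d) : Derivable R (q, d) := by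
  refine .step h derivable_zero (.inl ⟨(polyEq_iff.{u} _ _).2 ?_, ?_⟩)
  · simp [hpq, gaussElt_zero]
  · rw [dyadicVal_add]
    simpa [dyadicVal] using hcd

theorem exists_derivable_const (c : ℤ × ℤ × ℕ) :
    ∃ d, Derivable R (polyConst c, d) :=
  ⟨(c.1.natAbs + c.2.1.natAbs, 0), .of_constBound ⟨c, rfl, by
    simp only [pow_zero, mul_one]
    exact Nat.le_mul_of_pos_right _ (Nat.succ_pos _)⟩⟩

/-- The norm bounds on generators make every set of derivable bounds nonempty, so that `derivNorm`
is a genuine infimum and not the default value of `sInf`. -/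
theorem exists_derivable (hR : ∀ g, ∃ c, (gen g, c) ∈ R) (p : RatPoly G) :
    ∃ d, Derivable R (p, d) := by
  have hw : ∀ w : List (G × Bool), ∃ d, Derivable R ([((1, 0, 0), w)], d) := by
    intro w
    induction w with
    | nil => exact exists_derivable_const (1, 0, 0)
    | cons l w ih =>
      obtain ⟨d, hd⟩ := ih
      obtain ⟨g, b⟩ := l
      have hl : ∃ e, Derivable R ([((1, 0, 0), [(g, b)])], e) := by
        obtain ⟨e, he⟩ := hR g
        have he' : Derivable R (gen g, e) := .base (.inl he)
        cases b with
        | false => exact ⟨e, he'⟩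
        | true => exact ⟨e, he'.star⟩
      obtain ⟨e, he⟩ := hl
      exact ⟨_, he.mul hd⟩
  induction p with
  | nil => exact ⟨_, derivable_zero.mono.{0} (by simp [gaussElt_zero]) le_rfl⟩
  | cons m p ih =>
    obtain ⟨d, hd⟩ := ih
    obtain ⟨e, he⟩ := hw m.2
    obtain ⟨f, hf⟩ := exists_derivable_const (R := R) m.1
    refine ⟨_, ((hf.mul he).add hd).mono.{0} ?_ le_rfl⟩
    rw [formal_append, formal_mul, formal_const, formal_cons, formal_cons, formal_nil, add_zero,
      MonoidAlgebra.single_mul_single, one_mul, gaussElt_one, mul_one]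

theorem exists_derivable_lt (hR : ∀ g, ∃ c, (gen g, c) ∈ R) {p : RatPoly G} {t : ℝ}
    (h : derivNorm.{u} R (formal p) < t) : ∃ d, Derivable R (p, d) ∧ dyadicVal d < t := by
  have hne : (derivBounds.{u} R (formal p)).Nonempty := by
    obtain ⟨d, hd⟩ := exists_derivable hR p
    exact ⟨_, _, hd, rfl, rfl⟩
  obtain ⟨_, ⟨r, hr, hrp, rfl⟩, hlt⟩ := exists_lt_of_csInf_lt hne h
  exact ⟨r.2, Derivable.mono hr hrp.symm le_rfl, hlt⟩

theorem derivNorm_add_le (hR : ∀ g, ∃ c, (gen g, c) ∈ R) (v w : FreeStar.{u} G) :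
    derivNorm R (v + w) ≤ derivNorm R v + derivNorm R w := by
  obtain ⟨p, rfl⟩ := formal_surjective v
  obtain ⟨q, rfl⟩ := formal_surjective w
  refine le_of_forall_pos_lt_add fun ε hε => ?_
  obtain ⟨c, hc, hc'⟩ := exists_derivable_lt hR (lt_add_of_pos_right _ (half_pos hε))
  obtain ⟨d, hd, hd'⟩ := exists_derivable_lt hR (lt_add_of_pos_right _ (half_pos hε))
  have h := derivNorm_le.{u} (hc.add hd)
  rw [formal_append, dyadicVal_add] at h
  exact h.trans_lt (by linarith)

theorem derivNorm_mul_le (hR : ∀ g, ∃ c, (gen g, c) ∈ R) (v w : FreeStar.{u} G) :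
    derivNorm R (v * w) ≤ derivNorm R v * derivNorm R w := by
  obtain ⟨p, rfl⟩ := formal_surjective v
  obtain ⟨q, rfl⟩ := formal_surjective w
  refine le_mul_of_forall_lt₀ fun s hs t ht => ?_
  obtain ⟨c, hc, hc'⟩ := exists_derivable_lt hR hs
  obtain ⟨d, hd, hd'⟩ := exists_derivable_lt hR ht
  have h := derivNorm_le.{u} (hc.mul hd)
  rw [formal_mul, dyadicVal_mul] at h
  exact h.trans (mul_le_mul hc'.le hd'.le (dyadicVal_nonneg _) ((dyadicVal_nonneg _).trans hc'.le))

theorem derivNorm_star_le (hR : ∀ g, ∃ c, (gen g, c) ∈ R) (v : FreeStar.{u} G) :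
    derivNorm R (star v) ≤ derivNorm R v := by
  obtain ⟨p, rfl⟩ := formal_surjective v
  refine le_of_forall_gt fun t ht => ?_
  obtain ⟨c, hc, hc'⟩ := exists_derivable_lt hR ht
  have h := derivNorm_le.{u} hc.star
  rw [formal_star] at h
  exact h.trans_lt hc'

theorem derivNorm_star (hR : ∀ g, ∃ c, (gen g, c) ∈ R) (v : FreeStar.{u} G) :
    derivNorm R (star v) = derivNorm R v :=
  (derivNorm_star_le hR v).antisymm (by simpa using derivNorm_star_le hR (star v))

/-- If `v*v` had a derivable bound `c` below the square of `derivNorm R v`, a dyadic `d` between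
`√c` and `derivNorm R v` would be a derivable bound of `v` by the C*-rule. -/
theorem le_derivNorm_star_mul_self (hR : ∀ g, ∃ c, (gen g, c) ∈ R) (v : FreeStar.{u} G) :
    derivNorm R v * derivNorm R v ≤ derivNorm R (star v * v) := by
  obtain ⟨p, rfl⟩ := formal_surjective v
  by_contra! hlt
  rw [← formal_star, ← formal_mul] at hlt
  obtain ⟨c, hc, hc'⟩ := exists_derivable_lt hR hlt
  have h1 : √(dyadicVal c) < derivNorm R (formal.{u} p) := by
    rw [Real.sqrt_lt' (by
      by_contra! h0
      rw [(derivNorm_nonneg _).antisymm' h0, mul_zero] at hc'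
      exact (dyadicVal_nonneg c).not_gt hc'), sq]
    exact hc'
  obtain ⟨d, hd, hd'⟩ := exists_dyadicVal_between (Real.sqrt_nonneg _) h1
  have h2 : Derivable R (p, d) := by
    refine .step hc hc (.inr (.inr (.inl ⟨(polyEq_iff.{0} _ _).2 rfl, ?_⟩)))
    rw [dyadicVal_mul, ← sq]
    exact ((Real.sqrt_le_left (dyadicVal_nonneg d)).1 hd.le)
  exact (derivNorm_le.{u} h2).not_gt hd'

/-- The calculus starts from the crude `ℓ¹` bound of constants. That bound is exact for the
nonnegative rational `c̄c`, and the C*-inequality of the seminorm then gives the sharp bound for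
`c`. -/
theorem derivNorm_const_le (hR : ∀ g, ∃ c, (gen g, c) ∈ R) (c : gaussRat) :
    derivNorm R (MonoidAlgebra.single 1 c : FreeStar.{u} G) ≤ ‖c‖ := by
  obtain ⟨c, rfl⟩ := gaussElt_surjective c
  have h1 : derivNorm R (formal.{u} (polyConst (G := G) (gaussMul (gaussConj c) c))) ≤
      ‖gaussElt c‖ * ‖gaussElt c‖ := by
    refine le_of_forall_gt fun t ht => ?_
    obtain ⟨d, hd, hd'⟩ := exists_dyadicVal_between (by positivity) ht
    refine lt_of_le_of_lt (derivNorm_le.{u} (r := (_, d)) (.of_constBound ⟨_, rfl, ?_⟩)) hd'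
    have h2 : gaussVal (gaussMul (gaussConj c) c) = ((‖gaussVal c‖ * ‖gaussVal c‖ : ℝ) : ℂ) := by
      rw [gaussVal_mul, gaussVal_conj, ← sq, ← Complex.normSq_eq_norm_sq,
        Complex.normSq_eq_conj_mul_self]
      rfl
    have h3 : (gaussMul (gaussConj c) c).2.1 = 0 := by
      simp only [gaussMul, gaussConj]; ring
    have h4 : 0 ≤ (gaussMul (gaussConj c) c).1 := by
      simp only [gaussMul, gaussConj]; nlinarith [mul_self_nonneg c.1, mul_self_nonneg c.2.1]
    revert h2 h3 h4
    generalize gaussMul (gaussConj c) c = e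
    intro h2 h3 h4
    have h5 : ‖gaussVal c‖ * ‖gaussVal c‖ = (e.1.natAbs : ℝ) / ((e.2.2 : ℝ) + 1) := by
      have h6 : gaussVal e = (((e.1.natAbs : ℝ) / ((e.2.2 : ℝ) + 1) : ℝ) : ℂ) := by
        rw [gaussVal, h3]
        have h7 : (e.1 : ℂ) = ((e.1.natAbs : ℝ) : ℂ) := by
          conv_lhs => rw [← Int.natAbs_of_nonneg h4]
          rw [Int.cast_natCast, Complex.ofReal_natCast]
        rw [h7]
        push_cast
        simp
      rw [h6] at h2
      exact_mod_cast h2.symm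
    have h8 : (e.1.natAbs : ℝ) / ((e.2.2 : ℝ) + 1) < (d.1 : ℝ) / 2 ^ d.2 := by
      rw [← h5]; exact hd
    rw [div_lt_div_iff₀ (by positivity) (by positivity)] at h8
    simp only [h3, Int.natAbs_zero, add_zero]
    exact_mod_cast h8.le
  have h2 := le_derivNorm_star_mul_self hR (formal.{u} (polyConst (G := G) c))
  rw [← formal_star, ← formal_mul] at h2
  have h3 : polyMul (polyStar (polyConst (G := G) c)) (polyConst c) =
    polyConst (gaussMul (gaussConj c) c) := rfl
  rw [h3] at h2
  rw [← formal_const]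
  exact (mul_self_le_mul_self_iff (derivNorm_nonneg _) (norm_nonneg _)).2 (h2.trans h1)

theorem derivNorm_zero : derivNorm R (0 : FreeStar.{u} G) = 0 := by
  refine ((derivNorm_nonneg _).antisymm' ?_)
  have h := derivNorm_le.{u} (derivable_zero (R := R))
  simpa [gaussElt_zero, dyadicVal] using h

theorem derivNorm_neg_le (hR : ∀ g, ∃ c, (gen g, c) ∈ R) (v : FreeStar.{u} G) :
    derivNorm R (-v) ≤ derivNorm R v := by
  have h1 : -v = MonoidAlgebra.single 1 (-1) * v := by
    refine neg_eq_of_add_eq_zero_right ?_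
    calc v + MonoidAlgebra.single 1 (-1) * v
        = (MonoidAlgebra.single 1 1 + MonoidAlgebra.single 1 (-1)) * v := by
          rw [add_mul, ← MonoidAlgebra.one_def, one_mul]
      _ = 0 := by rw [← MonoidAlgebra.single_add]; simp
  rw [h1]
  refine (derivNorm_mul_le hR _ _).trans (mul_le_of_le_one_left (derivNorm_nonneg _) ?_)
  refine (derivNorm_const_le hR _).trans ?_
  rw [norm_neg]
  exact CStarRing.norm_one.le

/-- The universal C*-seminorm of a set of relations is realized by a representation. -/
theorem exists_representation (hR : ∀ g, ∃ c, (gen g, c) ∈ R) :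
    ∃ (C : Type u) (_ : CStarAlgebra C) (y : G → C), IsRepresentation R y ∧
      ∀ p, ‖polyVal y p‖ = derivNorm R (formal.{u} p) := by
  let N : RingSeminorm (FreeStar.{u} G) :=
    { toFun := derivNorm R
      map_zero' := derivNorm_zero
      add_le' := derivNorm_add_le hR
      neg' := fun v => (derivNorm_neg_le hR v).antisymm (by simpa using derivNorm_neg_le hR (-v))
      mul_le' := derivNorm_mul_le hR }
  obtain ⟨C, _, ι, hs, hc, hn⟩ := exists_cstarAlgebra_completion (V := FreeStar.{u} G)
    (K := gaussRat) N (derivNorm_star hR) (le_derivNorm_star_mul_self hR)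
    (gaussRat.subtype : gaussRat →+* ℂ) isometry_subtype_coe
    (denseRange_gaussVal.mono (by rintro _ ⟨c, rfl⟩; exact ⟨gaussElt c, rfl⟩)) (fun _ => rfl)
    MonoidAlgebra.singleOneRingHom (derivNorm_const_le hR)
    (fun c v => MonoidAlgebra.single_one_comm c v)
    (fun c => by
      change _ = star (MonoidAlgebra.single 1 c)
      rw [star_freeStar_single]
      rfl)
  let y : G → C := fun g => ι (formal (gen g))
  -- Evaluation at the images of the generators is the canonical map into the completion; this is
  -- checked on words first.
  have hw : ∀ w : List (G × Bool), ι (MonoidAlgebra.single (freeWord w) 1) =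
      (w.map (letterVal y)).prod := by
    intro w
    induction w with
    | nil => exact map_one ι
    | cons l w ih =>
      have hl : ι (MonoidAlgebra.single (freeWord [l]) 1) = letterVal y l := by
        obtain ⟨g, b⟩ := l
        have hg : formal.{u} (gen g) = MonoidAlgebra.single (freeWord [(g, false)]) 1 := by
          simp [gen, gaussElt_one]
        cases b with
        | false => simp [letterVal, y, hg]
        | true =>
          have h1 : letterVal y (g, true) = ι (star (formal (gen g))) := by
            simp [letterVal, y, hs]
          rw [h1, hg, star_freeStar_single, freeWordStar_freeWord, star_one]
          rfl
      have h2 : freeWord.{u} (l :: w) = freeWord [l] * freeWord w := freeWord_append [l] w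
      rw [h2, List.map_cons, List.prod_cons, ← ih, ← hl, ← map_mul,
        MonoidAlgebra.single_mul_single, one_mul]
  have hp : ∀ p, polyVal y p = ι (formal p) := by
    intro p
    induction p with
    | nil => simp
    | cons m p ih =>
      have h1 : (MonoidAlgebra.single (freeWord m.2) (gaussElt m.1) : FreeStar.{u} G) =
          MonoidAlgebra.singleOneRingHom (gaussElt m.1) *
            MonoidAlgebra.single (freeWord m.2) 1 := by
        simp [MonoidAlgebra.single_mul_single]
      rw [polyVal_cons, formal_cons, map_add, ih, h1, map_mul, hc, hw, monoVal, Algebra.smul_def]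
      rfl
  refine ⟨C, inferInstance, y, fun r hr => ?_, fun p => by rw [hp, hn]; rfl⟩
  rw [hp, hn]
  exact derivNorm_le (.base (.inl hr))

end Derivations


/-! ### Derivability is recursively enumerable. -/

section Enumerability

variable {G : Type} [Primcodable G]

theorem primrecPred_derivStep :
    PrimrecPred fun x : RatRelation G × RatRelation G × RatRelation G =>
      DerivStep x.1 x.2.1 x.2.2 := by
  have a1 : Primrec fun x : RatRelation G × RatRelation G × RatRelation G => x.1.1 :=
    Primrec.fst.comp Primrec.fst
  have a2 : Primrec fun x : RatRelation G × RatRelation G × RatRelation G => x.1.2 :=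
    Primrec.snd.comp Primrec.fst
  have b1 : Primrec fun x : RatRelation G × RatRelation G × RatRelation G => x.2.1.1 :=
    Primrec.fst.comp (Primrec.fst.comp Primrec.snd)
  have b2 : Primrec fun x : RatRelation G × RatRelation G × RatRelation G => x.2.1.2 :=
    Primrec.snd.comp (Primrec.fst.comp Primrec.snd)
  have c1 : Primrec fun x : RatRelation G × RatRelation G × RatRelation G => x.2.2.1 :=
    Primrec.fst.comp (Primrec.snd.comp Primrec.snd)
  have c2 : Primrec fun x : RatRelation G × RatRelation G × RatRelation G => x.2.2.2 :=
    Primrec.snd.comp (Primrec.snd.comp Primrec.snd)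
  refine PrimrecPred.or (PrimrecPred.and ?_ ?_) (PrimrecPred.or (PrimrecPred.and ?_ ?_)
    (PrimrecPred.or (PrimrecPred.and ?_ ?_) (PrimrecPred.and ?_ ?_)))
  · exact primrecRel_polyEq.comp c1 (Primrec.list_append.comp a1 b1)
  · exact primrecRel_dyadicVal_le.comp (primrec_dyadicAdd.comp a2 b2) c2
  · exact primrecRel_polyEq.comp c1 (primrec_polyMul.comp a1 b1)
  · exact primrecRel_dyadicVal_le.comp (primrec_dyadicMul.comp a2 b2) c2
  · exact primrecRel_polyEq.comp (primrec_polyMul.comp (primrec_polyStar.comp c1) c1) a1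
  · exact primrecRel_dyadicVal_le.comp a2 (primrec_dyadicMul.comp c2 c2)
  · exact primrecRel_polyEq.comp c1 (primrec_polyStar.comp a1)
  · exact primrecRel_dyadicVal_le.comp a2 c2

theorem rePred_constBound : REPred (ConstBound (G := G)) := by
  have hc : Primrec fun z : RatRelation G × (ℤ × ℤ × ℕ) => z.2 := Primrec.snd
  have h : PrimrecPred fun z : RatRelation G × (ℤ × ℤ × ℕ) => z.1.1 = polyConst z.2 ∧
      (z.2.1.natAbs + z.2.2.1.natAbs) * 2 ^ z.1.2.2 ≤ z.1.2.1 * (z.2.2.2 + 1) := by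
    refine PrimrecPred.and (Primrec.eq.comp (Primrec.fst.comp Primrec.fst)
      (primrec_polyConst.comp hc)) (Primrec.nat_le.comp (Primrec.nat_mul.comp (Primrec.nat_add.comp
        (primrec_int_natAbs.comp (Primrec.fst.comp hc))
        (primrec_int_natAbs.comp (Primrec.fst.comp (Primrec.snd.comp hc))))
        (primrec_nat_two_pow.comp (Primrec.snd.comp (Primrec.snd.comp Primrec.fst))))
        (Primrec.nat_mul.comp (Primrec.fst.comp (Primrec.snd.comp Primrec.fst))
        (Primrec.succ.comp (Primrec.snd.comp (Primrec.snd.comp hc)))))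
  exact REPred.exists h.computablePred.to_re

/-- The parameter lets the set of relations vary; the lower bounds in a simple algebra need this,
because there the relation under test is itself added to `R`. -/
theorem rePred_derivable {θ : Type} [Primcodable θ] {R : θ → Set (RatRelation G)}
    (hR : REPred fun x : θ × RatRelation G => x.2 ∈ R x.1) :
    REPred fun x : θ × RatRelation G => Derivable (R x.1) x.2 :=
  REPred.closure (B := fun t r => r ∈ R t ∨ ConstBound r)
    (REPred.or hR (rePred_constBound.comp Computable.snd)) primrecPred_derivStep

end Enumerability

/-! ### Upper bounds for norms in c.e. presentations. -/

section UpperBounds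

variable {G : Type} {A : Type u} [CStarAlgebra A] {R : Set (RatRelation G)} {x : G → A}

/-- Completeness of the calculus: the universal algebra maps contractively to the algebra whose norm
is `derivNorm`, so `derivNorm` is at most the universal norm. The converse is soundness. -/
theorem IsUniversal.norm_polyVal_lt_iff (hx : IsUniversal R x) (hR : ∀ g, ∃ c, (gen g, c) ∈ R)
    (p : RatPoly G) (t : ℝ) :
    ‖polyVal x p‖ < t ↔ ∃ d, Derivable R (p, d) ∧ dyadicVal d < t := by
  constructor
  · intro h
    obtain ⟨C, _, y, hy, hn⟩ := exists_representation.{u} hR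
    obtain ⟨φ, hφ, -⟩ := hx.2 C y hy
    have h1 : φ (polyVal x p) = polyVal y p := by
      rw [map_polyVal]
      exact congrArg (polyVal · p) (funext hφ)
    refine exists_derivable_lt.{u} hR ?_
    rw [← hn, ← h1]
    exact (NonUnitalStarAlgHom.norm_apply_le φ _).trans_lt h
  · rintro ⟨d, hd, hlt⟩
    exact (hd.norm_polyVal_le hx.1).trans_lt hlt

theorem IsCEPresentation.rePred_norm_lt [Primcodable G] (hx : IsCEPresentation R x) :
    REPred fun z : RatPoly G × (ℕ × ℕ) => ‖polyVal x z.1‖ < dyadicVal z.2 := by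
  have h1 : REPred fun z : Unit × RatRelation G => Derivable R z.2 :=
    rePred_derivable (R := fun _ => R) (hx.1.comp Computable.snd)
  have h2 : Computable fun y : (RatPoly G × (ℕ × ℕ)) × (ℕ × ℕ) => ((), (y.1.1, y.2)) :=
    ((Primrec.const ()).pair ((Primrec.fst.comp Primrec.fst).pair Primrec.snd)).to_comp
  have h3 : PrimrecPred fun y : (RatPoly G × (ℕ × ℕ)) × (ℕ × ℕ) =>
      dyadicVal y.2 < dyadicVal y.1.2 :=
    primrecRel_dyadicVal_lt.comp Primrec.snd (Primrec.snd.comp Primrec.fst)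
  exact ((h1.comp h2).and h3.computablePred.to_re).exists.of_eq fun z =>
    (hx.2.2.norm_polyVal_lt_iff hx.2.1 z.1 (dyadicVal z.2)).symm

end UpperBounds

/-! ### Lower bounds for norms in simple c.e. algebras. -/

section SimpleLowerBounds

variable {G : Type} {B : Type u} [CStarAlgebra B] {R : Set (RatRelation G)} {y : G → B}

theorem injective_or_subsingleton_of_isSimpleCStar (hB : IsSimpleCStar B) {C : Type u}
    [CStarAlgebra C] (φ : B →⋆ₐ[ℂ] C) : Function.Injective φ ∨ Subsingleton C := by
  have hcl : IsClosed ((TwoSidedIdeal.ker φ : TwoSidedIdeal B) : Set B) := by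
    have h : ((TwoSidedIdeal.ker φ : TwoSidedIdeal B) : Set B) = φ ⁻¹' {0} := by
      ext b
      simp [TwoSidedIdeal.mem_ker]
    rw [h]
    have hφ : Continuous φ := by
      refine AddMonoidHomClass.continuous_of_bound φ 1 fun b => ?_
      rw [one_mul]
      exact NonUnitalStarAlgHom.norm_apply_le φ b
    exact isClosed_singleton.preimage hφ
  rcases hB.2 _ hcl with h | h
  · refine .inl ((injective_iff_map_eq_zero φ).2 fun b hb => ?_)
    have : b ∈ (TwoSidedIdeal.ker φ : TwoSidedIdeal B) := (TwoSidedIdeal.mem_ker φ).2 hb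
    rwa [h] at this
  · right
    have h1 : (1 : B) ∈ (TwoSidedIdeal.ker φ : TwoSidedIdeal B) := by rw [h]; trivial
    rw [TwoSidedIdeal.mem_ker, map_one] at h1
    exact subsingleton_of_zero_eq_one h1.symm

/-- If `p(y)` has norm above `c`, the added relation fails in every faithful image of `B`, so by
simplicity it forces the zero algebra; otherwise `B` itself is a nonzero model of it. The code `(1,
1)` is the value `1/2`; any dyadic strictly between `0` and `1` would distinguish the two cases. -/
theorem lt_norm_polyVal_iff_derivable (hB : IsSimpleCStar B) (hy : IsUniversal R y)
    (hR : ∀ g, ∃ c, (gen g, c) ∈ R) (p : RatPoly G) (c : ℕ × ℕ) :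
    dyadicVal c < ‖polyVal y p‖ ↔
      Derivable (insert (p, c) R) (polyConst (1, 0, 0), (1, 1)) := by
  have hR' : ∀ g, ∃ d, (gen g, d) ∈ insert (p, c) R := fun g =>
    (hR g).imp fun d hd => Set.mem_insert_of_mem _ hd
  constructor
  · intro h
    obtain ⟨C, _, z, hz, hn⟩ := exists_representation.{u} hR'
    obtain ⟨φ, hφ, -⟩ := hy.2 C z fun r hr => hz r (Set.mem_insert_of_mem _ hr)
    have h1 : φ (polyVal y p) = polyVal z p := by
      rw [map_polyVal]
      exact congrArg (polyVal · p) (funext hφ)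
    -- An injective homomorphism is isometric, which would contradict the added bound.
    rcases injective_or_subsingleton_of_isSimpleCStar hB φ with hi | hC
    · have h2 : ‖φ (polyVal y p)‖ = ‖polyVal y p‖ := NonUnitalStarAlgHom.norm_map φ hi _
      rw [h1] at h2
      exact absurd (hz _ (Set.mem_insert _ _)) (by rw [h2]; exact not_le.2 h)
    · have h2 := hn (polyConst (1, 0, 0))
      rw [Subsingleton.elim (polyVal z _) 0, norm_zero] at h2
      have h3 : derivNorm.{u} (insert (p, c) R) (formal (polyConst (1, 0, 0))) <
          dyadicVal (1, 1) := by
        rw [← h2]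
        norm_num [dyadicVal]
      obtain ⟨d, hd, hlt⟩ := exists_derivable_lt hR' h3
      exact hd.mono.{0} rfl hlt.le
  · intro h
    by_contra! hle
    have h1 := h.norm_polyVal_le (x := y) (by
      rintro r (rfl | hr)
      · exact hle
      · exact hy.1 r hr)
    have := hB.1
    rw [polyVal_const, gaussVal_one, map_one, CStarRing.norm_one] at h1
    norm_num [dyadicVal] at h1

theorem IsCEPresentation.rePred_lt_norm [Primcodable G] (hB : IsSimpleCStar B)
    (hy : IsCEPresentation R y) :
    REPred fun z : RatPoly G × (ℕ × ℕ) => dyadicVal z.2 < ‖polyVal y z.1‖ := by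
  have h1 : REPred fun z : RatRelation G × RatRelation G => Derivable (insert z.1 R) z.2 := by
    refine rePred_derivable (R := fun t => insert t R) (REPred.or ?_ (hy.1.comp Computable.snd))
    exact (PrimrecPred.computablePred (Primrec.eq.comp Primrec.snd Primrec.fst)).to_re
  exact (h1.comp (Computable.pair Computable.id (Computable.const _))).of_eq fun z =>
    (lt_norm_polyVal_iff_derivable hB hy.2.2 hy.2.1 z.1 z.2).symm

end SimpleLowerBounds


/-! ### Generation and density of rational points. -/

section Generation

variable {G : Type} {A : Type u} [CStarAlgebra A]

/-- Universality gives a map into the closed `*`-subalgebra generated by `x`; by uniqueness its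
composite with the inclusion is the identity, so the inclusion is onto. -/
theorem IsUniversal.isPresentation {R : Set (RatRelation G)} {x : G → A} (hx : IsUniversal R x) :
    IsPresentation x := by
  let S := (StarAlgebra.adjoin ℂ (Set.range x)).topologicalClosure
  have : IsClosed (S : Set A) := StarSubalgebra.isClosed_topologicalClosure _
  let y : G → S := fun g => ⟨x g, StarSubalgebra.le_topologicalClosure _
    (StarAlgebra.subset_adjoin ℂ _ ⟨g, rfl⟩)⟩
  have hy : IsRepresentation R y := fun r hr => by
    have h : (S.subtype (polyVal y r.1) : A) = polyVal x r.1 := map_polyVal S.subtype y r.1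
    refine le_trans (le_of_eq ?_) (hx.1 r hr)
    rw [← h]
    rfl
  obtain ⟨φ, hφ, -⟩ := hx.2 S y hy
  have h : S.subtype.comp φ = StarAlgHom.id ℂ A :=
    (hx.2 A x hx.1).unique (fun g => by simp [hφ, y]) (fun g => rfl)
  refine eq_top_iff.2 fun a _ => ?_
  have ha : (φ a : A) = a := congrArg (fun ψ : A →⋆ₐ[ℂ] A => ψ a) h
  rw [← ha]
  exact (φ a).2

/-- The closure of the rational points is already closed under complex scalars, because the Gaussian
rationals are dense in `ℂ`. -/
theorem IsPresentation.denseRange_polyVal {x : G → A} (hx : IsPresentation x) :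
    DenseRange (polyVal x) := by
  let T : StarSubalgebra ℂ A :=
    { carrier := closure (Set.range (polyVal x))
      mul_mem' := fun ha hb => map_mem_closure₂ continuous_mul ha hb (by
        rintro _ ⟨p, rfl⟩ _ ⟨q, rfl⟩
        exact ⟨_, polyVal_mul x p q⟩)
      add_mem' := fun ha hb => map_mem_closure₂ continuous_add ha hb (by
        rintro _ ⟨p, rfl⟩ _ ⟨q, rfl⟩
        exact ⟨_, polyVal_append x p q⟩)
      algebraMap_mem' := fun c => map_mem_closure (continuous_algebraMap ℂ A)
        (denseRange_gaussVal c) (by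
          rintro _ ⟨c, rfl⟩
          exact ⟨_, polyVal_const x c⟩)
      star_mem' := fun ha => map_mem_closure continuous_star ha (by
        rintro _ ⟨p, rfl⟩
        exact ⟨_, polyVal_star x p⟩) }
  have hT : IsClosed (T : Set A) := isClosed_closure
  have h1 : StarAlgebra.adjoin ℂ (Set.range x) ≤ T := by
    refine StarAlgebra.adjoin_le ?_
    rintro _ ⟨g, rfl⟩
    exact subset_closure ⟨gen g, polyVal_gen x g⟩
  have h2 := StarSubalgebra.topologicalClosure_minimal h1 hT
  rw [IsPresentation] at hx
  rw [hx] at h2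
  exact fun a => h2 trivial

theorem IsPresentation.separableSpace [Countable G] {x : G → A} (hx : IsPresentation x) :
    TopologicalSpace.SeparableSpace A :=
  ⟨⟨_, Set.countable_range (polyVal x), hx.denseRange_polyVal⟩⟩

theorem continuous_polyVal (p : RatPoly G) : Continuous fun z : G → A => polyVal z p := by
  have hl : ∀ l : G × Bool, Continuous fun z : G → A => letterVal z l := by
    rintro ⟨g, b⟩
    cases b
    · simpa [letterVal] using continuous_apply g
    · simpa [letterVal] using (continuous_apply (A := fun _ => A) g).star
  have hw : ∀ w : List (G × Bool), Continuous fun z : G → A => (w.map (letterVal z)).prod := by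
    intro w
    induction w with
    | nil => simpa using continuous_const
    | cons l w ih => simpa using! (hl l).mul ih
  induction p with
  | nil => simpa using continuous_const
  | cons m p ih => simpa [monoVal] using! ((hw m.2).const_smul (gaussVal m.1)).add ih

end Generation

/-! ### Computable Lipschitz constants of polynomials. -/

section Lipschitz

variable {G : Type} {A : Type u} [CStarAlgebra A]

/-- A Lipschitz constant of a polynomial on the tuples with norms at most `C`. -/
def polyLip (C : ℕ) (p : RatPoly G) : ℕ :=
  p.foldr (fun m s => (m.1.1.natAbs + m.1.2.1.natAbs) * (m.2.length * C ^ m.2.length) + s) 0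

theorem norm_letterVal_le {C : ℝ} {z : G → A} (hz : ∀ g, ‖z g‖ ≤ C) (l : G × Bool) :
    ‖letterVal z l‖ ≤ C := by
  unfold letterVal
  split_ifs <;> simp [hz]

theorem norm_letterVal_sub_le {δ : ℝ} {z w : G → A} (h : ∀ g, ‖z g - w g‖ ≤ δ) (l : G × Bool) :
    ‖letterVal z l - letterVal w l‖ ≤ δ := by
  unfold letterVal
  split_ifs
  · rw [← star_sub, norm_star]
    exact h _
  · exact h _

theorem norm_one_le_one : ‖(1 : A)‖ ≤ 1 := by
  rcases subsingleton_or_nontrivial A with hA | hA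
  · rw [Subsingleton.elim (1 : A) 0, norm_zero]
    exact zero_le_one
  · exact CStarRing.norm_one.le

theorem norm_prod_letterVal_le {C : ℝ} {z : G → A} (hz : ∀ g, ‖z g‖ ≤ C)
    (v : List (G × Bool)) : ‖(v.map (letterVal z)).prod‖ ≤ C ^ v.length := by
  induction v with
  | nil => simpa using norm_one_le_one
  | cons l v ih =>
    rw [List.map_cons, List.prod_cons, List.length_cons, pow_succ']
    have := norm_letterVal_le hz l
    exact (norm_mul_le _ _).trans (mul_le_mul this ih (norm_nonneg _) ((norm_nonneg _).trans this))

/-- Letters are replaced one at a time; `1 ≤ C` lets shorter powers of `C` be absorbed into longer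
ones. -/
theorem norm_prod_letterVal_sub_le {C δ : ℝ} (hC : 1 ≤ C) (hδ : 0 ≤ δ) {z w : G → A}
    (hz : ∀ g, ‖z g‖ ≤ C) (hw : ∀ g, ‖w g‖ ≤ C) (h : ∀ g, ‖z g - w g‖ ≤ δ)
    (v : List (G × Bool)) :
    ‖(v.map (letterVal z)).prod - (v.map (letterVal w)).prod‖ ≤
      v.length * C ^ v.length * δ := by
  induction v with
  | nil => simp
  | cons l v ih =>
    simp only [List.map_cons, List.prod_cons, List.length_cons]
    set P := (v.map (letterVal z)).prod
    set Q := (v.map (letterVal w)).prod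
    have h1 : letterVal z l * P - letterVal w l * Q =
        letterVal z l * (P - Q) + (letterVal z l - letterVal w l) * Q := by noncomm_ring
    have hC0 : 0 ≤ C := zero_le_one.trans hC
    have h2 : ‖letterVal z l * (P - Q)‖ ≤ C * (v.length * C ^ v.length * δ) :=
      (norm_mul_le _ _).trans (mul_le_mul (norm_letterVal_le hz l) ih (norm_nonneg _) hC0)
    have h3 : ‖(letterVal z l - letterVal w l) * Q‖ ≤ δ * C ^ (v.length + 1) :=
      (norm_mul_le _ _).trans (mul_le_mul (norm_letterVal_sub_le h l)
        ((norm_prod_letterVal_le hw v).trans (pow_le_pow_right₀ hC (Nat.le_succ _)))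
        (norm_nonneg _) hδ)
    rw [h1]
    refine (norm_add_le _ _).trans ((add_le_add h2 h3).trans (le_of_eq ?_))
    push_cast
    ring

theorem norm_polyVal_sub_le {C : ℕ} {δ : ℝ} (hC : 1 ≤ C) (hδ : 0 ≤ δ) {z w : G → A}
    (hz : ∀ g, ‖z g‖ ≤ C) (hw : ∀ g, ‖w g‖ ≤ C) (h : ∀ g, ‖z g - w g‖ ≤ δ) (p : RatPoly G) :
    ‖polyVal z p - polyVal w p‖ ≤ polyLip C p * δ := by
  induction p with
  | nil => simp [polyLip]
  | cons m p ih =>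
    have h1 : polyLip C (m :: p) = (m.1.1.natAbs + m.1.2.1.natAbs) *
      (m.2.length * C ^ m.2.length) + polyLip C p := rfl
    have h2 : ‖monoVal z m - monoVal w m‖ ≤ ((m.1.1.natAbs + m.1.2.1.natAbs : ℕ) : ℝ) *
        (m.2.length * C ^ m.2.length * δ) := by
      rw [monoVal, monoVal, ← smul_sub, norm_smul]
      refine mul_le_mul ((norm_gaussVal_le m.1).trans (div_le_self (by positivity) ?_))
        (norm_prod_letterVal_sub_le (by exact_mod_cast hC) hδ hz hw h m.2) (norm_nonneg _)
        (by positivity)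
      exact le_add_of_nonneg_left (Nat.cast_nonneg _)
    rw [polyVal_cons, polyVal_cons, h1, add_sub_add_comm]
    refine (norm_add_le _ _).trans ((add_le_add h2 ih).trans (le_of_eq ?_))
    push_cast
    ring

theorem primrec_polyLip [Primcodable G] (C : ℕ) : Primrec (polyLip (G := G) C) := by
  refine Primrec.list_foldr (h := fun (_ : RatPoly G) (y : RatMonomial G × ℕ) =>
    (y.1.1.1.natAbs + y.1.1.2.1.natAbs) * (y.1.2.length * C ^ y.1.2.length) + y.2)
    Primrec.id (Primrec.const 0) ?_
  have h1 : Primrec fun x : RatPoly G × RatMonomial G × ℕ => x.2.1.1 :=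
    Primrec.fst.comp (Primrec.fst.comp Primrec.snd)
  have h2 : Primrec fun x : RatPoly G × RatMonomial G × ℕ => x.2.1.2.length :=
    Primrec.list_length.comp (Primrec.snd.comp (Primrec.fst.comp Primrec.snd))
  have hpow : Primrec₂ fun a b : ℕ => a ^ b := Primrec₂.unpaired'.1 Nat.Primrec.pow
  exact Primrec.nat_add.comp (Primrec.nat_mul.comp
    (Primrec.nat_add.comp (primrec_int_natAbs.comp (Primrec.fst.comp h1))
      (primrec_int_natAbs.comp (Primrec.fst.comp (Primrec.snd.comp h1))))
    (Primrec.nat_mul.comp h2 (hpow.comp (Primrec.const C) h2))) (Primrec.snd.comp Primrec.snd)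

end Lipschitz

/-! ### Norms in ultrapowers. -/

section UltrapowerNorm

variable {U : Ultrafilter ℕ} {B : Type u} [CStarAlgebra B]

variable (U) in
/-- The limit of the norms of a bounded sequence along an ultrafilter. -/
noncomputable def ultraNorm (f : ℕ →ᵇ B) : ℝ :=
  Filter.limUnder (U : Filter ℕ) fun n => ‖f n‖

theorem tendsto_ultraNorm (f : ℕ →ᵇ B) :
    Filter.Tendsto (fun n => ‖f n‖) U (𝓝 (ultraNorm U f)) := by
  refine tendsto_nhds_limUnder ?_
  have h : Set.Icc (0 : ℝ) ‖f‖ ∈ U.map fun n => ‖f n‖ :=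
    Ultrafilter.mem_map.2 (Filter.univ_mem' fun n => ⟨norm_nonneg _, f.norm_coe_le_norm n⟩)
  obtain ⟨t, -, ht⟩ := isCompact_Icc.ultrafilter_le_nhds' _ h
  exact ⟨t, ht⟩

theorem ultraNorm_eq {f : ℕ →ᵇ B} {t : ℝ} (h : Filter.Tendsto (fun n => ‖f n‖) U (𝓝 t)) :
    ultraNorm U f = t := tendsto_nhds_unique (tendsto_ultraNorm f) h

theorem ultraNorm_le_norm (f : ℕ →ᵇ B) : ultraNorm U f ≤ ‖f‖ :=
  le_of_tendsto' (tendsto_ultraNorm f) fun n => f.norm_coe_le_norm n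

/-- The sequences modulo an ultrafilter complete to a C*-algebra. -/
theorem exists_ultraNorm_completion (U : Ultrafilter ℕ) (B : Type u) [CStarAlgebra B] :
    ∃ (C : Type u) (_ : CStarAlgebra C) (ι : (ℕ →ᵇ B) →⋆ₐ[ℂ] C), ∀ f, ‖ι f‖ = ultraNorm U f := by
  let N : RingSeminorm (ℕ →ᵇ B) :=
    { toFun := ultraNorm U
      map_zero' := ultraNorm_eq (by simp)
      add_le' := fun f g => le_of_tendsto_of_tendsto' (tendsto_ultraNorm _)
        ((tendsto_ultraNorm f).add (tendsto_ultraNorm g)) fun n => norm_add_le _ _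
      neg' := fun f => ultraNorm_eq (by simpa using tendsto_ultraNorm f)
      mul_le' := fun f g => le_of_tendsto_of_tendsto' (tendsto_ultraNorm _)
        ((tendsto_ultraNorm f).mul (tendsto_ultraNorm g)) fun n => norm_mul_le _ _ }
  have hstar : ∀ v, N (star v) = N v := fun v =>
    ultraNorm_eq ((tendsto_ultraNorm v).congr fun n => (norm_star _).symm)
  have hcstar : ∀ v, N v * N v ≤ N (star v * v) := fun v => by
    refine (ultraNorm_eq ?_).ge
    exact ((tendsto_ultraNorm v).mul (tendsto_ultraNorm v)).congr fun n =>
      CStarRing.norm_star_mul_self.symm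
  obtain ⟨C, _, ι, hs, hc, hn⟩ := exists_cstarAlgebra_completion N hstar hcstar
    (RingHom.id ℂ) isometry_id Function.surjective_id.denseRange (fun _ => rfl)
    (algebraMap ℂ (ℕ →ᵇ B)) (fun c => (ultraNorm_le_norm _).trans (by
      rw [Algebra.algebraMap_eq_smul_one]
      refine (norm_smul_le _ _).trans ?_
      exact mul_le_of_le_one_right (norm_nonneg _) norm_one_le_one))
    (fun c v => Algebra.commutes (A := ℕ →ᵇ B) c v)
    (fun c => algebraMap_star_comm (A := ℕ →ᵇ B) c)
  exact ⟨C, inferInstance,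
    { toFun := ι
      map_one' := map_one ι
      map_mul' := map_mul ι
      map_zero' := map_zero ι
      map_add' := map_add ι
      commutes' := hc
      map_star' := hs }, hn⟩

theorem polyVal_boundedContinuousFunction_apply {G : Type} (f : G → ℕ →ᵇ B) (p : RatPoly G)
    (n : ℕ) : polyVal f p n = polyVal (fun g => f g n) p := by
  let e : (ℕ →ᵇ B) →⋆ₐ[ℂ] B :=
    { toFun := fun f => f n
      map_one' := rfl
      map_mul' := fun _ _ => rfl
      map_zero' := rfl
      map_add' := fun _ _ => rfl
      commutes' := fun _ => rfl
      map_star' := fun _ => rfl }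
  exact map_polyVal e f p

/-- A tuple of a C*-algebra which embeds in an ultrapower of `B` is approximated by tuples of `B`,
with respect to the norms of all rational polynomials. -/
theorem EmbedsInUltrapower.exists_tendsto {A : Type u} [CStarAlgebra A]
    (h : EmbedsInUltrapower U B A) {G : Type} (x : G → A) :
    ∃ f : G → ℕ → B, ∀ p : RatPoly G,
      Filter.Tendsto (fun n => ‖polyVal (fun g => f g n) p‖) U (𝓝 ‖polyVal x p‖) := by
  obtain ⟨Φ, hΦ⟩ := h
  -- The ultrapower is used here only as a `*`-algebra. It embeds in the C*-algebra `C`, since `ι`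
  -- vanishes exactly on the null ideal.
  obtain ⟨C, _, ι, hι⟩ := exists_ultraNorm_completion U B
  have hker : ∀ f : ℕ →ᵇ B, ι f = 0 ↔ f ∈ nullIdeal U B := fun f => by
    rw [mem_nullIdeal, ← norm_eq_zero, hι]
    exact ⟨fun h => h ▸ tendsto_ultraNorm f, ultraNorm_eq⟩
  let θ : Ultrapower U B →+* C := RingCon.lift _ (ι : (ℕ →ᵇ B) →+* C) fun f g hfg => by
    rw [TwoSidedIdeal.rel_iff, ← hker, map_sub, sub_eq_zero] at hfg
    exact hfg
  have hθ : ∀ f : ℕ →ᵇ B, θ ((nullIdeal U B).ringCon.mk' f) = ι f := fun _ => rfl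
  have hsurj : ∀ a : Ultrapower U B, ∃ f : ℕ →ᵇ B, (nullIdeal U B).ringCon.mk' f = a :=
    RingCon.mk'_surjective _
  let ψ : A →⋆ₐ[ℂ] C :=
    { toFun := fun a => θ (Φ a)
      map_one' := by rw [map_one, map_one]
      map_mul' := fun a b => by rw [map_mul, map_mul]
      map_zero' := by rw [map_zero, map_zero]
      map_add' := fun a b => by rw [map_add, map_add]
      commutes' := fun c => by
        rw [AlgHomClass.commutes]
        exact AlgHomClass.commutes ι c
      map_star' := fun a => by
        obtain ⟨f, hf⟩ := hsurj (Φ a)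
        rw [map_star, ← hf, star_mk, hθ, hθ, map_star] }
  have hψ : Function.Injective ψ := by
    refine (injective_iff_map_eq_zero ψ).2 fun a ha => ?_
    obtain ⟨f, hf⟩ := hsurj (Φ a)
    have h1 : ι f = 0 := by rw [← hθ, hf]; exact ha
    rw [hker] at h1
    refine (injective_iff_map_eq_zero Φ).1 hΦ a ?_
    rw [← hf]
    exact (TwoSidedIdeal.mem_iff _ _).1 h1 |> (RingCon.eq _).2
  choose f hf using fun g => hsurj (Φ (x g))
  refine ⟨fun g n => f g n, fun p => ?_⟩
  have h1 : ψ (polyVal x p) = ι (polyVal f p) := by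
    rw [map_polyVal, map_polyVal]
    congr 1
    funext g
    change θ (Φ (x g)) = _
    rw [← hf, hθ]
  -- Injectivity makes `ψ` isometric, so norms in `A` are limits along `U` of norms in `B`.
  rw [← NonUnitalStarAlgHom.norm_map ψ hψ, h1, hι]
  simpa only [polyVal_boundedContinuousFunction_apply] using tendsto_ultraNorm (polyVal f p)

end UltrapowerNorm


/-! ### Computability of weakly stable presentations. -/

section WeaklyStablePresentations

variable {A : Type u} [CStarAlgebra A]

theorem rePred_mem_finite {α : Type*} [Primcodable α] {s : Set α} (hs : s.Finite) :
    REPred fun a => a ∈ s := by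
  have h : PrimrecPred fun a => ∃ b ∈ hs.toFinset.toList, b = a :=
    PrimrecRel.comp (R := fun (L : List α) a => ∃ b ∈ L, b = a) Primrec.eq.exists_mem_list
      (Primrec.const _) Primrec.id
  exact h.computablePred.to_re.of_eq fun a => by simp

theorem FinPresData.finite_rels (P : FinPresData) : P.rels.Finite := by
  have h : P.rels = (fun p => (p, (0, 0))) '' {p | p ∈ P.polys} ∪
      Set.range fun k => (gen k, P.bounds k) := by
    ext r
    simp [FinPresData.rels, eq_comm]
  rw [h]
  exact ((List.finite_toSet _).image _).union (Set.finite_range _)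

theorem IsFinCEPresentation.isCEPresentation {P : FinPresData} {x : Fin P.numGens → A}
    (hx : IsFinCEPresentation P x) : IsCEPresentation P.rels x :=
  ⟨rePred_mem_finite P.finite_rels, fun k => ⟨P.bounds k, .inr ⟨k, rfl⟩⟩, hx⟩

/-- Search for verified lower and upper bounds at distance at most `2⁻ᵏ` and return the lower one;
strictness of the upper bound makes the error strictly less than `2⁻ᵏ`. -/
theorem REPred.isComputablePresentation {G : Type} [Primcodable G] {x : G → A}
    (hx : IsPresentation x)
    (hlt : REPred fun z : RatPoly G × (ℕ × ℕ) => ‖polyVal x z.1‖ < dyadicVal z.2)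
    (hgt : REPred fun z : RatPoly G × (ℕ × ℕ) => dyadicVal z.2 < ‖polyVal x z.1‖) :
    IsComputablePresentation x := by
  have hp : Computable fun z : (RatPoly G × ℕ) × (ℕ × ℕ) × (ℕ × ℕ) => z.1.1 :=
    (Primrec.fst.comp Primrec.fst).to_comp
  have h1 := hlt.comp (hp.pair (Computable.snd.comp Computable.snd))
  have h2 := hgt.comp (hp.pair (Computable.fst.comp Computable.snd))
  -- The lower bound zero is accepted without verification, since a zero norm has no strict lower
  -- bound among the dyadic values.
  have h3 : PrimrecPred fun z : (RatPoly G × ℕ) × (ℕ × ℕ) × (ℕ × ℕ) => z.2.1.1 = 0 :=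
    Primrec.eq.comp (Primrec.fst.comp (Primrec.fst.comp Primrec.snd)) (Primrec.const 0)
  have h4 : PrimrecPred fun z : (RatPoly G × ℕ) × (ℕ × ℕ) × (ℕ × ℕ) =>
      dyadicVal z.2.2 ≤ dyadicVal (dyadicAdd z.2.1 (1, z.1.2)) :=
    primrecRel_dyadicVal_le.comp (Primrec.snd.comp Primrec.snd)
      (primrec_dyadicAdd.comp (Primrec.fst.comp Primrec.snd)
        (Primrec.pair (Primrec.const 1) (Primrec.snd.comp Primrec.fst)))
  obtain ⟨f, hf, hfs⟩ := REPred.exists_computable_choice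
    (h1.and ((h3.computablePred.to_re.or h2).and h4.computablePred.to_re)) (by
      rintro ⟨p, k⟩
      set t := ‖polyVal x p‖ with ht
      have hk : (0 : ℝ) < ((2 : ℝ) ^ k)⁻¹ / 2 := by positivity
      obtain ⟨c, hc, hc'⟩ : ∃ c, (c.1 = 0 ∨ dyadicVal c < t) ∧
          t - ((2 : ℝ) ^ k)⁻¹ / 2 < dyadicVal c := by
        rcases le_or_gt t 0 with h0 | h0
        · exact ⟨(0, 0), .inl rfl, (by linarith : t - _ < 0).trans_le (dyadicVal_nonneg _)⟩
        · obtain ⟨c, hc, hc'⟩ := exists_dyadicVal_between (le_max_left 0 (t - ((2 : ℝ) ^ k)⁻¹ / 2))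
            (max_lt h0 (by linarith) : _ < t)
          exact ⟨c, .inr hc', (le_max_right _ _).trans_lt hc⟩
      obtain ⟨d, hd, hd'⟩ := exists_dyadicVal_between (norm_nonneg (polyVal x p))
        (lt_add_of_pos_right t hk)
      refine ⟨(c, d), hd, hc, ?_⟩
      change dyadicVal d ≤ dyadicVal (dyadicAdd c (1, k))
      rw [dyadicVal_add, dyadicVal_inv_two_pow]
      linarith)
  -- Rational codes store the denominator minus one, hence `2 ^ b - 1`.
  refine ⟨hx, fun p k => (((f (p, k)).1.1 : ℤ), 2 ^ (f (p, k)).1.2 - 1), ?_, fun p k => ?_⟩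
  · have h5 : Computable fun z : RatPoly G × ℕ => (f z).1 := Computable.fst.comp hf
    exact (primrec_int_natCast.to_comp.comp (Computable.fst.comp h5)).pair
      ((Primrec.pred.comp primrec_nat_two_pow).to_comp.comp (Computable.snd.comp h5))
  · obtain ⟨h6, h7, h8⟩ := hfs (p, k)
    simp only at h6 h7 h8
    rw [dyadicVal_add, dyadicVal_inv_two_pow] at h8
    have h9 : ratVal (((f (p, k)).1.1 : ℤ), 2 ^ (f (p, k)).1.2 - 1) = dyadicVal (f (p, k)).1 := by
      have : ((2 ^ (f (p, k)).1.2 - 1 : ℕ) : ℝ) + 1 = 2 ^ (f (p, k)).1.2 := by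
        rw [← Nat.cast_add_one, Nat.sub_add_cancel Nat.one_le_two_pow]
        push_cast
        rfl
      rw [ratVal, dyadicVal, this]
      push_cast
      rfl
    have h10 : dyadicVal (f (p, k)).1 ≤ ‖polyVal x p‖ := by
      rcases h7 with h7 | h7
      · have : dyadicVal (f (p, k)).1 = 0 := by simp [dyadicVal, h7]
        rw [this]
        exact norm_nonneg _
      · exact h7.le
    rw [h9, abs_of_nonneg (sub_nonneg.2 h10)]
    linarith

variable {B : Type u} [CStarAlgebra B]

/-- An ultrapower embedding yields tuples of `B` whose polynomial norms converge to those at `x`.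
The finitely many strict inequalities hold together at some index, and being open conditions they
persist at a nearby tuple of rational points. -/
theorem IsLocallyUniversal.exists_approximation (hB : IsLocallyUniversal B) [Nontrivial A]
    {P : FinPresData} {x : Fin P.numGens → A} (hx : IsFinCEPresentation P x) {G : Type}
    {y : G → B} (hy : IsPresentation y) (p : RatPoly (Fin P.numGens)) {t ε : ℝ}
    (ht : t < ‖polyVal x p‖) (hε : 0 < ε) :
    ∃ q : Fin P.numGens → RatPoly G, (∀ r ∈ P.polys, ‖polyVal y (polySubst q r)‖ < ε) ∧
      (∀ k, ‖polyVal y (q k)‖ < dyadicVal (P.bounds k) + ε) ∧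
        t < ‖polyVal y (polySubst q p)‖ := by
  have := (IsUniversal.isPresentation hx).separableSpace
  obtain ⟨U, -, hU⟩ := hB A
  obtain ⟨f, hf⟩ := hU.exists_tendsto x
  have h1 : ∀ r ∈ P.polys, ∀ᶠ n in (U : Filter ℕ), ‖polyVal (fun k => f k n) r‖ < ε := by
    intro r hr
    have h := hx.1 (r, (0, 0)) (.inl ⟨r, hr, rfl⟩)
    exact (hf r).eventually_lt_const (lt_of_le_of_lt h (by simpa [dyadicVal] using hε))
  have h2 : ∀ k, ∀ᶠ n in (U : Filter ℕ), ‖f k n‖ < dyadicVal (P.bounds k) + ε := by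
    intro k
    have h := hx.1 (gen k, P.bounds k) (.inr ⟨k, rfl⟩)
    have h' := (hf (gen k)).eventually_lt_const (lt_of_le_of_lt h (lt_add_of_pos_right _ hε))
    simpa using h'
  have h3 := (hf p).eventually_const_lt ht
  have h4 : ∀ᶠ n in (U : Filter ℕ), ∀ r ∈ P.polys, ‖polyVal (fun k => f k n) r‖ < ε := by
    have := (Filter.eventually_all_finite (l := (U : Filter ℕ)) (List.finite_toSet P.polys)
      (p := fun r n => ‖polyVal (fun k => f k n) r‖ < ε)).2 h1
    exact this
  obtain ⟨n, ⟨hn1, hn2⟩, hn3⟩ := ((h4.and (Filter.eventually_all.2 h2)).and h3).exists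
  let S : Set (Fin P.numGens → B) := {w | (∀ r ∈ P.polys, ‖polyVal w r‖ < ε) ∧
    (∀ k, ‖w k‖ < dyadicVal (P.bounds k) + ε) ∧ t < ‖polyVal w p‖}
  have hS : S ∈ 𝓝 fun k => f k n := by
    have c1 : ∀ r ∈ P.polys, ∀ᶠ w in 𝓝 (fun k => f k n), ‖polyVal w r‖ < ε := fun r hr =>
      (continuous_polyVal r).norm.continuousAt.eventually_lt_const (hn1 r hr)
    have c2 : ∀ k, ∀ᶠ w in 𝓝 (fun k => f k n), ‖w k‖ < dyadicVal (P.bounds k) + ε := fun k =>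
      Filter.Tendsto.eventually_lt_const (hn2 k) (continuous_apply k).norm.continuousAt
    have c3 : ∀ᶠ w in 𝓝 (fun k => f k n), t < ‖polyVal w p‖ :=
      (continuous_polyVal p).norm.continuousAt.eventually_const_lt hn3
    exact ((Filter.eventually_all_finite (List.finite_toSet P.polys)).2 c1).and
      ((Filter.eventually_all.2 c2).and c3)
  have hd : DenseRange fun (q : Fin P.numGens → RatPoly G) k => polyVal y (q k) :=
    DenseRange.piMap fun _ => hy.denseRange_polyVal
  obtain ⟨_, ⟨q, rfl⟩, hq⟩ := hd.inter_nhds_nonempty hS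
  exact ⟨q, by simp only [polyVal_subst]; exact hq⟩

/-- The search condition is a finite conjunction of strict norm bounds at rational points of `B`.
Upper bounds are enumerable from the presentation, lower bounds by simplicity. -/
theorem IsCEPresentation.rePred_approximation (hBs : IsSimpleCStar B) {P : FinPresData} {G : Type}
    [Primcodable G] {R : Set (RatRelation G)} {y : G → B} (hy : IsCEPresentation R y) {f : ℕ → ℕ}
    (hf : Computable f) (C : ℕ) :
    REPred fun z : (RatPoly (Fin P.numGens) × (ℕ × ℕ)) × (ℕ × (Fin P.numGens → RatPoly G)) =>
      (∀ r ∈ P.polys, ‖polyVal y (polySubst z.2.2 r)‖ < dyadicVal (1, f z.2.1)) ∧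
      (∀ k ∈ List.finRange P.numGens,
        ‖polyVal y (z.2.2 k)‖ < dyadicVal (dyadicAdd (P.bounds k) (1, f z.2.1))) ∧
      dyadicVal (dyadicAdd z.1.2 (polyLip C z.1.1, z.2.1)) <
        ‖polyVal y (polySubst z.2.2 z.1.1)‖ := by
  have hq : Primrec fun z : (RatPoly (Fin P.numGens) × (ℕ × ℕ)) ×
      (ℕ × (Fin P.numGens → RatPoly G)) => z.2.2 := Primrec.snd.comp Primrec.snd
  have hn : Primrec fun z : (RatPoly (Fin P.numGens) × (ℕ × ℕ)) ×
      (ℕ × (Fin P.numGens → RatPoly G)) => z.2.1 := Primrec.fst.comp Primrec.snd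
  have hp : Primrec fun z : (RatPoly (Fin P.numGens) × (ℕ × ℕ)) ×
      (ℕ × (Fin P.numGens → RatPoly G)) => z.1.1 := Primrec.fst.comp Primrec.fst
  have hc : Primrec fun z : (RatPoly (Fin P.numGens) × (ℕ × ℕ)) ×
      (ℕ × (Fin P.numGens → RatPoly G)) => z.1.2 := Primrec.snd.comp Primrec.fst
  have hfn : Computable fun z : (RatPoly (Fin P.numGens) × (ℕ × ℕ)) ×
      (ℕ × (Fin P.numGens → RatPoly G)) => ((1, f z.2.1) : ℕ × ℕ) :=
    (Computable.const 1).pair (hf.comp hn.to_comp)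
  have g1 : ∀ r, Computable fun z : (RatPoly (Fin P.numGens) × (ℕ × ℕ)) ×
      (ℕ × (Fin P.numGens → RatPoly G)) => (polySubst z.2.2 r, ((1, f z.2.1) : ℕ × ℕ)) := fun r =>
    (primrec_polySubst.comp hq (Primrec.const r)).to_comp.pair hfn
  have g2 : ∀ k, Computable fun z : (RatPoly (Fin P.numGens) × (ℕ × ℕ)) ×
      (ℕ × (Fin P.numGens → RatPoly G)) => (z.2.2 k, dyadicAdd (P.bounds k) (1, f z.2.1)) :=
    fun k => (Primrec.fin_app.comp hq (Primrec.const k)).to_comp.pair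
      (primrec_dyadicAdd.to_comp.comp (Computable.const (P.bounds k)) hfn)
  have g3 : Computable fun z : (RatPoly (Fin P.numGens) × (ℕ × ℕ)) ×
      (ℕ × (Fin P.numGens → RatPoly G)) =>
        (polySubst z.2.2 z.1.1, dyadicAdd z.1.2 (polyLip C z.1.1, z.2.1)) :=
    (primrec_polySubst.comp hq hp).to_comp.pair
      (primrec_dyadicAdd.comp hc (((primrec_polyLip C).comp hp).pair hn)).to_comp
  have h1 := REPred.forall_mem_list P.polys fun r _ => hy.rePred_norm_lt.comp (g1 r)
  have h2 := REPred.forall_mem_list (List.finRange P.numGens) fun k _ =>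
    hy.rePred_norm_lt.comp (g2 k)
  have h3 := (hy.rePred_lt_norm hBs).comp g3
  exact h1.and (h2.and h3)

theorem IsComputablyWeaklyStable.rePred_lt_norm (hBs : IsSimpleCStar B) (hB : IsLocallyUniversal B)
    [Nontrivial A] {P : FinPresData} {x : Fin P.numGens → A} (hx : IsComputablyWeaklyStable P x)
    {G : Type} [Primcodable G] {R : Set (RatRelation G)} {y : G → B}
    (hy : IsCEPresentation R y) :
    REPred fun z : RatPoly (Fin P.numGens) × (ℕ × ℕ) => dyadicVal z.2 < ‖polyVal x z.1‖ := by
  obtain ⟨hP, f, hf, hfs⟩ := hx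
  obtain ⟨C, hC⟩ : ∃ C : ℕ, ∀ k, dyadicVal (P.bounds k) + 1 ≤ C := by
    obtain ⟨C, hC⟩ := exists_nat_ge (∑ k, (dyadicVal (P.bounds k) + 1))
    refine ⟨C, fun k => le_trans ?_ hC⟩
    exact Finset.single_le_sum (f := fun k => dyadicVal (P.bounds k) + 1)
      (fun k _ => add_nonneg (dyadicVal_nonneg _) zero_le_one) (Finset.mem_univ k)
  -- The Lipschitz estimate needs a constant at least `1`, even without generators; hence `C + 1`.
  have hC' : ∀ k, dyadicVal (P.bounds k) + 1 ≤ ((C + 1 : ℕ) : ℝ) := fun k =>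
    (hC k).trans (by push_cast; linarith)
  refine (hy.rePred_approximation hBs hf (C + 1)).exists.of_eq fun z => ?_
  obtain ⟨p, c⟩ := z
  have hval : ∀ n, dyadicVal (polyLip (C + 1) p, n) = polyLip (C + 1) p * ((2 : ℝ) ^ n)⁻¹ :=
    fun n => by simp [dyadicVal, div_eq_mul_inv]
  simp only [dyadicVal_add, dyadicVal_inv_two_pow, hval]
  constructor
  · rintro ⟨⟨n, q⟩, hq1, hq2, hq3⟩
    simp only at hq1 hq2 hq3
    -- Soundness: weak stability replaces `z` by a nearby image of `x`, at the cost of the Lipschitz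
    -- term.
    let z : Fin P.numGens → B := fun k => polyVal y (q k)
    obtain ⟨φ, hφ⟩ := hfs n B z
      (fun r hr => by have := (hq1 r hr).le; rwa [polyVal_subst] at this)
      (fun k => (hq2 k (List.mem_finRange k)).le)
    have hle1 : ((2 : ℝ) ^ f n)⁻¹ ≤ 1 := inv_le_one_of_one_le₀ (one_le_pow₀ one_le_two)
    have hzC : ∀ k, ‖z k‖ ≤ ((C + 1 : ℕ) : ℝ) := fun k =>
      ((hq2 k (List.mem_finRange k)).le.trans (by linarith)).trans (hC' k)
    have hxC : ∀ k, ‖φ (x k)‖ ≤ ((C + 1 : ℕ) : ℝ) := fun k => by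
      have h := hP.1 (gen k, P.bounds k) (.inr ⟨k, rfl⟩)
      rw [polyVal_gen] at h
      exact (NonUnitalStarAlgHom.norm_apply_le φ _).trans (h.trans (by linarith [hC' k]))
    have hL := norm_polyVal_sub_le (C := C + 1) (δ := ((2 : ℝ) ^ n)⁻¹) (Nat.le_add_left 1 C) (by positivity) hzC hxC
      (fun k => by rw [norm_sub_rev]; exact (hφ k).le) p
    have hφp : ‖polyVal (fun k => φ (x k)) p‖ ≤ ‖polyVal x p‖ := by
      rw [← map_polyVal]
      exact NonUnitalStarAlgHom.norm_apply_le φ _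
    rw [polyVal_subst] at hq3
    have := norm_sub_norm_le (polyVal z p) (polyVal (fun k => φ (x k)) p)
    change dyadicVal c < ‖polyVal x p‖
    have hz : (fun k => polyVal y (q k)) = z := rfl
    rw [hz] at hq3
    linarith
  · intro h
    change dyadicVal c < ‖polyVal x p‖ at h
    -- Completeness: `n` is taken so large that the Lipschitz term fits in the gap `‖p(x)‖ - c`;
    -- adding `1` avoids dividing by a zero Lipschitz constant.
    obtain ⟨n, hn⟩ := exists_pow_lt_of_lt_one
      (div_pos (sub_pos.2 h) (by positivity : (0 : ℝ) < polyLip (C + 1) p + 1))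
      (by norm_num : (1 / 2 : ℝ) < 1)
    rw [one_div, inv_pow, lt_div_iff₀ (by positivity)] at hn
    have hpos : (0 : ℝ) < ((2 : ℝ) ^ n)⁻¹ := by positivity
    have ht : dyadicVal c + polyLip (C + 1) p * ((2 : ℝ) ^ n)⁻¹ < ‖polyVal x p‖ := by
      nlinarith
    obtain ⟨q, hq1, hq2, hq3⟩ := hB.exists_approximation hP
      (IsUniversal.isPresentation hy.2.2) p ht (by positivity : 0 < ((2 : ℝ) ^ f n)⁻¹)
    exact ⟨(n, q), hq1, fun k _ => hq2 k, hq3⟩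

theorem IsComputablyWeaklyStable.isComputablePresentation (hBs : IsSimpleCStar B)
    (hB : IsLocallyUniversal B) (hBc : HasCEPresentation B) {P : FinPresData}
    {x : Fin P.numGens → A} (hx : IsComputablyWeaklyStable P x) : IsComputablePresentation x := by
  have hpres : IsPresentation x := IsUniversal.isPresentation hx.1
  rcases subsingleton_or_nontrivial A with hA | hA
  -- Local universality says nothing about the zero algebra, but there all norms vanish.
  · refine ⟨hpres, fun _ _ => (0, 0), Computable.const _, fun p k => ?_⟩
    rw [Subsingleton.elim (polyVal x p) 0]
    simp [ratVal]
  · obtain ⟨G, _, R, y, hy⟩ := hBc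
    exact REPred.isComputablePresentation hpres hx.1.isCEPresentation.rePred_norm_lt
      (hx.rePred_lt_norm hBs hB hy)

end WeaklyStablePresentations


/-! ### Words in the Cuntz isometries. -/

section CuntzWords

variable {O : Type u} [CStarAlgebra O]

/-- A pair of isometries with orthogonal ranges that sum to the unit. -/
structure IsCuntzPair (s : Fin 2 → O) : Prop where
  star_mul : ∀ i j, star (s i) * s j = if i = j then 1 else 0
  mul_star : s 0 * star (s 0) + s 1 * star (s 1) = 1

theorem IsCuntzPair.norm_le_one {s : Fin 2 → O} (hs : IsCuntzPair s) (i : Fin 2) : ‖s i‖ ≤ 1 := by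
  have h := CStarRing.norm_star_mul_self (x := s i)
  rw [hs.star_mul, if_pos rfl] at h
  nlinarith [norm_one_le_one (A := O), norm_nonneg (s i)]

theorem isRepresentation_cuntzTwo_iff (s : Fin 2 → O) :
    IsRepresentation cuntzTwo.rels (s : Fin cuntzTwo.numGens → O) ↔ IsCuntzPair s := by
  have hz : ∀ p : RatPoly (Fin 2), ‖polyVal s p‖ ≤ dyadicVal (0, 0) ↔ polyVal s p = 0 := by
    intro p
    simp [dyadicVal]
  have hm : gaussVal (-1, 0, 0) = -1 := by simp [gaussVal]
  have h1 : polyVal s [((1, 0, 0), [(0, true), (0, false)]), ((-1, 0, 0), [])] =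
      star (s 0) * s 0 - 1 := by
    simp [monoVal, letterVal, gaussVal_one, hm, sub_eq_add_neg]
  have h2 : polyVal s [((1, 0, 0), [(1, true), (1, false)]), ((-1, 0, 0), [])] =
      star (s 1) * s 1 - 1 := by
    simp [monoVal, letterVal, gaussVal_one, hm, sub_eq_add_neg]
  have h3 : polyVal s [((1, 0, 0), [(0, true), (1, false)])] = star (s 0) * s 1 := by
    simp [monoVal, letterVal, gaussVal_one]
  have h4 : polyVal s [((1, 0, 0), [(1, true), (0, false)])] = star (s 1) * s 0 := by
    simp [monoVal, letterVal, gaussVal_one]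
  have h5 : polyVal s [((1, 0, 0), [(0, false), (0, true)]), ((1, 0, 0), [(1, false), (1, true)]),
      ((-1, 0, 0), [])] = s 0 * star (s 0) + s 1 * star (s 1) - 1 := by
    simp [monoVal, letterVal, gaussVal_one, hm, sub_eq_add_neg, add_assoc]
  constructor
  · intro h
    have hp : ∀ p ∈ cuntzTwo.polys, polyVal (s : Fin cuntzTwo.numGens → O) p = 0 := fun p hp =>
      (hz p).1 (h (p, (0, 0)) (.inl ⟨p, hp, rfl⟩))
    have e1 := hp _ (List.mem_cons_self)
    have e2 := hp _ (List.mem_cons_of_mem _ List.mem_cons_self)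
    have e3 := hp _ (List.mem_cons_of_mem _ (List.mem_cons_of_mem _ List.mem_cons_self))
    have e4 := hp _ (List.mem_cons_of_mem _ (List.mem_cons_of_mem _ (List.mem_cons_of_mem _
      List.mem_cons_self)))
    have e5 := hp _ (List.mem_cons_of_mem _ (List.mem_cons_of_mem _ (List.mem_cons_of_mem _
      (List.mem_cons_of_mem _ List.mem_cons_self))))
    have f1 := sub_eq_zero.1 (h1.symm.trans e1)
    have f2 := sub_eq_zero.1 (h2.symm.trans e2)
    have f3 := h3.symm.trans e3
    have f4 := h4.symm.trans e4
    have f5 := sub_eq_zero.1 (h5.symm.trans e5)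
    refine ⟨fun i j => ?_, f5⟩
    fin_cases i <;> fin_cases j <;> simp [f1, f2, f3, f4]
  · intro hs r hr
    have g : ∀ p ∈ cuntzTwo.polys, polyVal (s : Fin cuntzTwo.numGens → O) p = 0 := by
      intro p hp
      rcases List.mem_cons.1 hp with rfl | hp
      · exact h1.trans (sub_eq_zero.2 (by simp [hs.star_mul]))
      rcases List.mem_cons.1 hp with rfl | hp
      · exact h2.trans (sub_eq_zero.2 (by simp [hs.star_mul]))
      rcases List.mem_cons.1 hp with rfl | hp
      · exact h3.trans (by simp [hs.star_mul])
      rcases List.mem_cons.1 hp with rfl | hp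
      · exact h4.trans (by simp [hs.star_mul])
      rcases List.mem_cons.1 hp with rfl | hp
      · exact h5.trans (sub_eq_zero.2 hs.mul_star)
      · exact absurd hp List.not_mem_nil
    rcases hr with ⟨p, hp, rfl⟩ | ⟨k, rfl⟩
    · exact (hz p).2 (g p hp)
    · have h := (congrArg norm (polyVal_gen s (k : Fin 2))).trans_le (hs.norm_le_one k)
      refine h.trans ?_
      simp [cuntzTwo, dyadicVal]

/-- The product of the isometries along a word. -/
def cuntzWord (s : Fin 2 → O) (μ : List (Fin 2)) : O := (μ.map s).prod

@[simp] theorem cuntzWord_nil (s : Fin 2 → O) : cuntzWord s [] = 1 := rfl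

@[simp] theorem cuntzWord_cons (s : Fin 2 → O) (i : Fin 2) (μ : List (Fin 2)) :
    cuntzWord s (i :: μ) = s i * cuntzWord s μ := by simp [cuntzWord]

theorem cuntzWord_append (s : Fin 2 → O) (μ ν : List (Fin 2)) :
    cuntzWord s (μ ++ ν) = cuntzWord s μ * cuntzWord s ν := by simp [cuntzWord]

variable {s : Fin 2 → O}

theorem IsCuntzPair.star_mul_of_length_eq (hs : IsCuntzPair s) {μ ν : List (Fin 2)}
    (h : μ.length = ν.length) :
    star (cuntzWord s μ) * cuntzWord s ν = if μ = ν then 1 else 0 := by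
  induction μ generalizing ν with
  | nil =>
    have : ν = [] := List.length_eq_zero_iff.1 h.symm
    simp [this]
  | cons i μ ih =>
    cases ν with
    | nil => simp at h
    | cons j ν =>
      have h1 : star (cuntzWord s (i :: μ)) * cuntzWord s (j :: ν) =
          star (cuntzWord s μ) * (star (s i) * s j) * cuntzWord s ν := by
        simp [mul_assoc]
      rw [h1, hs.star_mul]
      by_cases hij : i = j
      · rw [if_pos hij, mul_one, ih (by simpa using h)]
        simp [hij]
      · rw [if_neg hij]
        simp [hij]

theorem IsCuntzPair.star_mul_of_length_le (hs : IsCuntzPair s) {μ ν : List (Fin 2)}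
    (h : μ.length ≤ ν.length) : star (cuntzWord s μ) * cuntzWord s ν =
      if μ = ν.take μ.length then cuntzWord s (ν.drop μ.length) else 0 := by
  conv_lhs => rw [← List.take_append_drop μ.length ν]
  rw [cuntzWord_append, ← mul_assoc, hs.star_mul_of_length_eq (by simp [h])]
  split_ifs <;> simp

theorem IsCuntzPair.star_mul_self (hs : IsCuntzPair s) (μ : List (Fin 2)) :
    star (cuntzWord s μ) * cuntzWord s μ = 1 := by
  rw [hs.star_mul_of_length_eq rfl, if_pos rfl]

theorem IsCuntzPair.sum_mul_star (hs : IsCuntzPair s) (k : ℕ) :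
    ∑ α : Fin k → Fin 2, cuntzWord s (List.ofFn α) * star (cuntzWord s (List.ofFn α)) = 1 := by
  induction k with
  | zero => simp
  | succ k ih =>
    rw [← (Fin.consEquiv fun _ : Fin (k + 1) => Fin 2).sum_comp, Fintype.sum_prod_type]
    have h : ∀ (i : Fin 2) (α : Fin k → Fin 2),
        cuntzWord s (List.ofFn (Fin.consEquiv (fun _ : Fin (k + 1) => Fin 2) (i, α))) *
          star (cuntzWord s (List.ofFn (Fin.consEquiv (fun _ : Fin (k + 1) => Fin 2) (i, α)))) =
        s i * (cuntzWord s (List.ofFn α) * star (cuntzWord s (List.ofFn α))) * star (s i) := by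
      intro i α
      simp [Fin.consEquiv, List.ofFn_succ, mul_assoc]
    simp only [h, ← Finset.mul_sum, ← Finset.sum_mul, ih, mul_one, Fin.sum_univ_two, hs.mul_star]

/-- Since `star (s i) * s j` is `0` or `1`, every adjoint can be moved to the right or cancelled. -/
theorem IsCuntzPair.prod_letterVal (hs : IsCuntzPair s) (w : List (Fin 2 × Bool)) :
    (w.map (letterVal s)).prod = 0 ∨
      ∃ μ ν, (w.map (letterVal s)).prod = cuntzWord s μ * star (cuntzWord s ν) := by
  induction w with
  | nil => exact .inr ⟨[], [], by simp⟩
  | cons l w ih =>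
    rw [List.map_cons, List.prod_cons]
    rcases ih with h | ⟨μ, ν, h⟩
    · exact .inl (by rw [h, mul_zero])
    · rw [h]
      obtain ⟨i, b⟩ := l
      cases b with
      | false => exact .inr ⟨i :: μ, ν, by simp [letterVal, mul_assoc]⟩
      | true =>
        cases μ with
        | nil => exact .inr ⟨[], ν ++ [i], by simp [letterVal, cuntzWord_append]⟩
        | cons j μ =>
          have h1 : letterVal s (i, true) * (cuntzWord s (j :: μ) * star (cuntzWord s ν)) =
              star (s i) * s j * (cuntzWord s μ * star (cuntzWord s ν)) := by
            simp [letterVal, mul_assoc]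
          rw [h1, hs.star_mul]
          split_ifs
          · exact .inr ⟨μ, ν, by rw [one_mul]⟩
          · exact .inl (zero_mul _)

/-- The combination of words with coefficients given by a list. -/
def cuntzComb (s : Fin 2 → O) (L : List (ℂ × List (Fin 2) × List (Fin 2))) : O :=
  (L.map fun t => t.1 • (cuntzWord s t.2.1 * star (cuntzWord s t.2.2))).sum

theorem IsCuntzPair.exists_cuntzComb (hs : IsCuntzPair s) (p : RatPoly (Fin 2)) :
    ∃ L, polyVal s p = cuntzComb s L := by
  induction p with
  | nil => exact ⟨[], by simp [cuntzComb]⟩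
  | cons m p ih =>
    obtain ⟨L, hL⟩ := ih
    rw [polyVal_cons, hL, monoVal]
    rcases hs.prod_letterVal m.2 with h | ⟨μ, ν, h⟩
    · exact ⟨L, by rw [h]; simp⟩
    · exact ⟨(gaussVal m.1, μ, ν) :: L, by rw [h]; simp [cuntzComb]⟩

/-- The homomorphism from matrices over words of length `k`. -/
noncomputable def IsCuntzPair.matrixHom (hs : IsCuntzPair s) (k : ℕ) :
    Matrix (Fin k → Fin 2) (Fin k → Fin 2) ℂ →ₐ[ℂ] O :=
  AlgHom.ofLinearMap
    { toFun := fun T => ∑ α, ∑ β, T α β •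
        (cuntzWord s (List.ofFn α) * star (cuntzWord s (List.ofFn β)))
      map_add' := fun S T => by simp [add_smul, Finset.sum_add_distrib]
      map_smul' := fun c T => by simp [mul_smul, Finset.smul_sum] }
    (by simp [Matrix.one_apply, hs.sum_mul_star])
    (fun S T => by
      have h : ∀ β γ : Fin k → Fin 2, star (cuntzWord s (List.ofFn β)) * cuntzWord s (List.ofFn γ) =
          if β = γ then 1 else 0 := fun β γ => by
        rw [hs.star_mul_of_length_eq (by simp)]
        simp [List.ofFn_inj]
      have h' : ∀ α β γ δ : Fin k → Fin 2,
          (cuntzWord s (List.ofFn α) * star (cuntzWord s (List.ofFn β))) *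
            (cuntzWord s (List.ofFn γ) * star (cuntzWord s (List.ofFn δ))) =
          if β = γ then cuntzWord s (List.ofFn α) * star (cuntzWord s (List.ofFn δ)) else 0 := by
        intro α β γ δ
        rw [mul_assoc, ← mul_assoc (star _), h]
        split_ifs <;> simp
      simp only [LinearMap.coe_mk, AddHom.coe_mk, Finset.sum_mul, Finset.mul_sum,
        smul_mul_smul_comm, h', Matrix.mul_apply, Finset.sum_smul]
      simp only [smul_ite, smul_zero, Finset.sum_ite_eq', Finset.mem_univ,
        if_true]
      refine (Finset.sum_congr rfl fun α _ => Finset.sum_comm).trans (Finset.sum_comm.trans ?_)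
      exact Finset.sum_congr rfl fun β _ => Finset.sum_comm)

end CuntzWords


/-! ### Compressing combinations of Cuntz words to scalars. -/

section CuntzSimple

variable {O : Type u} [CStarAlgebra O] {s : Fin 2 → O}

theorem IsCuntzPair.matrixHom_apply (hs : IsCuntzPair s) (k : ℕ)
    (T : Matrix (Fin k → Fin 2) (Fin k → Fin 2) ℂ) : hs.matrixHom k T =
      ∑ α, ∑ β, T α β • (cuntzWord s (List.ofFn α) * star (cuntzWord s (List.ofFn β))) := rfl

theorem IsCuntzPair.matrixHom_single (hs : IsCuntzPair s) {k : ℕ} {μ ν : List (Fin 2)}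
    (hμ : μ.length = k) (hν : ν.length = k) :
    cuntzWord s μ * star (cuntzWord s ν) ∈ (hs.matrixHom k).range := by
  subst hμ
  obtain ⟨β, rfl⟩ : ∃ β : Fin μ.length → Fin 2, List.ofFn β = ν := by
    rw [← hν]
    exact ⟨ν.get, List.ofFn_get ν⟩
  refine ⟨Matrix.single μ.get β 1, ?_⟩
  change hs.matrixHom _ _ = _
  rw [hs.matrixHom_apply]
  simp only [Matrix.single_apply, ite_smul, one_smul, zero_smul, ite_and]
  simp

/-- Inserting the unit, written as a sum over words of length `k - |μ|`, lengthens both words to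
length `k`. -/
theorem IsCuntzPair.mem_range_matrixHom (hs : IsCuntzPair s) {k : ℕ} {μ ν : List (Fin 2)}
    (h : μ.length = ν.length) (hk : μ.length ≤ k) :
    cuntzWord s μ * star (cuntzWord s ν) ∈ (hs.matrixHom k).range := by
  have : cuntzWord s μ * star (cuntzWord s ν) = ∑ σ : Fin (k - μ.length) → Fin 2,
      cuntzWord s (μ ++ List.ofFn σ) * star (cuntzWord s (ν ++ List.ofFn σ)) := by
    have h1 : ∀ σ : Fin (k - μ.length) → Fin 2,
        cuntzWord s (μ ++ List.ofFn σ) * star (cuntzWord s (ν ++ List.ofFn σ)) =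
        cuntzWord s μ * (cuntzWord s (List.ofFn σ) * star (cuntzWord s (List.ofFn σ))) *
          star (cuntzWord s ν) := fun σ => by
      simp [cuntzWord_append, mul_assoc]
    simp only [h1, ← Finset.sum_mul, ← Finset.mul_sum, hs.sum_mul_star, mul_one]
  rw [this]
  exact Subalgebra.sum_mem _ fun σ _ => hs.matrixHom_single (by simp; omega) (by simp; omega)

/-- The part of a combination of words that is fixed by the gauge action. -/
def cuntzDiag (s : Fin 2 → O) (L : List (ℂ × List (Fin 2) × List (Fin 2))) : O :=
  cuntzComb s (L.filter fun t => t.2.1.length = t.2.2.length)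

theorem cuntzComb_cons (s : Fin 2 → O) (t : ℂ × List (Fin 2) × List (Fin 2))
    (L : List (ℂ × List (Fin 2) × List (Fin 2))) :
    cuntzComb s (t :: L) = t.1 • (cuntzWord s t.2.1 * star (cuntzWord s t.2.2)) +
      cuntzComb s L := by
  simp [cuntzComb]

theorem cuntzDiag_cons (s : Fin 2 → O) (t : ℂ × List (Fin 2) × List (Fin 2))
    (L : List (ℂ × List (Fin 2) × List (Fin 2))) :
    cuntzDiag s (t :: L) = (if t.2.1.length = t.2.2.length then
      t.1 • (cuntzWord s t.2.1 * star (cuntzWord s t.2.2)) else 0) + cuntzDiag s L := by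
  unfold cuntzDiag
  rw [List.filter_cons]
  split_ifs with h1 h2 h2
  · rw [cuntzComb_cons]
  · simp [h2] at h1
  · simp [h2] at h1
  · rw [zero_add]

/-- All words of the list have length at most `k`. -/
def WordsBounded (k : ℕ) (L : List (ℂ × List (Fin 2) × List (Fin 2))) : Prop :=
  ∀ t ∈ L, t.2.1.length ≤ k ∧ t.2.2.length ≤ k

theorem exists_wordsBounded (L : List (ℂ × List (Fin 2) × List (Fin 2))) :
    ∃ k, WordsBounded k L := by
  induction L with
  | nil => exact ⟨0, by simp [WordsBounded]⟩
  | cons t L ih =>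
    obtain ⟨k, hk⟩ := ih
    refine ⟨max k (max t.2.1.length t.2.2.length), fun r hr => ?_⟩
    rcases List.mem_cons.1 hr with rfl | hr
    · simp
    · have := hk r hr
      omega

theorem IsCuntzPair.cuntzDiag_mem_range (hs : IsCuntzPair s) {k : ℕ}
    {L : List (ℂ × List (Fin 2) × List (Fin 2))} (hL : WordsBounded k L) :
    cuntzDiag s L ∈ (hs.matrixHom k).range := by
  induction L with
  | nil => exact Subalgebra.zero_mem _
  | cons t L ih =>
    rw [cuntzDiag_cons]
    refine Subalgebra.add_mem _ ?_ (ih fun r hr => hL r (List.mem_cons_of_mem _ hr))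
    split_ifs with h
    · exact Subalgebra.smul_mem _ (hs.mem_range_matrixHom h (hL t List.mem_cons_self).1) _
    · exact Subalgebra.zero_mem _

/-- The word `0 ⋯ 0 1`, whose only proper overlaps with itself are trivial. -/
def testWord (k : ℕ) : List (Fin 2) := List.replicate k 0 ++ [1]

/-- Otherwise the shorter word would be a prefix of the longer one, yet its last letter `1` faces a
letter of the block of zeros there. -/
theorem IsCuntzPair.drop_testWord_orthogonal (hs : IsCuntzPair s) {k m n : ℕ} {α β : List (Fin 2)}
    (hα : α.length = k) (hβ : β.length = k) (hm : m ≤ k) (hn : n ≤ k) (hmn : m ≠ n) :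
    star (cuntzWord s ((α ++ testWord k).drop m)) * cuntzWord s ((β ++ testWord k).drop n) = 0 := by
  wlog h : n < m generalizing m n α β
  · have := congrArg star (this hβ hα hn hm hmn.symm (by omega))
    simpa using this
  rw [hs.star_mul_of_length_le (by simp [testWord]; omega), if_neg]
  intro he
  have h1 : ((α ++ testWord k).drop m)[2 * k - m]? = some 1 := by
    rw [List.getElem?_drop, show m + (2 * k - m) = α.length + k by omega,
      List.getElem?_append_right (by omega)]
    simp [testWord]
  rw [he, List.getElem?_take, if_pos (by simp [testWord]; omega), List.getElem?_drop,
    List.getElem?_append_right (by omega), testWord,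
    List.getElem?_append_left (by simp; omega), List.getElem?_replicate, if_pos (by omega)] at h1
  simp at h1

theorem IsCuntzPair.star_word_mul_append (hs : IsCuntzPair s) {μ ν : List (Fin 2)}
    (h : μ.length ≤ ν.length) : star (cuntzWord s μ) * cuntzWord s ν = 0 ∨
      star (cuntzWord s μ) * cuntzWord s ν = cuntzWord s (ν.drop μ.length) := by
  rw [hs.star_mul_of_length_le h]
  split_ifs <;> simp

/-- Cancelling `μ` and `ν` either gives zero or drops different numbers of letters from the two
words ending in the test word, and the remainders are orthogonal. -/
theorem IsCuntzPair.offDiag_compress (hs : IsCuntzPair s) {k : ℕ} {α β μ ν : List (Fin 2)}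
    (hα : α.length = k) (hβ : β.length = k) (hμ : μ.length ≤ k) (hν : ν.length ≤ k)
    (h : μ.length ≠ ν.length) :
    star (cuntzWord s (α ++ testWord k)) * (cuntzWord s μ * star (cuntzWord s ν)) *
      cuntzWord s (β ++ testWord k) = 0 := by
  have e : star (cuntzWord s (α ++ testWord k)) * (cuntzWord s μ * star (cuntzWord s ν)) *
      cuntzWord s (β ++ testWord k) = star (star (cuntzWord s μ) * cuntzWord s (α ++ testWord k)) *
      (star (cuntzWord s ν) * cuntzWord s (β ++ testWord k)) := by
    simp [mul_assoc]
  rw [e]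
  rcases hs.star_word_mul_append (μ := μ) (ν := α ++ testWord k) (by simp; omega) with h1 | h1
  · rw [h1, star_zero, zero_mul]
  rcases hs.star_word_mul_append (μ := ν) (ν := β ++ testWord k) (by simp; omega) with h2 | h2
  · rw [h2, mul_zero]
  rw [h1, h2]
  exact hs.drop_testWord_orthogonal hα hβ hμ hν h

/-- The combination of the words of length `k` with coefficients `v`. -/
def cuntzVec (s : Fin 2 → O) {k : ℕ} (v : (Fin k → Fin 2) → ℂ) : O :=
  ∑ α, v α • cuntzWord s (List.ofFn α)

theorem IsCuntzPair.cuntzComb_compress (hs : IsCuntzPair s) {k : ℕ}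
    {L : List (ℂ × List (Fin 2) × List (Fin 2))} (hL : WordsBounded k L)
    (v : (Fin k → Fin 2) → ℂ) :
    star (cuntzVec s v * cuntzWord s (testWord k)) * cuntzComb s L *
      (cuntzVec s v * cuntzWord s (testWord k)) =
    star (cuntzVec s v * cuntzWord s (testWord k)) * cuntzDiag s L *
      (cuntzVec s v * cuntzWord s (testWord k)) := by
  induction L with
  | nil => rfl
  | cons t L ih =>
    rw [cuntzDiag_cons, cuntzComb_cons, mul_add, mul_add, add_mul, add_mul,
      ih fun r hr => hL r (List.mem_cons_of_mem _ hr)]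
    congr 1
    split_ifs with h
    · rfl
    · have hX : cuntzVec s v * cuntzWord s (testWord k) =
          ∑ α, v α • cuntzWord s (List.ofFn α ++ testWord k) := by
        simp [cuntzVec, Finset.sum_mul, cuntzWord_append]
      rw [hX, mul_zero, zero_mul, star_sum, Finset.sum_mul, Finset.sum_mul]
      refine Finset.sum_eq_zero fun α _ => ?_
      rw [Finset.mul_sum]
      refine Finset.sum_eq_zero fun β _ => ?_
      have := hL t List.mem_cons_self
      rw [star_smul, mul_smul_comm, smul_mul_assoc, smul_mul_assoc, mul_smul_comm, smul_mul_assoc,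
        hs.offDiag_compress (by simp) (by simp) this.1 this.2 h, smul_zero, smul_zero, smul_zero]

theorem IsCuntzPair.star_word_mul_cuntzVec (hs : IsCuntzPair s) {k : ℕ}
    (v : (Fin k → Fin 2) → ℂ) (β : Fin k → Fin 2) :
    star (cuntzWord s (List.ofFn β)) * cuntzVec s v = v β • (1 : O) := by
  have h : ∀ γ : Fin k → Fin 2, star (cuntzWord s (List.ofFn β)) * cuntzWord s (List.ofFn γ) =
      if β = γ then 1 else 0 := fun γ => by
    rw [hs.star_mul_of_length_eq (by simp)]
    simp [List.ofFn_inj]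
  simp [cuntzVec, Finset.mul_sum, h]

theorem IsCuntzPair.matrixHom_mul_cuntzVec (hs : IsCuntzPair s) {k : ℕ}
    (T : Matrix (Fin k → Fin 2) (Fin k → Fin 2) ℂ) (v : (Fin k → Fin 2) → ℂ) :
    hs.matrixHom k T * cuntzVec s v = cuntzVec s (T.mulVec v) := by
  rw [hs.matrixHom_apply]
  simp only [Finset.sum_mul, smul_mul_assoc, mul_assoc, hs.star_word_mul_cuntzVec, mul_smul_comm,
    mul_one, smul_smul]
  simp only [cuntzVec, Matrix.mulVec, dotProduct, Finset.sum_smul]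

theorem IsCuntzPair.star_cuntzVec_mul_self (hs : IsCuntzPair s) {k : ℕ}
    (v : (Fin k → Fin 2) → ℂ) :
    star (cuntzVec s v) * cuntzVec s v = (((∑ α, ‖v α‖ ^ 2 : ℝ)) : ℂ) • (1 : O) := by
  conv_lhs => enter [1, 1]; unfold cuntzVec
  rw [star_sum, Finset.sum_mul, Complex.ofReal_sum, Finset.sum_smul]
  refine Finset.sum_congr rfl fun α _ => ?_
  rw [star_smul, smul_mul_assoc, hs.star_word_mul_cuntzVec, smul_smul]
  congr 1
  rw [Complex.star_def, mul_comm, Complex.mul_conj, Complex.normSq_eq_norm_sq]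

/-- A spectral value of the gauge-invariant part is a compression of the combination. -/
theorem IsCuntzPair.exists_compress (hs : IsCuntzPair s) {k : ℕ}
    {L : List (ℂ × List (Fin 2) × List (Fin 2))} (hL : WordsBounded k L) {l : ℂ}
    (hl : l ∈ spectrum ℂ (cuntzDiag s L)) :
    ∃ X : O, ∃ r : ℝ, 0 < r ∧ star X * X = (r : ℂ) • (1 : O) ∧
      star X * cuntzComb s L * X = (l * r) • (1 : O) := by
  obtain ⟨T, hT⟩ := hs.cuntzDiag_mem_range hL
  change hs.matrixHom k T = _ at hT
  -- Homomorphisms can only shrink spectra, so `l` is an eigenvalue of `T`, whether or not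
  -- `hs.matrixHom k` is injective.
  have hlT : l ∈ spectrum ℂ T := AlgHom.spectrum_apply_subset (hs.matrixHom k) T (by rwa [hT])
  have hdet : (algebraMap ℂ (Matrix (Fin k → Fin 2) (Fin k → Fin 2) ℂ) l - T).det = 0 := by
    by_contra h
    exact hlT ((Matrix.isUnit_iff_isUnit_det _).2 (isUnit_iff_ne_zero.2 h))
  obtain ⟨v, hv, hTv⟩ := Matrix.exists_mulVec_eq_zero_iff.2 hdet
  have hTv' : T.mulVec v = l • v := by
    rw [Matrix.sub_mulVec, sub_eq_zero, Algebra.algebraMap_eq_smul_one, Matrix.smul_mulVec,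
      Matrix.one_mulVec] at hTv
    exact hTv.symm
  have hlv : cuntzVec s (l • v) = l • cuntzVec s v := by
    simp [cuntzVec, Finset.smul_sum, mul_smul]
  have hXX : star (cuntzVec s v * cuntzWord s (testWord k)) *
      (cuntzVec s v * cuntzWord s (testWord k)) = (((∑ α, ‖v α‖ ^ 2 : ℝ)) : ℂ) • (1 : O) := by
    rw [StarMul.star_mul, mul_assoc, ← mul_assoc (star (cuntzVec s v)), hs.star_cuntzVec_mul_self,
      smul_mul_assoc, one_mul, mul_smul_comm, hs.star_mul_self]
  -- The eigenvector is not normalized; `r` is its squared length.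
  refine ⟨cuntzVec s v * cuntzWord s (testWord k), ∑ α, ‖v α‖ ^ 2, ?_, hXX, ?_⟩
  · obtain ⟨α, hα⟩ := Function.ne_iff.1 hv
    exact Finset.sum_pos' (fun _ _ => by positivity)
      ⟨α, Finset.mem_univ _, by have : v α ≠ 0 := hα; positivity⟩
  · rw [hs.cuntzComb_compress hL, mul_assoc, ← mul_assoc (cuntzDiag s L), ← hT,
      hs.matrixHom_mul_cuntzVec, hTv', hlv, smul_mul_assoc, mul_smul_comm, hXX, smul_smul]

end CuntzSimple


/-! ### The gauge action and its discrete averages. -/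

section Gauge

variable {O : Type u} [CStarAlgebra O] {s : Fin 2 → O}

theorem cuntzWord_smul (z : ℂ) (s : Fin 2 → O) (μ : List (Fin 2)) :
    cuntzWord (fun i => z • s i) μ = z ^ μ.length • cuntzWord s μ := by
  induction μ with
  | nil => simp
  | cons i μ ih => rw [cuntzWord_cons, ih, smul_mul_smul_comm, cuntzWord_cons, List.length_cons,
      pow_succ']

theorem IsCuntzPair.smul (hs : IsCuntzPair s) (z : Circle) :
    IsCuntzPair fun i => (z : ℂ) • s i := by
  have h : star (z : ℂ) * z = 1 := by
    rw [Complex.star_def, mul_comm, Complex.mul_conj]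
    simp
  have h' : (z : ℂ) * star (z : ℂ) = 1 := by rw [mul_comm, h]
  constructor
  · intro i j
    rw [star_smul, smul_mul_smul_comm, h, one_smul, hs.star_mul]
  · simp only [star_smul, smul_mul_smul_comm, h', one_smul, hs.mul_star]

theorem map_cuntzComb (φ : O →⋆ₐ[ℂ] O) (s : Fin 2 → O)
    (L : List (ℂ × List (Fin 2) × List (Fin 2))) :
    φ (cuntzComb s L) = cuntzComb (fun i => φ (s i)) L := by
  have h : ∀ μ, φ (cuntzWord s μ) = cuntzWord (fun i => φ (s i)) μ := fun μ => by
    simp [cuntzWord, map_list_prod, Function.comp_def]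
  induction L with
  | nil => simp [cuntzComb]
  | cons t L ih => simp [cuntzComb_cons, ih, h, map_star]

theorem sum_rootOfUnity_pow {N a b : ℕ} (ha : a < N) (hb : b < N) {w : ℂ}
    (hw : IsPrimitiveRoot w N) :
    ∑ j ∈ Finset.range N, (w ^ j) ^ a * star ((w ^ j) ^ b) = if a = b then (N : ℂ) else 0 := by
  have hN : N ≠ 0 := by omega
  have hn : ‖w‖ = 1 := hw.norm'_eq_one hN
  have hw0 : w ≠ 0 := hw.ne_zero hN
  have hst : star w = w⁻¹ := by
    rw [Complex.star_def, Complex.inv_def, Complex.normSq_eq_norm_sq, hn]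
    simp
  have h1 : ∀ j, (w ^ j) ^ a * star ((w ^ j) ^ b) = (w ^ a * (w⁻¹) ^ b) ^ j := by
    intro j
    rw [star_pow, star_pow, hst, mul_pow]
    ring
  simp only [h1]
  split_ifs with h
  · subst h
    simp [mul_inv_cancel₀ (pow_ne_zero a hw0)]
  · have hne : w ^ a * (w⁻¹) ^ b ≠ 1 := by
      intro he
      apply h
      refine hw.pow_inj ha hb ?_
      rw [inv_pow, mul_inv_eq_one₀ (pow_ne_zero _ hw0)] at he
      exact he
    rw [geom_sum_eq hne]
    have : (w ^ a * (w⁻¹) ^ b) ^ N = 1 := by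
      rw [mul_pow, ← pow_mul, ← pow_mul, mul_comm a, mul_comm b, pow_mul, pow_mul, inv_pow,
        hw.pow_eq_one]
      simp
    rw [this, sub_self, zero_div]

/-- A finite average replaces the integral over the circle: word lengths are below `N`, so
orthogonality of characters kills exactly the terms of nonzero degree. -/
theorem sum_cuntzComb_smul {N k : ℕ} (hk : k < N) {w : ℂ} (hw : IsPrimitiveRoot w N)
    (s : Fin 2 → O) {L : List (ℂ × List (Fin 2) × List (Fin 2))} (hL : WordsBounded k L) :
    ∑ j ∈ Finset.range N, cuntzComb (fun i => w ^ j • s i) L = (N : ℂ) • cuntzDiag s L := by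
  induction L with
  | nil => simp [cuntzComb, cuntzDiag]
  | cons t L ih =>
    have hb := hL t List.mem_cons_self
    simp only [cuntzComb_cons]
    rw [Finset.sum_add_distrib, ih fun r hr => hL r (List.mem_cons_of_mem _ hr), cuntzDiag_cons,
      smul_add]
    congr 1
    simp only [cuntzWord_smul, star_smul, smul_mul_smul_comm]
    rw [← Finset.smul_sum, ← Finset.sum_smul, sum_rootOfUnity_pow (by omega) (by omega) hw]
    split_ifs
    · rw [smul_comm]
    · simp

theorem exists_gauge (hs : IsFinCEPresentation cuntzTwo s) :
    ∃ φ : Circle → O →⋆ₐ[ℂ] O, ∀ z i, φ z (s i) = (z : ℂ) • s i := by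
  have h : ∀ z : Circle, ∃ φ : O →⋆ₐ[ℂ] O, ∀ i : Fin 2, φ (s i) = (z : ℂ) • s i := fun z =>
    (hs.2 O _ ((isRepresentation_cuntzTwo_iff _).2
      (((isRepresentation_cuntzTwo_iff s).1 hs.1).smul z))).exists
  choose φ hφ using h
  exact ⟨φ, hφ⟩

/-- Orbits of rational polynomials are continuous by inspection, and contractivity of the gauge maps
makes the approximation uniform in `z`. -/
theorem continuous_gauge (hs : IsFinCEPresentation cuntzTwo s) {φ : Circle → O →⋆ₐ[ℂ] O}
    (hφ : ∀ z i, φ z (s i) = (z : ℂ) • s i) (b : O) : Continuous fun z => φ z b := by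
  refine continuous_of_uniform_approx_of_continuous fun u hu => ?_
  obtain ⟨ε, hε, hu⟩ := Metric.mem_uniformity_dist.1 hu
  have hpres : IsPresentation (G := Fin 2) s := IsUniversal.isPresentation hs
  obtain ⟨p, hp⟩ := hpres.denseRange_polyVal.exists_dist_lt b hε
  refine ⟨fun z => φ z (polyVal s p), ?_, fun z => hu ?_⟩
  · have h : ∀ z, φ z (polyVal s p) = polyVal (fun i => (z : ℂ) • s i) p := fun z => by
      rw [map_polyVal]
      simp only [hφ]
    simp only [h]
    exact (continuous_polyVal p).comp (by fun_prop)
  · rw [dist_eq_norm, ← map_sub]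
    refine (NonUnitalStarAlgHom.norm_apply_le (φ z) _).trans_lt ?_
    rwa [← dist_eq_norm]

end Gauge

/-! ### Simplicity of `𝒪₂`. -/

section Simplicity

variable {O : Type u} [CStarAlgebra O] {s : Fin 2 → O}

theorem norm_sum_le_norm_sum_of_subset {ι : Type*} {S T : Finset ι} (h : S ⊆ T) (f : ι → O) :
    ‖∑ i ∈ S, star (f i) * f i‖ ≤ ‖∑ i ∈ T, star (f i) * f i‖ := by
  let _ := CStarAlgebra.spectralOrder O
  have := CStarAlgebra.spectralOrderedRing O
  exact CStarAlgebra.norm_le_norm_of_nonneg_of_le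
    (Finset.sum_nonneg fun i _ => star_mul_self_nonneg _)
    (Finset.sum_le_sum_of_subset_of_nonneg h fun i _ _ => star_mul_self_nonneg _)

theorem exists_mem_spectrum_norm_eq [Nontrivial O] {c : O} (hc : IsSelfAdjoint c) :
    ∃ l ∈ spectrum ℂ c, ‖l‖ = ‖c‖ := by
  obtain ⟨l, hl, h⟩ := spectrum.exists_nnnorm_eq_spectralRadius c
  rw [hc.spectralRadius_eq_nnnorm] at h
  exact ⟨l, hl, congrArg NNReal.toReal (ENNReal.coe_injective h)⟩

theorem isUnit_of_norm_sub_smul_one_lt {y : O} {l : ℂ} (h : ‖y - l • (1 : O)‖ < ‖l‖) :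
    IsUnit y := by
  have hl : l ≠ 0 := norm_pos_iff.1 ((norm_nonneg _).trans_lt h)
  have h1 : ‖1 - l⁻¹ • y‖ < 1 := by
    have : 1 - l⁻¹ • y = -(l⁻¹ • (y - l • (1 : O))) := by
      rw [smul_sub, smul_smul, inv_mul_cancel₀ hl, one_smul, neg_sub]
    rw [this, norm_neg, norm_smul, norm_inv, inv_mul_lt_iff₀ (norm_pos_iff.2 hl), mul_one]
    exact h
  have h2 := isUnit_one_sub_of_norm_lt_one h1
  rw [sub_sub_cancel] at h2
  have h3 := h2.smul (Units.mk0 l hl)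
  rwa [Units.smul_mk0, smul_smul, mul_inv_cancel₀ hl, one_smul] at h3

/-- Taking the real part of a rational approximation does not increase the distance to a
self-adjoint element; `(1, 0, 1)` codes `1/2`. -/
theorem exists_selfAdjoint_approx {x : Fin 2 → O} (hx : IsPresentation x) {b : O}
    (hb : IsSelfAdjoint b) {ε : ℝ} (hε : 0 < ε) :
    ∃ p, IsSelfAdjoint (polyVal x p) ∧ ‖b - polyVal x p‖ < ε := by
  obtain ⟨q, hq⟩ := hx.denseRange_polyVal.exists_dist_lt b hε
  have h2 : gaussVal (1, 0, 1) = (1 / 2 : ℂ) := by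
    simp [gaussVal]
    norm_num
  have hv : polyVal x (polyMul (polyConst (1, 0, 1)) (q ++ polyStar q)) =
      (1 / 2 : ℂ) • (polyVal x q + star (polyVal x q)) := by
    rw [polyVal_mul, polyVal_const, polyVal_append, polyVal_star, h2, ← Algebra.smul_def]
  refine ⟨polyMul (polyConst (1, 0, 1)) (q ++ polyStar q), ?_, ?_⟩
  · rw [hv, IsSelfAdjoint, star_smul, star_add, star_star, add_comm]
    congr 1
    simp
  · have : b - (1 / 2 : ℂ) • (polyVal x q + star (polyVal x q)) =
        (1 / 2 : ℂ) • ((b - polyVal x q) + star (b - polyVal x q)) := by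
      have hb2 : b = (1 / 2 : ℂ) • (b + b) := by rw [← two_smul ℂ b, smul_smul]; norm_num
      conv_lhs => rw [hb2]
      rw [← smul_sub, star_sub, hb.star_eq]
      congr 1
      abel
    rw [hv, this, norm_smul]
    have h3 := norm_add_le (b - polyVal x q) (star (b - polyVal x q))
    rw [norm_star] at h3
    rw [dist_eq_norm] at hq
    rw [show ‖(1 / 2 : ℂ)‖ = 1 / 2 by norm_num]
    linarith

/-- Gauge averages of a nonzero positive element are bounded below uniformly in the number of
words. -/
theorem exists_gauge_lower_bound {φ : Circle → O →⋆ₐ[ℂ] O} (hφ1 : ∀ b, φ 1 b = b)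
    (hφ : ∀ b, Continuous fun z => φ z b) {a : O} (ha : a ≠ 0) :
    ∃ M : ℕ, 0 < M ∧ ∀ k : ℕ, ((k : ℝ) + 1) * (‖star a * a‖ / 2) ≤
      ‖∑ j ∈ Finset.range (M * (k + 1)),
        φ (Circle.exp (2 * Real.pi / (M * (k + 1) : ℕ) * j)) (star a * a)‖ := by
  set b := star a * a with hb
  have hb0 : 0 < ‖b‖ := by
    rw [hb, CStarRing.norm_star_mul_self]
    have := norm_pos_iff.2 ha
    positivity
  have hc : Continuous fun t : ℝ => φ (Circle.exp t) b := (hφ b).comp Circle.exp.continuous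
  obtain ⟨δ, hδ, h⟩ := Metric.continuous_iff.1 hc 0 (‖b‖ / 2) (by positivity)
  simp only [Circle.exp_zero, hφ1, dist_eq_norm, sub_zero] at h
  -- Among `M (k + 1)` equally spaced rotations, the first `k + 1` have angles below `δ` and move
  -- `b` by at most half its norm. The other summands are positive, so dropping them does not
  -- increase the norm.
  obtain ⟨M, hM⟩ := exists_nat_gt (2 * Real.pi / δ)
  have hM0 : (0 : ℝ) < M := lt_of_le_of_lt (by positivity) hM
  refine ⟨M, by exact_mod_cast hM0, fun k => ?_⟩
  have hsub : Finset.range (k + 1) ⊆ Finset.range (M * (k + 1)) := by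
    refine Finset.range_subset_range.2 ?_
    have : 0 < M := by exact_mod_cast hM0
    nlinarith
  have hmono := norm_sum_le_norm_sum_of_subset hsub
    (fun j : ℕ => φ (Circle.exp (2 * Real.pi / (M * (k + 1) : ℕ) * j)) a)
  simp only [← map_star, ← map_mul, ← hb] at hmono
  refine le_trans ?_ hmono
  have hle : ‖∑ j ∈ Finset.range (k + 1),
      (φ (Circle.exp (2 * Real.pi / (M * (k + 1) : ℕ) * j)) b - b)‖ ≤ (k + 1) * (‖b‖ / 2) := by
    refine (norm_sum_le_of_le (n := fun _ => ‖b‖ / 2) _ fun j hj => (h _ ?_).le).trans (by simp)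
    have hj' : (j : ℝ) ≤ k + 1 := by exact_mod_cast (Finset.mem_range.1 hj).le
    rw [Real.norm_of_nonneg (by positivity)]
    push_cast
    rw [div_mul_eq_mul_div, div_lt_iff₀ (by positivity)]
    rw [div_lt_iff₀ hδ] at hM
    have := Real.pi_pos
    have hk : (0 : ℝ) < (k : ℝ) + 1 := by positivity
    calc 2 * Real.pi * j ≤ 2 * Real.pi * (k + 1) := by gcongr
      _ < M * δ * (k + 1) := by gcongr
      _ = δ * (M * (k + 1)) := by ring
  rw [Finset.sum_sub_distrib] at hle
  have h3 : ‖∑ j ∈ Finset.range (k + 1), b‖ = (k + 1) * ‖b‖ := by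
    rw [Finset.sum_const, Finset.card_range, ← Nat.cast_smul_eq_nsmul ℝ, norm_smul]
    push_cast
    rw [Real.norm_of_nonneg (by positivity)]
  have h4 := norm_sub_norm_le (∑ j ∈ Finset.range (k + 1), b) (∑ j ∈ Finset.range (k + 1),
    φ (Circle.exp (2 * Real.pi / (M * (k + 1) : ℕ) * j)) b)
  rw [norm_sub_rev, h3] at h4
  linarith

theorem one_mem_of_ne_zero_mem [Nontrivial O] (hs : IsFinCEPresentation cuntzTwo s)
    {I : TwoSidedIdeal O} {a : O} (ha : a ∈ I) (ha0 : a ≠ 0) : (1 : O) ∈ I := by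
  have hp : IsPresentation (G := Fin 2) s := IsUniversal.isPresentation hs
  have hC : IsCuntzPair s := (isRepresentation_cuntzTwo_iff s).1 hs.1
  obtain ⟨φ, hφ⟩ := exists_gauge hs
  have hcont := continuous_gauge hs hφ
  have hφ1 : ∀ b, φ 1 b = b := by
    have h := hs.2 O s hs.1
    have h1 : φ 1 = StarAlgHom.id ℂ O := h.unique (fun i => by simpa using hφ 1 i) fun i => rfl
    intro b
    rw [h1]
    rfl
  obtain ⟨M, hM, hlow⟩ := exists_gauge_lower_bound hφ1 hcont ha0
  set b := star a * a with hb
  have hbI : b ∈ I := I.mul_mem_left _ _ ha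
  have hb0 : 0 < ‖b‖ := by
    rw [hb, CStarRing.norm_star_mul_self]
    have := norm_pos_iff.2 ha0
    positivity
  have hMR : (0 : ℝ) < M := by exact_mod_cast hM
  -- The averages of `b` have norm at least `‖b‖ / (2 M) = 3 ε`, where `M` is fixed before the
  -- approximating polynomial and its word length. An error `ε` then leaves at least `2 ε` for the
  -- averaged polynomial.
  set ε : ℝ := ‖b‖ / (6 * M) with hε
  have hε0 : 0 < ε := by positivity
  obtain ⟨p, hpsa, hpb⟩ := exists_selfAdjoint_approx hp (IsSelfAdjoint.star_mul_self a) hε0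
  rw [← hb] at hpb
  obtain ⟨L, hL⟩ := hC.exists_cuntzComb p
  obtain ⟨k, hk⟩ := exists_wordsBounded L
  set N : ℕ := M * (k + 1) with hN
  have hkN : k < N := by nlinarith
  have hNR : (0 : ℝ) < N := by exact_mod_cast (by omega : 0 < N)
  have hw : IsPrimitiveRoot (Complex.exp (2 * Real.pi * Complex.I / N)) N :=
    Complex.isPrimitiveRoot_exp N (by omega)
  have hsum : ∑ j ∈ Finset.range N, φ (Circle.exp (2 * Real.pi / N * j)) (polyVal s p) =
      (N : ℂ) • cuntzDiag s L := by
    rw [← sum_cuntzComb_smul hkN hw s hk]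
    refine Finset.sum_congr rfl fun j _ => ?_
    have he : (fun i => φ (Circle.exp (2 * Real.pi / N * j)) (s i)) =
        fun i => Complex.exp (2 * Real.pi * Complex.I / N) ^ j • s i := by
      funext i
      rw [hφ, Circle.coe_exp, ← Complex.exp_nat_mul]
      congr 2
      push_cast
      ring
    rw [hL, map_cuntzComb, he]
  have hNc : ((N : ℂ)) ≠ 0 := by exact_mod_cast hNR.ne'
  have hsa : IsSelfAdjoint (cuntzDiag s L) := by
    have h1 : IsSelfAdjoint ((N : ℂ) • cuntzDiag s L) := by
      rw [← hsum]
      exact isSelfAdjoint_sum _ fun j _ => hpsa.map _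
    rw [IsSelfAdjoint, star_smul, star_natCast] at h1
    exact smul_right_injective _ hNc h1
  have hnorm : ε < ‖cuntzDiag s L‖ := by
    have h1 : ‖∑ j ∈ Finset.range N, φ (Circle.exp (2 * Real.pi / N * j)) (b - polyVal s p)‖ ≤
        N * ε :=
      (norm_sum_le_of_le (n := fun _ => ε) _ fun j _ =>
        (NonUnitalStarAlgHom.norm_apply_le _ _).trans hpb.le).trans (by simp)
    simp only [map_sub, Finset.sum_sub_distrib] at h1
    rw [hsum] at h1
    have h2 := norm_sub_norm_le (∑ j ∈ Finset.range N, φ (Circle.exp (2 * Real.pi / N * j)) b)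
      ((N : ℂ) • cuntzDiag s L)
    have h3 : ‖(N : ℂ) • cuntzDiag s L‖ = N * ‖cuntzDiag s L‖ := by simp [norm_smul]
    have h4 : ((k : ℝ) + 1) * (‖b‖ / 2) = N * (3 * ε) := by
      rw [hε, hN]
      push_cast
      field_simp
      ring
    have h5 := hlow k
    rw [h4] at h5
    rw [h3] at h2
    have h6 : N * (2 * ε) ≤ N * ‖cuntzDiag s L‖ := by linarith
    linarith [le_of_mul_le_mul_left h6 hNR]
  obtain ⟨l, hl, hlc⟩ := exists_mem_spectrum_norm_eq hsa
  obtain ⟨X, r, hr, hXX, hXp⟩ := hC.exists_compress hk hl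
  -- The compression of `b` is within `ε r` of the scalar `l r`, and `ε < |l|`.
  have hu : IsUnit (star X * b * X) := by
    refine isUnit_of_norm_sub_smul_one_lt (l := l * r) ?_
    have hX : ‖X‖ * ‖X‖ = r := by
      rw [← CStarRing.norm_star_mul_self, hXX, norm_smul, CStarRing.norm_one]
      simp [abs_of_pos hr]
    rw [← hXp, ← hL, ← sub_mul, ← mul_sub, norm_mul l, hlc, Complex.norm_real,
      Real.norm_of_nonneg hr.le]
    calc ‖star X * (b - polyVal s p) * X‖ ≤ ‖X‖ * ε * ‖X‖ := by
          refine (norm_mul_le _ _).trans ?_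
          gcongr
          refine (norm_mul_le _ _).trans ?_
          rw [norm_star]
          gcongr
      _ = ε * r := by rw [← hX]; ring
      _ < ‖cuntzDiag s L‖ * r := by gcongr
  obtain ⟨y, hy⟩ := hu.exists_right_inv
  rw [← hy]
  exact I.mul_mem_right _ _ (I.mul_mem_right _ _ (I.mul_mem_left _ _ hbI))

theorem isSimpleCStar_of_cuntzTwo [Nontrivial O] (hs : IsFinCEPresentation cuntzTwo s) :
    IsSimpleCStar O := by
  refine ⟨inferInstance, fun I _ => ?_⟩
  by_cases h : ∃ a ∈ I, a ≠ 0
  · obtain ⟨a, ha, ha0⟩ := h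
    exact .inr ((TwoSidedIdeal.one_mem_iff I).1 (one_mem_of_ne_zero_mem hs ha ha0))
  · push Not at h
    refine .inl (le_bot_iff.1 fun a ha => ?_)
    exact (TwoSidedIdeal.mem_bot _).2 (h a ha)

theorem IsLocallyUniversal.nontrivial (h : IsLocallyUniversal O) : Nontrivial O := by
  -- A copy of `ℂ` in universe `u` serves as the nonzero test algebra.
  obtain ⟨U, -, φ, hφ⟩ := h C(PUnit.{u + 1}, ℂ)
  by_contra hO
  rw [not_nontrivial_iff_subsingleton] at hO
  have h1 : (1 : ℕ →ᵇ O) = 0 := by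
    ext n
    exact Subsingleton.elim _ _
  have h2 : (1 : Ultrapower U O) = 0 := congrArg (nullIdeal U O).ringCon.mk' h1
  have h3 : φ 1 = φ 0 := by rw [map_one, map_zero, h2]
  exact one_ne_zero (hφ h3)

end Simplicity

end CStarPres

/-! ### The corollary. -/

theorem mainTheorem3 :
    ((∃ (B : Type u) (_ : CStarAlgebra B), CStarPres.IsSimpleCStar B ∧
        CStarPres.IsLocallyUniversal B ∧ CStarPres.HasCEPresentation B) →
      ∀ (A : Type u) [CStarAlgebra A] (P : CStarPres.FinPresData) (x : Fin P.numGens → A),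
        CStarPres.IsComputablyWeaklyStable P x → CStarPres.IsComputablePresentation x) ∧
    (CStarPres.KirchbergEmbedding.{u} →
      ∃ (B : Type u) (_ : CStarAlgebra B), CStarPres.IsSimpleCStar B ∧
        CStarPres.IsLocallyUniversal B ∧ CStarPres.HasCEPresentation B) := by
  refine ⟨?_, ?_⟩
  · rintro ⟨B, _, hs, hl, hc⟩ A _ P x hx
    exact hx.isComputablePresentation hs hl hc
  · rintro ⟨O, _, s, hs, hl⟩
    have := hl.nontrivial
    exact ⟨O, _, CStarPres.isSimpleCStar_of_cuntzTwo hs, hl, Fin 2, inferInstance, _, s,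
      hs.isCEPresentation⟩
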